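/- Let $\Bbbk$ be a field, $m\ge N\ge 2$, $n\ge 1$, let $V$ be a $\Bbbk$-vector space with basis $v_1,\dots,v_n$ and dual basis $\theta_1,\dots,\theta_n$ of $V^*$. Let $\mathsf e:V^{\otimes m}\to\Bbbk$ and $\mathsf f:(V^*)^{\otimes m}\to\Bbbk$ be preregular $m$-linear forms, i.e. nondegenerate in the first argument and satisfying $\mathsf t(z_1,\dots,z_m)=\mathsf t(\phi z_m,z_1,\dots,z_{m-1})$ for some invertible linear $\phi$. Write $\mathsf e_{i_1\cdots i_m}=\mathsf e(v_{i_1},\dots,v_{i_m})$ and $\mathsf f_{i_1\cdots i_m}=\mathsf f(\theta_{i_1},\dots,\theta_{i_m})$, and put $$A(\mathsf e,N)=\Bbbk\langle x_1,\dots,x_n\rangle\Big/\Big(\sum_{j_1,\dots,j_N}\mathsf e_{\lambda_1\cdots\lambda_{m-N}j_1\cdots j_N}x_{j_1}\cdots x_{j_N}\ :\ 1\le\lambda_1,\dots,\lambda_{m-N}\le n\Big),$$ and define $A(\mathsf f,N)$, with generators $y_1,\dots,y_n$, in the same way from $\mathsf f$. Assume that $A(\mathsf e,N)$ and $A(\mathsf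 f,N)$ are $N$-Koszul and Artin–Schelter regular of global dimension $d$, and that $m$ is the internal degree of the last term of their $N$-Koszul resolutions: $m=\nu_N(d)$ where $\nu_N(2i)=Ni$ and $\nu_N(2i+1)=Ni+1$ (so $m=d$ if $N=2$). Let $\mathcal O(M)=\mathcal O_{A(\mathsf e,N),A(\mathsf f,N)}(M)$ be the bialgebra generated by $z_{ij}$ ($1\le i,j\le n$) with relations $$\sum_{i,j}\mathsf e_{\lambda_1\cdots\lambda_{m-N}i_1\cdots i_N}\,\mu_{j_1\cdots j_N}\,z_{i_1j_1}\cdots z_{i_Nj_N}=0,\qquad \sum_{i,j}\mathsf f_{\lambda_1\cdots\lambda_{m-N}j_1\cdots j_N}\,\nu_{i_1\cdots i_N}\,z_{i_1j_1}\cdots z_{i_Nj_N}=0$$ for all $\lambda$, all $\mu$ with $\sum_i\mathsf e_{\lambda' i}\mu_i=0$ for every $\lambda'$, and all $\nu$ with $\sum_j\mathsf f_{\lambda' j}\nu_j=0$ for every $\lambda'$, and with $\Delta(z_{ij})=\sum_k z_{ik}\otimes z_{kj}$, $\varepsilon(z_{ij})=\delta_{ij}$. For any $j,j'$ with $\mathsf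 e_{j_1\cdots j_m}\ne0$ and $\mathsf f_{j'_1\cdots j'_m}\ne0$ let $$g_1=\frac1{\mathsf e_{j_1\cdots j_m}}\sum_i\mathsf e_{i_1\cdots i_m}z_{i_1j_1}\cdots z_{i_mj_m},\qquad g_2=\frac1{\mathsf f_{j'_1\cdots j'_m}}\sum_i\mathsf f_{i_1\cdots i_m}z_{j'_1i_1}\cdots z_{j'_mi_m}.$$ A Hopf algebra $K$ coacts on the pair in a balanced fashion if $A(\mathsf e,N)$ is a left and $A(\mathsf f,N)$ a right $K$-comodule algebra with $\rho^\ell(x_i)=\sum_j a_{ij}\otimes x_j$ and $\rho^r(y_j)=\sum_i y_i\otimes a_{ij}$ for common elements $a_{ij}\in K$. Let $\mathcal O(GL)=\mathcal O_{A(\mathsf e,N),A(\mathsf f,N)}(GL)$ be the universal Hopf algebra with a balanced coaction, and $\mathcal O(SL)=\mathcal O_{A(\mathsf e,N),A(\mathsf f,N)}(SL)$ the universal Hopf algebra with a balanced coaction such that both coactions have trivial homological codeterminant (the induced coactions on $\mathrm{Ext}^d(\Bbbk,\Bbbk)$ over $A(\mathsf e,N)$ and over $A(\mathsf f,N)$ are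 trivial); universality means that every other such Hopf algebra $K$ receives a unique Hopf algebra map from it that carries its coactions to those of $K$. (a) Let $G$ be the multiplicative set generated by $g_1,g_2$. If $G$ is a (right) Ore set of $\mathcal O(M)$ (so that the ring of fractions $\mathcal O(M)G^{-1}$ exists), then $\mathcal O(M)G^{-1}$ is a Hopf algebra such that the localization map is a bialgebra map, $\mathcal O(GL)$ exists, and $\mathcal O(GL)\cong\mathcal O(M)G^{-1}$ as Hopf algebras, where the elements $a_{ij}$ of the universal balanced coaction correspond to the images of the $z_{ij}$. (b) $\mathcal O(M)/(g_1-1,g_2-1)$ is a Hopf algebra such that the quotient map is a bialgebra map, $\mathcal O(SL)$ exists, and $\mathcal O(SL)\cong\mathcal O(M)/(g_1-1,g_2-1)$ as Hopf algebras, where the elements $a_{ij}$ of the universal balanced coaction correspond to the images of the $z_{ij}$. -/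

import Mathlib

open scoped TensorProduct

universe u v

/-! ## Multi-indices and words -/

section Words

/-- Concatenation `u₁ … u_{ℓ-p} v₁ … v_p` of two multi-indices, of total length `ℓ` (for `p ≤ ℓ`). -/
def glue {X : Type*} {ℓ p : ℕ} (u : Fin (ℓ - p) → X) (w : Fin p → X) : Fin ℓ → X := fun q =>
  if h : (q : ℕ) < ℓ - p then u ⟨q, h⟩ else w ⟨(q : ℕ) - (ℓ - p), by omega⟩

/-- The multi-index `i` with the `N` consecutive entries at positions `p, …, p + N - 1` replaced
by those of `j`. -/
def splice {X : Type*} {ℓ N : ℕ} (i : Fin ℓ → X) (p : ℕ) (j : Fin N → X) : Fin ℓ → X := fun q =>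
  if h : p ≤ (q : ℕ) ∧ (q : ℕ) < p + N then j ⟨(q : ℕ) - p, by omega⟩ else i q

/-- The ordered product `x_{j₁} ⋯ x_{j_N}` in a possibly noncommutative ring. -/
def word {B : Type*} [Monoid B] {X : Type*} {N : ℕ} (x : X → B) (j : Fin N → X) : B :=
  (List.ofFn fun q => x (j q)).prod

/-- The ordered product `z_{i₁ j₁} ⋯ z_{i_N j_N}`. -/
def word₂ {B : Type*} [Monoid B] {X : Type*} {N : ℕ} (z : X → X → B) (i j : Fin N → X) : B :=
  (List.ofFn fun q => z (i q) (j q)).prod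

end Words

/-! ## Preregular forms -/

section Forms

variable {k : Type u} [Field k]

/-- An `m`-linear form `t` on `Z` is preregular if it is nondegenerate in its first argument and
`t(z₁, …, z_m) = t(φ z_m, z₁, …, z_{m-1})` for some `φ ∈ GL(Z)`.
(For the index `0 : Fin m` one has `0 - 1 = m - 1`, the last index.) -/
structure IsPreregular {Z : Type v} [AddCommGroup Z] [Module k Z] {m : ℕ} [NeZero m]
    (t : MultilinearMap k (fun _ : Fin m => Z) k) : Prop where
  nondegenerate : ∀ z₁ : Z, (∀ z : Fin m → Z, z 0 = z₁ → t z = 0) → z₁ = 0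
  cyclic : ∃ φ : Z ≃ₗ[k] Z, ∀ z : Fin m → Z,
    t z = t (fun i => if i = 0 then φ (z (i - 1)) else z (i - 1))

/-- The coefficients `e_{i₁ ⋯ i_m} = e(v_{i₁}, …, v_{i_m})` of a form on `V`. -/
noncomputable def coeffs {V : Type v} [AddCommGroup V] [Module k V] {n m : ℕ} (b : Module.Basis (Fin n) k V)
    (e : MultilinearMap k (fun _ : Fin m => V) k) (i : Fin m → Fin n) : k :=
  e (fun q => b (i q))

/-- The coefficients `f_{i₁ ⋯ i_m} = f(θ_{i₁}, …, θ_{i_m})` of a form on `V*`, with respect to the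
dual basis `θ` of `V*`. -/
noncomputable def dualCoeffs {V : Type v} [AddCommGroup V] [Module k V] {n m : ℕ} (b : Module.Basis (Fin n) k V)
    (f : MultilinearMap k (fun _ : Fin m => Module.Dual k V) k) (i : Fin m → Fin n) : k :=
  f (fun q => b.coord (i q))

end Forms

/-! ## Superpotential algebras -/

section Superpotential

variable {k : Type u} [Field k] {n m : ℕ}

/-- The relation space `R = ∂^{m-N}(k c)`, spanned by the coefficient vectors
`(c_{λ₁ ⋯ λ_{m-N} j₁ ⋯ j_N})_j`. -/
def relSpace (c : (Fin m → Fin n) → k) (N : ℕ) : Submodule k ((Fin N → Fin n) → k) :=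
  Submodule.span k (Set.range fun (lam : Fin (m - N) → Fin n) (j : Fin N → Fin n) =>
    c (glue lam j))

/-- The annihilator `R^⊥` of the relation space. -/
def IsAnnihilating (c : (Fin m → Fin n) → k) {N : ℕ} (μ : (Fin N → Fin n) → k) : Prop :=
  ∀ lam : Fin (m - N) → Fin n, ∑ j : Fin N → Fin n, c (glue lam j) * μ j = 0

/-- The defining relations `∑_j c_{λ j} x_{j₁} ⋯ x_{j_N} = 0`. -/
inductive SPRel (c : (Fin m → Fin n) → k) (N : ℕ) :
    FreeAlgebra k (Fin n) → FreeAlgebra k (Fin n) → Prop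
  | rel (lam : Fin (m - N) → Fin n) : SPRel c N
      (∑ j : Fin N → Fin n, c (glue lam j) • word (FreeAlgebra.ι k) j) 0

/-- The superpotential algebra `A(c, N)` with generators `x₁, …, x_n`. -/
def SPAlg (c : (Fin m → Fin n) → k) (N : ℕ) : Type u := RingQuot (SPRel c N)

noncomputable instance (c : (Fin m → Fin n) → k) (N : ℕ) : Ring (SPAlg c N) :=
  inferInstanceAs (Ring (RingQuot (SPRel c N)))

noncomputable instance (c : (Fin m → Fin n) → k) (N : ℕ) : Algebra k (SPAlg c N) :=
  inferInstanceAs (Algebra k (RingQuot (SPRel c N)))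

/-- The generators `x_i`. -/
noncomputable def SPAlg.x (c : (Fin m → Fin n) → k) (N : ℕ) (i : Fin n) : SPAlg c N :=
  RingQuot.mkAlgHom k (SPRel c N) (FreeAlgebra.ι k i)

lemma word_zero {B : Type*} [MonoidWithZero B] {X : Type*} {N : ℕ} (hN : N ≠ 0) (j : Fin N → X) :
    word (fun _ : X => (0 : B)) j = 0 := by
  obtain ⟨N, rfl⟩ := Nat.exists_eq_succ_of_ne_zero hN
  simp [word]

lemma map_word {B C F : Type*} [Monoid B] [Monoid C] [FunLike F B C] [MonoidHomClass F B C]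
    {X : Type*} {N : ℕ} (φ : F) (x : X → B) (j : Fin N → X) :
    φ (word x j) = word (fun i => φ (x i)) j := by
  simp [word, map_list_prod, List.map_ofFn, Function.comp_def]

/-- The augmentation `A(c, N) → k` killing the generators (for `N ≥ 1`). -/
noncomputable def SPAlg.aug (c : (Fin m → Fin n) → k) (N : ℕ) [NeZero N] : SPAlg c N →ₐ[k] k :=
  RingQuot.liftAlgHom k ⟨FreeAlgebra.lift k (fun _ => (0 : k)), by
    rintro _ _ ⟨lam⟩
    simp [map_sum, map_word, word_zero (NeZero.ne N)]⟩

end Superpotential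

/-! ## `N`-Koszulity -/

section Koszul

variable {k : Type u} [Field k] {n m : ℕ}

/-- The internal degree `ν(i)` of the `i`-th term of the Koszul complex:
`ν(2j) = N j`, `ν(2j+1) = N j + 1`. -/
def koszulDegree (N i : ℕ) : ℕ := N * (i / 2) + i % 2

/-- The space `W_ℓ = ⋂_{s+N+t=ℓ} Z^{⊗s} ⊗ R ⊗ Z^{⊗t} ⊆ Z^{⊗ℓ}`, in coordinates
(all of `Z^{⊗ℓ}` if `ℓ < N`). -/
def koszulSpace (c : (Fin m → Fin n) → k) (N ℓ : ℕ) : Submodule k ((Fin ℓ → Fin n) → k) where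
  carrier := {w | ∀ p : ℕ, p + N ≤ ℓ → ∀ i : Fin ℓ → Fin n,
    (fun j : Fin N → Fin n => w (splice i p j)) ∈ relSpace c N}
  zero_mem' _ _ _ := Submodule.zero_mem _
  add_mem' ha hb p hp i := Submodule.add_mem _ (ha p hp i) (hb p hp i)
  smul_mem' r _ ha p hp i := Submodule.smul_mem _ r (ha p hp i)

/-- `A ⊗ W_ℓ` as a left `A`-submodule of `A ⊗ Z^{⊗ℓ}`, in coordinates. -/
noncomputable def koszulTerm (c : (Fin m → Fin n) → k) (N ℓ : ℕ) :
    Submodule (SPAlg c N) ((Fin ℓ → Fin n) → SPAlg c N) :=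
  Submodule.span (SPAlg c N)
    {F | ∃ w ∈ koszulSpace c N ℓ, F = fun i => algebraMap k (SPAlg c N) (w i)}

/-- The map `A ⊗ Z^{⊗a} → A ⊗ Z^{⊗b}` (for `b ≤ a`) that multiplies the first `a - b` tensor
factors into `A`. -/
noncomputable def koszulDiff (c : (Fin m → Fin n) → k) (N a b : ℕ)
    (F : (Fin a → Fin n) → SPAlg c N) : (Fin b → Fin n) → SPAlg c N := fun j =>
  ∑ i : Fin (a - b) → Fin n, F (glue i j) * word (SPAlg.x c N) i

/-- `A(c, N)` is `N`-Koszul: the Koszul complex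
`⋯ → A ⊗ W_{2N} → A ⊗ W_{N+1} → A ⊗ W_N → A ⊗ W_1 → A` of left modules, whose differentials are
alternately the `1`-fold and `(N-1)`-fold multiplication, is exact in positive degrees. -/
def IsNKoszul (c : (Fin m → Fin n) → k) (N : ℕ) : Prop :=
  ∀ i : ℕ, ∀ F ∈ koszulTerm c N (koszulDegree N (i + 1)),
    koszulDiff c N (koszulDegree N (i + 1)) (koszulDegree N i) F = 0 →
    ∃ G ∈ koszulTerm c N (koszulDegree N (i + 2)),
      koszulDiff c N (koszulDegree N (i + 2)) (koszulDegree N (i + 1)) G = F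

end Koszul

/-! ## Artin–Schelter regularity -/

section ASRegular

open CategoryTheory CategoryTheory.Abelian

variable {k : Type u} [Field k] {A : Type u} [Ring A] [Algebra k A]

/-- The one-dimensional left `A`-module given by an augmentation of `A`. -/
noncomputable abbrev trivialModule (ε : A →ₐ[k] k) : ModuleCat.{u} A :=
  (ModuleCat.restrictScalars.{u} ε.toRingHom).obj (ModuleCat.of k k)

/-- The left global dimension of a ring. -/
noncomputable def leftGlobalDimension (A : Type u) [Ring A] : WithBot ℕ∞ :=
  ⨆ M : ModuleCat.{u} A, projectiveDimension M

/-- The left-module half of Artin–Schelter regularity of dimension `d`: left global dimension `d`,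
left self-injective dimension `d`, `Ext^i_A(k, A) = 0` for `i ≠ d` and `Ext^d_A(k, A) ≅ k`. -/
structure IsLeftASRegular (ε : A →ₐ[k] k) (d : ℕ) : Prop where
  globalDimension : leftGlobalDimension A = d
  injectiveDimension : injectiveDimension (ModuleCat.of A A : ModuleCat.{u} A) = d
  ext_eq_zero : ∀ i : ℕ, i ≠ d →
    Subsingleton (Ext.{u} (trivialModule ε) (ModuleCat.of A A : ModuleCat.{u} A) i)
  ext_top : Module.finrank k
    (Ext.{u} (trivialModule ε) (ModuleCat.of A A : ModuleCat.{u} A) d) = 1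

/-- The augmentation of the opposite algebra. -/
noncomputable def augOp (ε : A →ₐ[k] k) : Aᵐᵒᵖ →ₐ[k] k :=
  AlgHom.ofLinearMap (ε.toLinearMap ∘ₗ (MulOpposite.opLinearEquiv k).symm.toLinearMap)
    (by simp) (by intro x y; simp [mul_comm])

/-- Artin–Schelter regularity of dimension `d` of an augmented algebra, on both sides
(right modules are modules over the opposite algebra). -/
structure IsASRegular (ε : A →ₐ[k] k) (d : ℕ) : Prop where
  left : IsLeftASRegular ε d
  right : IsLeftASRegular (augOp ε) d

end ASRegular

/-! ## The coaction on `Ext`, and trivial homological codeterminant -/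

section Codeterminant

open CategoryTheory CategoryTheory.Abelian
open scoped ModuleCat

variable {k : Type u} [Field k] {A K : Type u} [Ring A] [Algebra k A] [Ring K] [Algebra k K]

/-- The action of `A` on `K ⊗ M` through an algebra map `ρ : A → K ⊗ A`, that is
`a · (h ⊗ x) = ∑ a₍₋₁₎ h ⊗ a₍₀₎ x`. -/
noncomputable def twistAction (ρ : A →ₐ[k] K ⊗[k] A) (M : ModuleCat.{u} A) :
    A →ₐ[k] Module.End k (K ⊗[k] M) :=
  (Module.endTensorEndAlgHom (R := k) (S := k) (A := k) (M := K) (N := M)).comp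
    ((Algebra.TensorProduct.map (Algebra.lmul k K) (Algebra.lsmul k k M)).comp ρ)

/-- The `A`-module `K ⊗ M`, on which `A` acts through `ρ : A → K ⊗ A`. -/
def TwistModule (_ρ : A →ₐ[k] K ⊗[k] A) (M : ModuleCat.{u} A) : Type u := K ⊗[k] M

noncomputable instance (ρ : A →ₐ[k] K ⊗[k] A) (M : ModuleCat.{u} A) :
    AddCommGroup (TwistModule ρ M) :=
  inferInstanceAs (AddCommGroup (K ⊗[k] M))

noncomputable instance (ρ : A →ₐ[k] K ⊗[k] A) (M : ModuleCat.{u} A) :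
    Module A (TwistModule ρ M) :=
  letI : Module (Module.End k (K ⊗[k] M)) (TwistModule ρ M) :=
    inferInstanceAs (Module (Module.End k (K ⊗[k] M)) (K ⊗[k] M))
  Module.compHom _ (twistAction ρ M).toRingHom

/-- The pure tensor `h ⊗ x`. -/
noncomputable def TwistModule.tmul (ρ : A →ₐ[k] K ⊗[k] A) (M : ModuleCat.{u} A) (h : K) (x : M) :
    TwistModule ρ M := (h ⊗ₜ[k] x : K ⊗[k] M)

lemma twist_smul (ρ : A →ₐ[k] K ⊗[k] A) (M : ModuleCat.{u} A) (a : A) (x : K ⊗[k] M) :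
    (show K ⊗[k] M from a • (show TwistModule ρ M from x)) = twistAction ρ M a x := rfl

lemma twist_map_smul (ρ : A →ₐ[k] K ⊗[k] A) {M M' : ModuleCat.{u} A} (f : M ⟶ M') (a : A)
    (x : K ⊗[k] M) :
    (f.hom.restrictScalars k).lTensor K (twistAction ρ M a x) =
      twistAction ρ M' a ((f.hom.restrictScalars k).lTensor K x) := by
  simp only [twistAction, AlgHom.comp_apply]
  induction ρ a using TensorProduct.induction_on with
  | zero => simp
  | add s t hs ht => simp only [map_add, LinearMap.add_apply, hs, ht]
  | tmul h b =>
    induction x using TensorProduct.induction_on with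
    | zero => simp
    | add s t hs ht => simp only [map_add, hs, ht]
    | tmul h' y => simp [Module.endTensorEndAlgHom_apply]

/-- The map `id_K ⊗ f : K ⊗ M → K ⊗ M'` as an `A`-linear map. -/
noncomputable def twistMap (ρ : A →ₐ[k] K ⊗[k] A) {M M' : ModuleCat.{u} A} (f : M ⟶ M') :
    TwistModule ρ M →ₗ[A] TwistModule ρ M' where
  toFun := (f.hom.restrictScalars k).lTensor K
  map_add' := map_add ((f.hom.restrictScalars k).lTensor K)
  map_smul' a x := twist_map_smul ρ f a x

/-- The functor `M ↦ K ⊗ M` from left `A`-modules to left `A`-modules, where `A` acts on `K ⊗ M`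
through `ρ : A → K ⊗ A`. -/
noncomputable def twist (ρ : A →ₐ[k] K ⊗[k] A) : ModuleCat.{u} A ⥤ ModuleCat.{u} A where
  obj M := ModuleCat.of A (TwistModule ρ M)
  map f := ModuleCat.ofHom (twistMap ρ f)
  map_id M := by
    apply ModuleCat.hom_ext
    ext x
    exact LinearMap.congr_fun (LinearMap.lTensor_id K M) x
  map_comp {M M' M''} f g := by
    apply ModuleCat.hom_ext
    ext x
    exact LinearMap.congr_fun
      (LinearMap.lTensor_comp K (g.hom.restrictScalars k) (f.hom.restrictScalars k)) x

instance (ρ : A →ₐ[k] K ⊗[k] A) : (twist ρ).Additive where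
  map_add {M M' f g} := by
    apply ModuleCat.hom_ext
    ext x
    exact LinearMap.congr_fun
      (LinearMap.lTensor_add K (f.hom.restrictScalars k) (g.hom.restrictScalars k)) x

lemma twist_shortExact (ρ : A →ₐ[k] K ⊗[k] A) (S : ShortComplex (ModuleCat.{u} A))
    (hS : S.ShortExact) : (S.map (twist ρ)).ShortExact := by
  have h1 : Function.Injective (S.f.hom.restrictScalars k) := hS.moduleCat_injective_f
  have h2 : Function.Surjective (S.g.hom.restrictScalars k) := hS.moduleCat_surjective_g
  have h3 : Function.Exact (S.f.hom.restrictScalars k) (S.g.hom.restrictScalars k) :=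
    (ShortComplex.ShortExact.moduleCat_exact_iff_function_exact S).mp hS.exact
  refine ModuleCat.shortComplex_shortExact _ ?_ ?_ ?_
  · exact lTensor_exact K h3 h2
  · exact Module.Flat.lTensor_preserves_injective_linearMap _ h1
  · exact LinearMap.lTensor_surjective K h2

instance (ρ : A →ₐ[k] K ⊗[k] A) : Limits.PreservesFiniteLimits (twist ρ) := by
  have h := ((Functor.exact_tfae (twist ρ)).out 0 3).mp (twist_shortExact ρ)
  exact h.1

instance (ρ : A →ₐ[k] K ⊗[k] A) : Limits.PreservesFiniteColimits (twist ρ) := by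
  have h := ((Functor.exact_tfae (twist ρ)).out 0 3).mp (twist_shortExact ρ)
  exact h.2

/-- The coaction of `K` on `Ext^d_A(k, k)` induced by a coaction `ρ : A → K ⊗ A` that preserves the
augmentation `ε` is trivial. Here `k → K ⊗ k`, `c ↦ 1 ⊗ c`, is `A`-linear, the induced coaction
`Ext^d_A(k, k) → Ext^d_A(k, K ⊗ k) = K ⊗ Ext^d_A(k, k)` applies the exact functor `K ⊗ -` and
restricts along `k → K ⊗ k`, and the trivial coaction `x ↦ 1 ⊗ x` is composition with
`k → K ⊗ k`. -/
def ActsTriviallyOnExt (ρ : A →ₐ[k] K ⊗[k] A) (ε : A →ₐ[k] k) (d : ℕ) : Prop :=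
  ∃ ι : trivialModule ε ⟶ (twist ρ).obj (trivialModule ε),
    (∀ c : k, ι.hom c = TwistModule.tmul ρ (trivialModule ε) 1 c) ∧
    ∀ y : Ext.{u} (trivialModule ε) (trivialModule ε) d,
      (Ext.mk₀ ι).comp (y.mapExactFunctor (twist ρ)) (zero_add d) =
        y.comp (Ext.mk₀ ι) (add_zero d)

end Codeterminant

/-! ## The balanced bialgebra `O(M)` -/

section Bialgebra

variable {k : Type u} [Field k] {n m : ℕ}

lemma map_word₂ {B C F : Type*} [Monoid B] [Monoid C] [FunLike F B C] [MonoidHomClass F B C]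
    {X : Type*} {N : ℕ} (φ : F) (z : X → X → B) (i j : Fin N → X) :
    φ (word₂ z i j) = word₂ (fun a b => φ (z a b)) i j := by
  simp [word₂, map_list_prod, List.map_ofFn, Function.comp_def]

lemma word₂_comul {B C : Type*} [Ring B] [Algebra k B] [Ring C] [Algebra k C]
    {X : Type*} [Fintype X] (z : X → X → B) (z' : X → X → C) {N : ℕ} (i j : Fin N → X) :
    word₂ (fun a b => ∑ c, z a c ⊗ₜ[k] z' c b) i j =
      ∑ c : Fin N → X, word₂ z i c ⊗ₜ[k] word₂ z' c j := by
  induction N with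
  | zero => simp [word₂, Algebra.TensorProduct.one_def]
  | succ N ih =>
    have h := ih (fun q => i q.succ) (fun q => j q.succ)
    simp only [word₂] at h ⊢
    rw [List.ofFn_succ, List.prod_cons, h, Finset.sum_mul_sum, ← Finset.sum_product',
      ← (Fin.consEquiv fun _ : Fin (N + 1) => X).sum_comp]
    refine Finset.sum_congr rfl fun c _ => ?_
    simp [List.ofFn_succ, Fin.consEquiv]

lemma sum_word₂_comul {B C : Type*} [Ring B] [Algebra k B] [Ring C] [Algebra k C]
    {X : Type*} [Fintype X] (z : X → X → B) (z' : X → X → C) {N : ℕ} (s t : (Fin N → X) → k) :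
    ∑ i, ∑ j, (s i * t j) • word₂ (fun a b => ∑ c, z a c ⊗ₜ[k] z' c b) i j =
      ∑ c : Fin N → X, (∑ i, s i • word₂ z i c) ⊗ₜ[k] (∑ j, t j • word₂ z' c j) := by
  simp only [word₂_comul, TensorProduct.sum_tmul, TensorProduct.tmul_sum, Finset.smul_sum]
  conv_lhs =>
    enter [2, i]
    rw [Finset.sum_comm]
  rw [Finset.sum_comm]
  refine Finset.sum_congr rfl fun c _ => ?_
  conv_rhs => rw [Finset.sum_comm]
  refine Finset.sum_congr rfl fun i _ => Finset.sum_congr rfl fun j _ => ?_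
  rw [TensorProduct.smul_tmul_smul]

lemma word₂_delta {X : Type*} [Fintype X] [DecidableEq X] {N : ℕ} (i j : Fin N → X) :
    word₂ (fun a b : X => if a = b then (1 : k) else 0) i j = if i = j then 1 else 0 := by
  rw [word₂, List.prod_ofFn]
  by_cases h : i = j
  · simp [h]
  · obtain ⟨q, hq⟩ := Function.ne_iff.mp h
    rw [if_neg h]
    exact Finset.prod_eq_zero (Finset.mem_univ q) (by simp [hq])

lemma sum_tmul_eq_zero {I : Type*} [Fintype I] [DecidableEq I] {B C : Type*} [AddCommGroup B]
    [Module k B] [AddCommGroup C] [Module k C] (R : Submodule k (I → k)) (v : I → B) (w : I → C)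
    (hv : ∀ μ : I → k, (∀ r ∈ R, ∑ j, r j * μ j = 0) → ∑ j, μ j • v j = 0)
    (hw : ∀ r ∈ R, ∑ j, r j • w j = 0) : ∑ j, v j ⊗ₜ[k] w j = 0 := by
  obtain ⟨P, hP⟩ := R.subtype.exists_leftInverse_of_injective R.ker_subtype
  have hPr : ∀ r ∈ R, ∀ j, ∑ l, r l * (P (Pi.single l 1) : I → k) j = r j := by
    intro r hr j
    have h1 : r = ∑ l, r l • (Pi.single l (1 : k) : I → k) := by
      ext a; simp [Finset.sum_apply, Pi.single_apply]
    have h2 : (P r : I → k) = r := by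
      have := LinearMap.congr_fun hP ⟨r, hr⟩
      simpa using congrArg Subtype.val this
    conv_rhs => rw [← h2, h1]
    simp [map_sum, Finset.sum_apply]
  have hvj : ∀ j, v j = ∑ l, (P (Pi.single l 1) : I → k) j • v l := by
    intro j
    have h := hv (fun l => (P (Pi.single l 1) : I → k) j - if l = j then 1 else 0) (by
      intro r hr
      simp [mul_sub, Finset.sum_sub_distrib, hPr r hr])
    simp only [sub_smul, Finset.sum_sub_distrib, ite_smul, one_smul, zero_smul,
      Finset.sum_ite_eq', Finset.mem_univ, if_true] at h
    exact (sub_eq_zero.mp h).symm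
  calc ∑ j, v j ⊗ₜ[k] w j
      = ∑ j, ∑ l, v l ⊗ₜ[k] ((P (Pi.single l 1) : I → k) j • w j) := by
        refine Finset.sum_congr rfl fun j _ => ?_
        conv_lhs => rw [hvj j, TensorProduct.sum_tmul]
        simp only [TensorProduct.smul_tmul]
    _ = ∑ l, v l ⊗ₜ[k] ∑ j, (P (Pi.single l 1) : I → k) j • w j := by
        rw [Finset.sum_comm]
        simp only [TensorProduct.tmul_sum]
    _ = 0 := by
        refine Finset.sum_eq_zero fun l _ => ?_
        rw [hw _ (P (Pi.single l 1)).2, TensorProduct.tmul_zero]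

/-- The defining relations of `O(M)`: with `R_e`, `R_f` the relation spaces of `A(e, N)` and
`A(f, N)`,
`∑_{i,j} e_{λ i} μ_j z_{i₁j₁} ⋯ z_{i_N j_N} = 0` for `μ ∈ R_e^⊥`, and
`∑_{i,j} f_{λ j} ν_i z_{i₁j₁} ⋯ z_{i_N j_N} = 0` for `ν ∈ R_f^⊥`. -/
inductive OMRel (e f : (Fin m → Fin n) → k) (N : ℕ) :
    FreeAlgebra k (Fin n × Fin n) → FreeAlgebra k (Fin n × Fin n) → Prop
  | left (lam : Fin (m - N) → Fin n) (μ : (Fin N → Fin n) → k) (hμ : IsAnnihilating e μ) :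
      OMRel e f N (∑ i : Fin N → Fin n, ∑ j : Fin N → Fin n, (e (glue lam i) * μ j) •
        word₂ (fun a b => FreeAlgebra.ι k (a, b)) i j) 0
  | right (lam : Fin (m - N) → Fin n) (ν : (Fin N → Fin n) → k) (hν : IsAnnihilating f ν) :
      OMRel e f N (∑ i : Fin N → Fin n, ∑ j : Fin N → Fin n, (f (glue lam j) * ν i) •
        word₂ (fun a b => FreeAlgebra.ι k (a, b)) i j) 0

/-- The algebra `O_{A(e,N), A(f,N)}(M)`. -/
def OM (e f : (Fin m → Fin n) → k) (N : ℕ) : Type u := RingQuot (OMRel e f N)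

variable (e f : (Fin m → Fin n) → k) (N : ℕ)

noncomputable instance : Ring (OM e f N) := inferInstanceAs (Ring (RingQuot (OMRel e f N)))

noncomputable instance : Algebra k (OM e f N) :=
  inferInstanceAs (Algebra k (RingQuot (OMRel e f N)))

namespace OM

/-- The generators `z_{ab}`. -/
noncomputable def z (a b : Fin n) : OM e f N :=
  RingQuot.mkAlgHom k (OMRel e f N) (FreeAlgebra.ι k (a, b))

variable {e f N}

lemma rel_left (lam : Fin (m - N) → Fin n) (μ : (Fin N → Fin n) → k) (hμ : IsAnnihilating e μ) :
    ∑ i : Fin N → Fin n, ∑ j : Fin N → Fin n, (e (glue lam i) * μ j) • word₂ (z e f N) i j = 0 := by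
  have h := RingQuot.mkAlgHom_rel k (OMRel.left (e := e) (f := f) lam μ hμ)
  simp only [map_sum, map_smul, map_word₂, map_zero] at h
  exact h

lemma rel_right (lam : Fin (m - N) → Fin n) (ν : (Fin N → Fin n) → k) (hν : IsAnnihilating f ν) :
    ∑ i : Fin N → Fin n, ∑ j : Fin N → Fin n, (f (glue lam j) * ν i) • word₂ (z e f N) i j = 0 := by
  have h := RingQuot.mkAlgHom_rel k (OMRel.right (e := e) (f := f) lam ν hν)
  simp only [map_sum, map_smul, map_word₂, map_zero] at h
  exact h

/-- Algebra maps out of `O(M)`. -/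
noncomputable def lift {B : Type*} [Ring B] [Algebra k B] (b : Fin n → Fin n → B)
    (hl : ∀ (lam : Fin (m - N) → Fin n) (μ : (Fin N → Fin n) → k), IsAnnihilating e μ →
      ∑ i : Fin N → Fin n, ∑ j : Fin N → Fin n, (e (glue lam i) * μ j) • word₂ b i j = 0)
    (hr : ∀ (lam : Fin (m - N) → Fin n) (ν : (Fin N → Fin n) → k), IsAnnihilating f ν →
      ∑ i : Fin N → Fin n, ∑ j : Fin N → Fin n, (f (glue lam j) * ν i) • word₂ b i j = 0) :
    OM e f N →ₐ[k] B :=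
  RingQuot.liftAlgHom k ⟨FreeAlgebra.lift k (fun p : Fin n × Fin n => b p.1 p.2), by
    rintro _ _ (⟨lam, μ, hμ⟩ | ⟨lam, ν, hν⟩)
    · simpa only [map_sum, map_smul, map_word₂, map_zero, FreeAlgebra.lift_ι_apply]
        using hl lam μ hμ
    · simpa only [map_sum, map_smul, map_word₂, map_zero, FreeAlgebra.lift_ι_apply]
        using hr lam ν hν⟩

@[simp]
lemma lift_z {B : Type*} [Ring B] [Algebra k B] (b : Fin n → Fin n → B) (hl) (hr) (i j : Fin n) :
    lift (e := e) (f := f) (N := N) b hl hr (z e f N i j) = b i j := by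
  simp only [lift, z]
  erw [RingQuot.liftAlgHom_mkAlgHom_apply]
  simp

lemma hom_ext {B : Type*} [Ring B] [Algebra k B] {φ ψ : OM e f N →ₐ[k] B}
    (h : ∀ i j, φ (z e f N i j) = ψ (z e f N i j)) : φ = ψ := by
  refine RingQuot.ringQuot_ext' k (s := OMRel e f N) φ ψ ?_
  apply FreeAlgebra.hom_ext
  funext p
  exact h p.1 p.2

lemma annihilates_relSpace {c : (Fin m → Fin n) → k} {μ : (Fin N → Fin n) → k} :
    IsAnnihilating c μ ↔ ∀ r ∈ relSpace c N, ∑ j, r j * μ j = 0 := by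
  constructor
  · intro h r hr
    induction hr using Submodule.span_induction with
    | mem x hx => obtain ⟨lam, rfl⟩ := hx; exact h lam
    | zero => simp
    | add x y _ _ hx hy => simp [add_mul, Finset.sum_add_distrib, hx, hy]
    | smul a x _ hx => simp [mul_assoc, ← Finset.mul_sum, hx]
  · intro h lam
    exact h _ (Submodule.subset_span ⟨lam, rfl⟩)

lemma relSpace_smul_sum {c : (Fin m → Fin n) → k} {B : Type*} [AddCommGroup B] [Module k B]
    {w : (Fin N → Fin n) → B} (h : ∀ lam : Fin (m - N) → Fin n, ∑ j, c (glue lam j) • w j = 0) :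
    ∀ r ∈ relSpace c N, ∑ j, r j • w j = 0 := by
  intro r hr
  induction hr using Submodule.span_induction with
  | mem x hx => obtain ⟨lam, rfl⟩ := hx; exact h lam
  | zero => simp
  | add x y _ _ hx hy => simp [add_smul, Finset.sum_add_distrib, hx, hy]
  | smul a x _ hx => simp [mul_smul, ← Finset.smul_sum, hx]

variable (e f N)

/-- `Δ(z_{ab}) = ∑_c z_{ac} ⊗ z_{cb}`. -/
noncomputable def comulHom : OM e f N →ₐ[k] OM e f N ⊗[k] OM e f N :=
  lift (fun a b => ∑ c, z e f N a c ⊗ₜ[k] z e f N c b)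
    (by
      intro lam μ hμ
      have key : ∑ c : Fin N → Fin n, (∑ i, e (glue lam i) • word₂ (z e f N) i c) ⊗ₜ[k]
          (∑ j, μ j • word₂ (z e f N) c j) = 0 := by
        refine sum_tmul_eq_zero (relSpace e N) _ _ ?_ (relSpace_smul_sum ?_)
        · intro μ' hμ'
          rw [← rel_left (e := e) (f := f) lam μ' (annihilates_relSpace.mpr hμ'), Finset.sum_comm]
          refine Finset.sum_congr rfl fun c _ => ?_
          rw [Finset.smul_sum]
          refine Finset.sum_congr rfl fun i _ => ?_
          rw [smul_smul, mul_comm]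
        · intro lam'
          rw [← rel_left (e := e) (f := f) lam' μ hμ]
          refine Finset.sum_congr rfl fun c _ => ?_
          rw [Finset.smul_sum]
          refine Finset.sum_congr rfl fun i _ => ?_
          rw [smul_smul]
      rw [← key, sum_word₂_comul])
    (by
      intro lam ν hν
      have key : ∑ c : Fin N → Fin n, (∑ j, f (glue lam j) • word₂ (z e f N) c j) ⊗ₜ[k]
          (∑ i, ν i • word₂ (z e f N) i c) = 0 := by
        refine sum_tmul_eq_zero (relSpace f N) _ _ ?_ (relSpace_smul_sum ?_)
        · intro μ' hμ'
          rw [← rel_right (e := e) (f := f) lam μ' (annihilates_relSpace.mpr hμ')]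
          refine Finset.sum_congr rfl fun c _ => ?_
          rw [Finset.smul_sum]
          refine Finset.sum_congr rfl fun i _ => ?_
          rw [smul_smul, mul_comm]
        · intro lam'
          rw [← rel_right (e := e) (f := f) lam' ν hν, Finset.sum_comm]
          refine Finset.sum_congr rfl fun c _ => ?_
          rw [Finset.smul_sum]
          refine Finset.sum_congr rfl fun i _ => ?_
          rw [smul_smul]
      have key' := congrArg (TensorProduct.comm k (OM e f N) (OM e f N)) key
      simp only [map_sum, TensorProduct.comm_tmul, map_zero] at key'
      simp only [mul_comm (f _)]
      rw [← key', sum_word₂_comul])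

/-- `ε(z_{ab}) = δ_{ab}`. -/
noncomputable def counitHom : OM e f N →ₐ[k] k :=
  lift (fun a b => if a = b then 1 else 0)
    (by
      intro lam μ hμ
      simp only [word₂_delta, smul_eq_mul, mul_ite, mul_one, mul_zero, Finset.sum_ite_eq,
        Finset.mem_univ, if_true]
      exact hμ lam)
    (by
      intro lam ν hν
      simp only [word₂_delta, smul_eq_mul, mul_ite, mul_one, mul_zero, Finset.sum_ite_eq,
        Finset.mem_univ, if_true]
      exact hν lam)

/-- The bialgebra structure of `O(M)`. -/
noncomputable instance : Bialgebra k (OM e f N) :=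
  Bialgebra.ofAlgHom (comulHom e f N) (counitHom e f N)
    (by
      apply hom_ext
      intro i j
      simp [comulHom, TensorProduct.sum_tmul, TensorProduct.tmul_sum]
      exact Finset.sum_comm)
    (by
      apply hom_ext
      intro i j
      simp [comulHom, counitHom, TensorProduct.ite_tmul])
    (by
      apply hom_ext
      intro i j
      simp [comulHom, counitHom, TensorProduct.tmul_ite])

/-- `g₁ = e_{j₁⋯j_m}⁻¹ ∑_i e_{i₁⋯i_m} z_{i₁j₁} ⋯ z_{i_m j_m}` (for `e_{j₁⋯j_m} ≠ 0`). -/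
noncomputable def g₁ (j : Fin m → Fin n) : OM e f N :=
  (e j)⁻¹ • ∑ i : Fin m → Fin n, e i • word₂ (z e f N) i j

/-- `g₂ = f_{j₁⋯j_m}⁻¹ ∑_i f_{i₁⋯i_m} z_{j₁i₁} ⋯ z_{j_m i_m}` (for `f_{j₁⋯j_m} ≠ 0`). -/
noncomputable def g₂ (j : Fin m → Fin n) : OM e f N :=
  (f j)⁻¹ • ∑ i : Fin m → Fin n, f i • word₂ (z e f N) j i

end OM

end Bialgebra

/-! ## Ore sets, rings of fractions, quotients -/

section Ore

variable {R Q : Type*} [Ring R] [Ring Q]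

/-- A right Ore (denominator) set: the condition under which the ring of right fractions
`R S⁻¹` exists. -/
structure IsRightOreSet (S : Submonoid R) : Prop where
  ore : ∀ r : R, ∀ s ∈ S, ∃ r' : R, ∃ s' ∈ S, r * s' = s * r'
  reversible : ∀ r : R, ∀ s ∈ S, s * r = 0 → ∃ s' ∈ S, r * s' = 0

/-- `φ : R → Q` is the localization `R → R S⁻¹` (the ring of right fractions). -/
structure IsRightRingOfFractions (S : Submonoid R) (φ : R →+* Q) : Prop where
  isUnit : ∀ s ∈ S, IsUnit (φ s)
  surj : ∀ q : Q, ∃ r : R, ∃ s ∈ S, q * φ s = φ r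
  ker : ∀ r : R, φ r = 0 → ∃ s ∈ S, r * s = 0

/-- `φ : R → Q` is the quotient map by the two-sided ideal generated by `X`. -/
structure IsQuotientBy (X : Set R) (φ : R →+* Q) : Prop where
  surj : Function.Surjective φ
  ker : TwoSidedIdeal.ker φ = TwoSidedIdeal.span X

end Ore

/-! ## Balanced coactions and the universal quantum groups -/

section Coactions

variable {k : Type u} [Field k]

/-- `ρ` makes `A` a left `K`-comodule algebra. -/
structure IsLeftCoaction {K A : Type u} [Ring K] [Bialgebra k K] [Ring A] [Algebra k A]
    (ρ : A →ₐ[k] K ⊗[k] A) : Prop where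
  coassoc : (Algebra.TensorProduct.assoc k k k K K A).toAlgHom.comp
      ((Algebra.TensorProduct.map (Bialgebra.comulAlgHom k K) (AlgHom.id k A)).comp ρ) =
    (Algebra.TensorProduct.map (AlgHom.id k K) ρ).comp ρ
  counit : (Algebra.TensorProduct.map (Bialgebra.counitAlgHom k K) (AlgHom.id k A)).comp ρ =
    (Algebra.TensorProduct.lid k A).symm.toAlgHom

/-- `ρ` makes `A` a right `K`-comodule algebra. -/
structure IsRightCoaction {K A : Type u} [Ring K] [Bialgebra k K] [Ring A] [Algebra k A]
    (ρ : A →ₐ[k] A ⊗[k] K) : Prop where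
  coassoc : (Algebra.TensorProduct.assoc k k k A K K).toAlgHom.comp
      ((Algebra.TensorProduct.map ρ (AlgHom.id k K)).comp ρ) =
    (Algebra.TensorProduct.map (AlgHom.id k A) (Bialgebra.comulAlgHom k K)).comp ρ
  counit : (Algebra.TensorProduct.map (AlgHom.id k A) (Bialgebra.counitAlgHom k K)).comp ρ =
    (Algebra.TensorProduct.rid k k A).symm.toAlgHom

variable {n m N : ℕ} {e f : (Fin m → Fin n) → k}

/-- The coactions `ρl`, `ρr` are given on generators by the elements `a_{ij}`. -/
def HasMatrix {K : Type u} [Ring K] [Algebra k K] (ρl : SPAlg e N →ₐ[k] K ⊗[k] SPAlg e N)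
    (ρr : SPAlg f N →ₐ[k] SPAlg f N ⊗[k] K) (a : Fin n → Fin n → K) : Prop :=
  (∀ i, ρl (SPAlg.x e N i) = ∑ j, a i j ⊗ₜ[k] SPAlg.x e N j) ∧
  (∀ j, ρr (SPAlg.x f N j) = ∑ i, SPAlg.x f N i ⊗ₜ[k] a i j)

/-- `K` coacts from the left on `A(e, N)` and from the right on `A(f, N)` in a balanced fashion:
`ρ_ℓ(x_i) = ∑_j a_{ij} ⊗ x_j` and `ρ_r(y_j) = ∑_i y_i ⊗ a_{ij}` with the same `a_{ij} ∈ K`. -/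
structure IsBalancedCoaction {K : Type u} [Ring K] [Bialgebra k K]
    (ρl : SPAlg e N →ₐ[k] K ⊗[k] SPAlg e N) (ρr : SPAlg f N →ₐ[k] SPAlg f N ⊗[k] K) : Prop where
  left : IsLeftCoaction ρl
  right : IsRightCoaction ρr
  balanced : ∃ a : Fin n → Fin n → K, HasMatrix ρl ρr a

/-- Both coactions have trivial homological codeterminant, i.e. the induced coactions on
`Ext^d_A(k, k)`, `d` being the global dimension of `A = A(e, N)`, `A(f, N)`, are trivial. -/
def HasTrivialCodeterminants [NeZero N] (d : ℕ) {K : Type u} [Ring K] [Bialgebra k K]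
    (ρl : SPAlg e N →ₐ[k] K ⊗[k] SPAlg e N) (ρr : SPAlg f N →ₐ[k] SPAlg f N ⊗[k] K) : Prop :=
  ActsTriviallyOnExt ρl (SPAlg.aug e N) d ∧
  ActsTriviallyOnExt ((Algebra.TensorProduct.comm k (SPAlg f N) K).toAlgHom.comp ρr)
    (SPAlg.aug f N) d

/-- The bialgebra map `φ` carries the pair of coactions `(ρl, ρr)` to `(σl, σr)`. -/
def IntertwinesCoactions {H K : Type u} [Ring H] [Bialgebra k H] [Ring K] [Bialgebra k K]
    (φ : H →ₐc[k] K)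
    (ρl : SPAlg e N →ₐ[k] H ⊗[k] SPAlg e N) (ρr : SPAlg f N →ₐ[k] SPAlg f N ⊗[k] H)
    (σl : SPAlg e N →ₐ[k] K ⊗[k] SPAlg e N) (σr : SPAlg f N →ₐ[k] SPAlg f N ⊗[k] K) : Prop :=
  (Algebra.TensorProduct.map (φ : H →ₐ[k] K) (AlgHom.id k (SPAlg e N))).comp ρl = σl ∧
  (Algebra.TensorProduct.map (AlgHom.id k (SPAlg f N)) (φ : H →ₐ[k] K)).comp ρr = σr

/-- The Hopf algebra `H`, with its coactions, is the balanced quantum general linear group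
`O_{A(e,N), A(f,N)}(GL)`: it is universal among Hopf algebras with a balanced coaction. -/
structure IsQuantumGL {H : Type u} [Ring H] [HopfAlgebra k H]
    (ρl : SPAlg e N →ₐ[k] H ⊗[k] SPAlg e N) (ρr : SPAlg f N →ₐ[k] SPAlg f N ⊗[k] H) : Prop where
  balanced : IsBalancedCoaction ρl ρr
  universal : ∀ (K : Type u) [Ring K] [HopfAlgebra k K]
    (σl : SPAlg e N →ₐ[k] K ⊗[k] SPAlg e N) (σr : SPAlg f N →ₐ[k] SPAlg f N ⊗[k] K),
    IsBalancedCoaction σl σr → ∃! φ : H →ₐc[k] K, IntertwinesCoactions φ ρl ρr σl σr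

/-- The Hopf algebra `H`, with its coactions, is the balanced quantum special linear group
`O_{A(e,N), A(f,N)}(SL)`: it is universal among Hopf algebras with a balanced coaction such that
both coactions have trivial homological codeterminant. -/
structure IsQuantumSL [NeZero N] (d : ℕ) {H : Type u} [Ring H] [HopfAlgebra k H]
    (ρl : SPAlg e N →ₐ[k] H ⊗[k] SPAlg e N) (ρr : SPAlg f N →ₐ[k] SPAlg f N ⊗[k] H) : Prop where
  balanced : IsBalancedCoaction ρl ρr
  trivial_codeterminants : HasTrivialCodeterminants d ρl ρr
  universal : ∀ (K : Type u) [Ring K] [HopfAlgebra k K]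
    (σl : SPAlg e N →ₐ[k] K ⊗[k] SPAlg e N) (σr : SPAlg f N →ₐ[k] SPAlg f N ⊗[k] K),
    IsBalancedCoaction σl σr → HasTrivialCodeterminants d σl σr →
    ∃! φ : H →ₐc[k] K, IntertwinesCoactions φ ρl ρr σl σr

end Coactions

/-! A balanced coaction of a bialgebra `K` is the same thing as a multiplicative matrix `a` over `K`
such that `a` respects the relations of `A(e, N)` and its transpose those of `A(f, N)`;
equivalently, it is a bialgebra map `O(M) → K`, `z_{ij} ↦ a_{ij}`. To read the matrix off a coaction
one needs enough linear functionals on `A(c, N)`: `SPAlg.exists_functional_word` gives compatibility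
with the relations, `SPAlg.sum_tmul_x_injective` gives uniqueness and multiplicativity.

Koszulity and regularity enter through the codeterminant. Twisted cyclicity puts every window of
length `N` of the coefficient tensor `c` into the relation space, so `c ∈ W_m`. The Koszul complex
is a minimal projective resolution of `k`. Finite global dimension makes `Ext^d(k, A) → Ext^d(k, k)`
surjective, so regularity bounds the dimension of `Ext^d(k, k)` by one, and minimality turns this
into `W_m = k c` (`koszulSpace_le_span`). A compatible matrix coacts on `W_m`; hence `∑_i c_i
a_{i₁j₁} ⋯ a_{i_m j_m} = c_j g` with a single element `g`, called `codet`
(`IsCompatible.sum_eq_smul_codet`). Extending the coaction to the whole resolution shows that it is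
trivial on `Ext^d(k, k)` exactly when `g = 1` (`actsTriviallyOnExt_iff`). For the matrix `z`, and
for its transpose, these elements are `g₁` and `g₂`, and they are group-like.

Group-like elements of a Hopf algebra are invertible. So `O(M) → K` inverts `g₁` and `g₂` whenever
`K` is Hopf, and sends them to `1` when the codeterminants are trivial. What remains is that a
universal target of this kind is itself a Hopf algebra. The identity for `g₁` splits off the last
letter as `∑_p (∑_x e_{xp} z_{xy}) z_{pq} = e_{yq} g₁`; since `e` is nondegenerate in its last
argument, inverting `g₁` yields a left inverse of `z`, as with cofactors. In the same way `f` and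
`g₂` yield a right inverse. The inverse matrix satisfies the relations of `O(M)` in the opposite
algebra, so it defines the antipode (`IsUniversalInverting.exists_antipode`).

Parts (a) and (b) run in parallel: `IsUniversalInverting t` describes maps making `g₁`, `g₂` units
and, if `t` holds, equal to `1`. The ring of fractions and the quotient each have this property, and
the rest is formal. -/

/-! ## Concatenation of multi-indices -/

section Concatenation

/-- Concatenation of two multi-indices of lengths `a` and `b` with `a + b = ℓ`. -/
def cat {X : Type*} {ℓ a b : ℕ} (h : a + b = ℓ) (s : Fin a → X) (w : Fin b → X) : Fin ℓ → X :=
  fun q => if hq : (q : ℕ) < a then s ⟨q, hq⟩ else w ⟨(q : ℕ) - a, by omega⟩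

variable {X : Type*} {ℓ a b : ℕ}

lemma glue_eq_cat {p : ℕ} (h : p ≤ ℓ) (s : Fin (ℓ - p) → X) (w : Fin p → X) :
    glue s w = cat (Nat.sub_add_cancel h) s w := rfl

/-- Concatenation as a bijection. -/
def catEquiv (X : Type*) {ℓ a b : ℕ} (h : a + b = ℓ) :
    (Fin a → X) × (Fin b → X) ≃ (Fin ℓ → X) where
  toFun p := cat h p.1 p.2
  invFun i := (fun q => i ⟨q, by omega⟩, fun q => i ⟨a + q, by omega⟩)
  left_inv p := by
    ext q <;> simp [cat]
  right_inv i := by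
    ext q
    simp only [cat]
    split_ifs with hq
    · rfl
    · congr 1
      ext
      simp only
      omega

lemma exists_cat (h : a + b = ℓ) (i : Fin ℓ → X) : ∃ s w, i = cat h s w :=
  ⟨_, _, ((catEquiv X h).apply_symm_apply i).symm⟩

lemma cat_inj (h : a + b = ℓ) {s s' : Fin a → X} {w w' : Fin b → X} :
    cat h s w = cat h s' w' ↔ s = s' ∧ w = w' := by
  have := (catEquiv X h).injective.eq_iff (a := (s, w)) (b := (s', w'))
  simpa [catEquiv] using this

lemma sum_cat [Fintype X] {M : Type*} [AddCommMonoid M] (h : a + b = ℓ) (F : (Fin ℓ → X) → M) :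
    ∑ i, F i = ∑ s : Fin a → X, ∑ w : Fin b → X, F (cat h s w) := by
  rw [← (catEquiv X h).sum_comp, Fintype.sum_prod_type]
  rfl

lemma comp_cat {Y : Type*} (h : a + b = ℓ) (s : Fin a → X) (w : Fin b → X) (g : X → Y) :
    (fun q => g (cat h s w q)) = cat h (fun q => g (s q)) (fun q => g (w q)) := by
  ext q
  simp only [cat]
  split_ifs <;> rfl

lemma prod_ofFn_cat {B : Type*} [Monoid B] (h : a + b = ℓ) (s : Fin a → B) (w : Fin b → B) :
    (List.ofFn (cat h s w)).prod = (List.ofFn s).prod * (List.ofFn w).prod := by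
  subst h
  rw [← List.prod_append, ← List.ofFn_fin_append]
  congr 2
  ext q
  refine Fin.addCases (fun i => ?_) (fun i => ?_) q
  · simp [cat]
  · simp [cat]

lemma word_cat {B : Type*} [Monoid B] (h : a + b = ℓ) (x : X → B) (s : Fin a → X)
    (w : Fin b → X) : word x (cat h s w) = word x s * word x w := by
  simp only [word]
  rw [comp_cat, prod_ofFn_cat]

lemma word₂_cat {B : Type*} [Monoid B] (h : a + b = ℓ) (z : X → X → B) (s s' : Fin a → X)
    (w w' : Fin b → X) :
    word₂ z (cat h s w) (cat h s' w') = word₂ z s s' * word₂ z w w' := by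
  simp only [word₂]
  rw [← prod_ofFn_cat h]
  congr 2
  ext q
  simp only [cat]
  split_ifs <;> rfl

lemma splice_cat {N : ℕ} (h : a + b = ℓ) (s : Fin a → X) (w : Fin b → X) (p : ℕ)
    (j : Fin N → X) : splice (cat h s w) (a + p) j = cat h s (splice w p j) := by
  ext q
  simp only [splice, cat]
  split_ifs <;> first | rfl | omega | (congr 2; omega)

lemma splice_zero_eq_cat {N : ℕ} (h : N + b = ℓ) (s : Fin N → X) (w : Fin b → X)
    (j : Fin N → X) : splice (cat h s w) 0 j = cat h j w := by
  ext q
  simp only [splice, cat]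
  split_ifs <;> first | rfl | omega

lemma splice_sub_eq_glue {N : ℕ} (hN : N ≤ ℓ) (s : Fin (ℓ - N) → X) (w j : Fin N → X) :
    splice (glue s w) (ℓ - N) j = glue s j := by
  ext q
  simp only [splice, glue]
  split_ifs <;> first | rfl | omega

end Concatenation

/-! ## The double annihilator -/

section Annihilator

variable {k : Type u} [Field k]

/-- A vector outside `R` is separated from `R` by a functional, and on `I → k` every functional is
the pairing with its vector of values on the unit vectors. -/
lemma mem_iff_forall_annihilator {I : Type*} [Fintype I] [DecidableEq I]
    (R : Submodule k (I → k)) (w : I → k) :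
    w ∈ R ↔ ∀ μ : I → k, (∀ r ∈ R, ∑ j, r j * μ j = 0) → ∑ j, w j * μ j = 0 := by
  refine ⟨fun hw μ hμ => hμ w hw, fun h => ?_⟩
  by_contra hw
  obtain ⟨φ, hφ, hR⟩ := Submodule.exists_le_ker_of_notMem hw
  have key : ∀ r : I → k, ∑ j, r j * φ (Pi.single j 1) = φ r := by
    intro r
    conv_rhs => rw [← Finset.univ_sum_single r, map_sum]
    refine Finset.sum_congr rfl fun j _ => ?_
    rw [← smul_eq_mul, ← map_smul]
    congr 1
    ext l
    simp [Pi.single_apply]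
  refine hφ ?_
  rw [← key w]
  refine h _ fun r hr => ?_
  rw [key]
  exact hR hr

end Annihilator

/-! ## Consequences of preregularity -/

section Preregular

variable {k : Type u} [Field k] {V : Type v} [AddCommGroup V] [Module k V] {n m : ℕ}
  (b : Module.Basis (Fin n) k V) (e : MultilinearMap k (fun _ : Fin m => V) k)

-- The sum is multilinear in the positions satisfying `P`, so it is enough to test it on basis
-- vectors. This passes from coefficients to arbitrary vectors, which is necessary because the twist
-- `φ` of a preregular form need not permute the basis.
open Classical in
lemma sum_multilinear_eq_zero {J : Type*} [Fintype J] (P : Fin m → Prop) (μ : J → k)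
    (y : J → Fin m → V)
    (h : ∀ i : Fin m → Fin n, ∑ j, μ j * e (fun q => if P q then b (i q) else y j q) = 0)
    (x : Fin m → V) : ∑ j, μ j * e (fun q => if P q then x q else y j q) = 0 := by
  let E : MultilinearMap k (fun _ : {q // P q} => V) k :=
    ∑ j, μ j • e.domDomRestrict P (fun q => y j q)
  have hE : E = 0 := by
    refine Module.Basis.ext_multilinear (fun _ => b) fun i => ?_
    -- The index family given here is defined only where `P` holds. Extending it to all positions
    -- needs an element of `Fin n`, so `n = 0` is treated apart.
    rcases isEmpty_or_nonempty (Fin n) with hn | hn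
    · by_cases hP : ∃ q, P q
      · obtain ⟨q, hq⟩ := hP
        exact (hn.false (i ⟨q, hq⟩)).elim
      · push Not at hP
        by_cases hm : Nonempty (Fin m)
        · obtain ⟨q⟩ := hm
          have hV : Subsingleton V := b.repr.toEquiv.subsingleton
          have : ∀ j, e (fun q => if h : P q then b (i ⟨q, h⟩) else y j q) = 0 := fun j =>
            e.map_coord_zero q (Subsingleton.elim _ _)
          simp [E, MultilinearMap.domDomRestrict, this]
        · have := h (fun q => (hm ⟨q⟩).elim)
          simp only [E, _root_.sum_apply, _root_.smul_apply,
            MultilinearMap.domDomRestrict, MultilinearMap.coe_mk, smul_eq_mul,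
            _root_.zero_apply]
          rw [← this]
          refine Finset.sum_congr rfl fun j _ => ?_
          congr 2
          ext q
          exact (hm ⟨q⟩).elim
    · have := h (fun q => if hq : P q then i ⟨q, hq⟩ else Classical.arbitrary _)
      simp only [E, _root_.sum_apply, _root_.smul_apply,
        MultilinearMap.domDomRestrict, MultilinearMap.coe_mk, smul_eq_mul,
        _root_.zero_apply]
      rw [← this]
      refine Finset.sum_congr rfl fun j _ => ?_
      congr 2
      ext q
      split_ifs <;> rfl
  have := congrArg (fun F => F (fun q => x q)) hE
  simp only [E, _root_.sum_apply, _root_.smul_apply,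
    MultilinearMap.domDomRestrict, MultilinearMap.coe_mk, smul_eq_mul,
    _root_.zero_apply] at this
  rw [← this]
  refine Finset.sum_congr rfl fun j _ => ?_
  congr 2

/-- The span of the vectors `(c_{i₁ ⋯ i_p j₁ ⋯ j_N i_{p+N+1} ⋯})_j`. -/
def spliceSpace (c : (Fin m → Fin n) → k) (N p : ℕ) : Submodule k ((Fin N → Fin n) → k) :=
  Submodule.span k (Set.range fun (i : Fin m → Fin n) (j : Fin N → Fin n) => c (splice i p j))

/-- The span of the vectors `(e(z₁, …, z_p, v_{j₁}, …, v_{j_N}, z_{p+N+1}, …))_j`. -/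
def spliceSpan (N p : ℕ) : Submodule k ((Fin N → Fin n) → k) :=
  Submodule.span k (Set.range fun (z : Fin m → V) (j : Fin N → Fin n) =>
    e (splice z p fun q => b (j q)))

/-- By multilinearity, annihilating the windows surrounded by basis vectors forces annihilating
those surrounded by any vectors; the double annihilator then compares the spans. -/
lemma spliceSpan_eq_spliceSpace (N p : ℕ) :
    spliceSpan b e N p = spliceSpace (coeffs b e) N p := by
  apply le_antisymm
  · refine Submodule.span_le.mpr ?_
    rintro _ ⟨z, rfl⟩
    rw [SetLike.mem_coe, mem_iff_forall_annihilator]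
    intro μ hμ
    have := sum_multilinear_eq_zero b e (fun q : Fin m => ¬ (p ≤ (q : ℕ) ∧ (q : ℕ) < p + N)) μ
      (fun j => splice z p fun q => b (j q)) (fun i => ?_) z
    · rw [← this]
      refine Finset.sum_congr rfl fun j _ => ?_
      rw [mul_comm]
      congr 1
      refine congrArg e (funext fun q => ?_)
      simp only [splice]
      split_ifs <;> simp_all
    · rw [← hμ _ (Submodule.subset_span ⟨i, rfl⟩)]
      refine Finset.sum_congr rfl fun j _ => ?_
      rw [mul_comm]
      simp only [coeffs]
      congr 2
      ext q
      simp only [splice]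
      split_ifs <;> simp_all
  · refine Submodule.span_le.mpr ?_
    rintro _ ⟨i, rfl⟩
    refine Submodule.subset_span ⟨fun q => b (i q), ?_⟩
    ext j
    simp only [coeffs]
    congr 1
    ext q
    simp only [splice]
    split_ifs <;> rfl

lemma spliceSpace_last (c : (Fin m → Fin n) → k) {N : ℕ} (hN : N ≤ m) :
    spliceSpace c N (m - N) = relSpace c N := by
  apply le_antisymm <;> refine Submodule.span_le.mpr ?_
  · rintro _ ⟨i, rfl⟩
    obtain ⟨s, w, rfl⟩ := exists_cat (Nat.sub_add_cancel hN) i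
    refine Submodule.subset_span ⟨s, ?_⟩
    ext j
    simp only [← glue_eq_cat hN, splice_sub_eq_glue hN]
  · rintro _ ⟨lam, rfl⟩
    rcases isEmpty_or_nonempty (Fin N → Fin n) with h | ⟨⟨w⟩⟩
    · have h0 : (fun j : Fin N → Fin n => c (glue lam j)) = 0 := Subsingleton.elim _ _
      simp only [h0, SetLike.mem_coe, Submodule.zero_mem]
    · refine Submodule.subset_span ⟨glue lam w, ?_⟩
      ext j
      simp only [splice_sub_eq_glue hN]

/-- Independent rows make `t ↦ ∑ t_i M_i` injective; a linear left inverse of this map, evaluated on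
unit vectors, is the required matrix. -/
lemma exists_right_inverse_of_rows {I J : Type*} [Fintype I] [DecidableEq I] [Fintype J]
    [DecidableEq J] (M : I → J → k) (h : ∀ t : I → k, (∀ j, ∑ i, t i * M i j = 0) → t = 0) :
    ∃ M' : J → I → k, ∀ i l, ∑ j, M i j * M' j l = if i = l then 1 else 0 := by
  let L : (I → k) →ₗ[k] (J → k) := Fintype.linearCombination k M
  obtain ⟨g, hg⟩ := L.exists_leftInverse_of_injective (by
    rw [LinearMap.ker_eq_bot']
    intro t ht
    refine h t fun j => ?_
    simpa [L, Fintype.linearCombination_apply, Finset.sum_apply] using congrFun ht j)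
  refine ⟨fun j => g (Pi.single j 1), fun i l => ?_⟩
  have h1 : g (M i) = Pi.single i 1 := by
    simpa [L, Fintype.linearCombination_apply_single] using
      LinearMap.congr_fun hg (Pi.single i 1)
  have h2 : M i = ∑ j, M i j • (Pi.single j (1 : k) : J → k) := by
    ext j; simp [Finset.sum_apply, Pi.single_apply]
  calc ∑ j, M i j * g (Pi.single j 1) l = g (M i) l := by
        conv_rhs => rw [h2]
        simp [map_sum, Finset.sum_apply]
    _ = _ := by rw [h1, Pi.single_apply]; simp [eq_comm]

variable [NeZero m]

/-- The rotation `(z₁, …, z_m) ↦ (φ z_m, z₁, …, z_{m-1})`. -/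
def rotate {Z : Type*} (φ : Z → Z) (z : Fin m → Z) : Fin m → Z := fun i =>
  if i = 0 then φ (z (i - 1)) else z (i - 1)

lemma exists_rotate {Z : Type*} {φ ψ : Z → Z} (h : ∀ x, φ (ψ x) = x) (y : Fin m → Z) :
    ∃ z : Fin m → Z, rotate φ z = y ∧ z (-1) = ψ (y 0) := by
  refine ⟨fun i => if i = -1 then ψ (y (i + 1)) else y (i + 1), ?_, by simp⟩
  ext i
  simp only [rotate]
  by_cases hi : i = 0
  · simp [hi, h]
  · have : i - 1 ≠ -1 := fun h' => hi (by simpa [sub_eq_neg_self] using h')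
    simp [hi, this]

/-- The bound on `p` keeps the window away from the last entry, the only one that wraps around and
meets `φ`; the window merely moves one place to the right. -/
lemma rotate_splice {Z : Type*} (φ : Z → Z) (z : Fin m → Z) {N p : ℕ} (hp : p + 1 + N ≤ m)
    (B : Fin N → Z) : rotate φ (splice z p B) = splice (rotate φ z) (p + 1) B := by
  obtain ⟨m, rfl⟩ := Nat.exists_eq_succ_of_ne_zero (NeZero.ne m)
  ext i
  simp only [rotate]
  refine Fin.cases ?_ (fun i => ?_) i
  · have h1 : ((0 - 1 : Fin (m + 1)) : ℕ) = m := by simp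
    simp only [splice, if_true, h1]
    rw [dif_neg (by omega), dif_neg (by simp)]
    rfl
  · have h1 : ((i.succ - 1 : Fin (m + 1)) : ℕ) = i := by
      rw [Fin.val_sub_one_of_ne_zero (Fin.succ_ne_zero i)]; simp
    simp only [splice, h1, Fin.succ_ne_zero, if_false]
    simp only [Fin.val_succ, Nat.succ_le_succ_iff]
    split_ifs <;> first | rfl | omega | (congr 2; omega)

variable {e}

/-- Cyclicity shifts the window by one and applies `φ` to a vector outside it. The outside vectors
range over everything and rotation is surjective on them, so the span is unchanged. -/
lemma IsPreregular.spliceSpan_succ (he : IsPreregular e) {N p : ℕ} (hp : p + 1 + N ≤ m) :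
    spliceSpan b e N p = spliceSpan b e N (p + 1) := by
  obtain ⟨φ, hφ⟩ := he.cyclic
  have key : ∀ (z : Fin m → V) (B : Fin N → V),
      e (splice z p B) = e (splice (rotate φ z) (p + 1) B) := fun z B => by
    rw [hφ, ← rotate_splice _ _ hp]
    rfl
  apply le_antisymm <;> refine Submodule.span_le.mpr ?_ <;> rintro _ ⟨z, rfl⟩
  · refine Submodule.subset_span ⟨rotate φ z, ?_⟩
    ext j
    exact (key _ _).symm
  · obtain ⟨y, rfl, -⟩ := exists_rotate φ.apply_symm_apply z
    refine Submodule.subset_span ⟨y, ?_⟩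
    ext j
    exact key _ _

lemma IsPreregular.spliceSpace_eq (he : IsPreregular e) {N p : ℕ} (hp : p + N ≤ m) :
    spliceSpace (coeffs b e) N p = relSpace (coeffs b e) N := by
  rw [← spliceSpace_last _ (by omega : N ≤ m)]
  obtain ⟨r, hr⟩ : ∃ r, m - N = p + r := ⟨m - N - p, by omega⟩
  rw [hr]
  have : ∀ s, p + s + N ≤ m →
      spliceSpace (coeffs b e) N p = spliceSpace (coeffs b e) N (p + s) := by
    intro s
    induction s with
    | zero => intro _; rfl
    | succ s ih =>
      intro hs
      rw [ih (by omega), ← spliceSpan_eq_spliceSpace, he.spliceSpan_succ b (by omega),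
        spliceSpan_eq_spliceSpace]
      rfl
  exact this r (by omega)

/-- Windows at all positions span the same space as the last ones, and those define the relations.
-/
lemma IsPreregular.mem_koszulSpace (he : IsPreregular e) (N : ℕ) :
    coeffs b e ∈ koszulSpace (coeffs b e) N m := fun p hp i => by
  rw [← he.spliceSpace_eq b hp]
  exact Submodule.subset_span ⟨i, rfl⟩

/-- The relation space is also spanned by the vectors `(c_{j₁ ⋯ j_N κ})_j`. -/
lemma IsPreregular.relSpace_smul_sum (he : IsPreregular e) {N b' : ℕ} (hN : N + b' = m)
    {B : Type*} [AddCommGroup B] [Module k B] {w : (Fin N → Fin n) → B}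
    (h : ∀ κ : Fin b' → Fin n, ∑ j, coeffs b e (cat hN j κ) • w j = 0) :
    ∀ r ∈ relSpace (coeffs b e) N, ∑ j, r j • w j = 0 := by
  intro r hr
  rw [← he.spliceSpace_eq b (p := 0) (by omega)] at hr
  induction hr using Submodule.span_induction with
  | mem x hx =>
    obtain ⟨i, rfl⟩ := hx
    obtain ⟨s, t, rfl⟩ := exists_cat hN i
    simpa only [splice_zero_eq_cat] using h t
  | zero => simp
  | add x y _ _ hx hy => simp [add_smul, Finset.sum_add_distrib, hx, hy]
  | smul a x _ hx => simp [mul_smul, ← Finset.smul_sum, hx]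


/-- A preregular form is nondegenerate in its first argument, in coordinates. -/
lemma IsPreregular.exists_first_inverse (he : IsPreregular e) {r : ℕ} (h : 1 + r = m) :
    ∃ t : (Fin r → Fin n) → Fin n → k, ∀ a l,
      ∑ w, coeffs b e (cat h (fun _ => a) w) * t w l = if a = l then 1 else 0 := by
  refine exists_right_inverse_of_rows (fun a w => coeffs b e (cat h (fun _ => a) w)) fun s hs => ?_
  have hfirst : ∀ q : Fin m, q = 0 ↔ (q : ℕ) < 1 := fun q => by
    rw [Fin.ext_iff, Nat.lt_one_iff]
    rfl
  have h0 : ∑ a, s a • b a = 0 := by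
    refine he.nondegenerate _ fun z hz => ?_
    have := sum_multilinear_eq_zero b e (fun q => q ≠ 0) s (fun a _ => b a) (fun i => ?_) z
    · rw [← this]
      have hz' : z = Function.update z 0 (∑ a, s a • b a) := by
        rw [← hz, Function.update_eq_self]
      rw [hz', MultilinearMap.map_update_sum]
      refine Finset.sum_congr rfl fun a _ => ?_
      rw [MultilinearMap.map_update_smul, smul_eq_mul]
      congr 2
      ext q
      by_cases hq : q = 0
      · subst hq; simp
      · simp [hq]
    · rw [← hs fun q => i ⟨1 + q, by omega⟩]
      refine Finset.sum_congr rfl fun a _ => ?_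
      simp only [coeffs]
      congr 2
      ext q
      simp only [cat, ne_eq, hfirst]
      split_ifs with hq
      · rfl
      · congr 3
        exact Fin.ext (show (q : ℕ) = 1 + ((q : ℕ) - 1) by omega)
  exact funext (Fintype.linearIndependent_iff.mp b.linearIndependent s h0)

/-- A preregular form is nondegenerate in its last argument, in coordinates. -/
lemma IsPreregular.exists_last_inverse (he : IsPreregular e) {r : ℕ} (h : r + 1 = m) :
    ∃ t : (Fin r → Fin n) → Fin n → k, ∀ a l,
      ∑ w, coeffs b e (cat h w (fun _ => a)) * t w l = if a = l then 1 else 0 := by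
  refine exists_right_inverse_of_rows (fun a w => coeffs b e (cat h w (fun _ => a))) fun s hs => ?_
  have hlast : ∀ q : Fin m, q = -1 ↔ ¬ (q : ℕ) < r := by
    subst h
    intro q
    rw [Fin.ext_iff]
    have : ((-1 : Fin (r + 1)) : ℕ) = r := by simp
    omega
  obtain ⟨φ, hφ⟩ := he.cyclic
  -- Cyclicity turns the last argument into the first at the price of `φ`, so nondegeneracy applies
  -- to the image under `φ`, and `φ` is injective.
  have h0 : φ (∑ a, s a • b a) = 0 := by
    refine he.nondegenerate _ fun y hy => ?_
    obtain ⟨z, rfl, hz⟩ := exists_rotate φ.apply_symm_apply y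
    rw [hy, φ.symm_apply_apply] at hz
    have := sum_multilinear_eq_zero b e (fun q => q ≠ -1) s (fun a _ => b a) (fun i => ?_) z
    · rw [← this]
      refine (hφ z).symm.trans ?_
      have hz' : z = Function.update z (-1) (∑ a, s a • b a) := by
        rw [← hz, Function.update_eq_self]
      rw [hz', MultilinearMap.map_update_sum]
      refine Finset.sum_congr rfl fun a _ => ?_
      rw [MultilinearMap.map_update_smul, smul_eq_mul]
      congr 2
      ext q
      by_cases hq : q = -1
      · subst hq; simp
      · simp [hq]
    · rw [← hs fun q => i ⟨q, by omega⟩]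
      refine Finset.sum_congr rfl fun a _ => ?_
      simp only [coeffs]
      congr 2
      ext q
      simp only [cat, ne_eq, hlast, not_not]
      split_ifs <;> rfl
  exact funext (Fintype.linearIndependent_iff.mp b.linearIndependent s
    (φ.map_eq_zero_iff.mp h0))

end Preregular

/-! ## Matrices compatible with the relations -/

section Compatible

variable {k : Type u} [Field k] {n m : ℕ}

/-- The matrix `a` over `B` is compatible with the relations of `A(c, N)`: the map
`x_i ↦ ∑_j a_{ij} ⊗ x_j` preserves them. -/
def IsCompatible (c : (Fin m → Fin n) → k) (N : ℕ) {B : Type*} [Ring B] [Algebra k B]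
    (a : Fin n → Fin n → B) : Prop :=
  ∀ (lam : Fin (m - N) → Fin n) (μ : (Fin N → Fin n) → k), IsAnnihilating c μ →
    ∑ i : Fin N → Fin n, ∑ j : Fin N → Fin n, (c (glue lam i) * μ j) • word₂ a i j = 0

lemma IsCompatible.map {c : (Fin m → Fin n) → k} {N : ℕ} {B C : Type*} [Ring B] [Algebra k B]
    [Ring C] [Algebra k C] {a : Fin n → Fin n → B} (h : IsCompatible c N a) (φ : B →ₐ[k] C) :
    IsCompatible c N fun p q => φ (a p q) := fun lam μ hμ => by
  have := congrArg φ (h lam μ hμ)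
  simpa only [map_sum, map_smul, map_word₂, map_zero] using this

lemma OM.isCompatible_z (e f : (Fin m → Fin n) → k) (N : ℕ) : IsCompatible e N (OM.z e f N) :=
  OM.rel_left

lemma OM.isCompatible_z_transpose (e f : (Fin m → Fin n) → k) (N : ℕ) :
    IsCompatible f N fun p q => OM.z e f N q p := fun lam ν hν => by
  rw [Finset.sum_comm]
  exact OM.rel_right lam ν hν

/-- Algebra maps out of `O(M)` from pairs of compatible matrices. -/
noncomputable def OM.liftMatrix {e f : (Fin m → Fin n) → k} {N : ℕ} {B : Type*} [Ring B]
    [Algebra k B] (a : Fin n → Fin n → B) (he : IsCompatible e N a)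
    (hf : IsCompatible f N fun p q => a q p) : OM e f N →ₐ[k] B :=
  OM.lift a he fun lam ν hν => by
    rw [Finset.sum_comm]
    exact hf lam ν hν

@[simp]
lemma OM.liftMatrix_z {e f : (Fin m → Fin n) → k} {N : ℕ} {B : Type*} [Ring B]
    [Algebra k B] (a : Fin n → Fin n → B) (he : IsCompatible e N a)
    (hf : IsCompatible f N fun p q => a q p) (i j : Fin n) :
    OM.liftMatrix a he hf (OM.z e f N i j) = a i j :=
  OM.lift_z _ _ _ _ _

end Compatible

/-! ## Presentation and linear functionals of superpotential algebras -/

section Functionals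

variable {k : Type u} [Field k] {n m : ℕ} (c : (Fin m → Fin n) → k) (N : ℕ)

namespace SPAlg

lemma rel (lam : Fin (m - N) → Fin n) :
    ∑ j : Fin N → Fin n, c (glue lam j) • word (SPAlg.x c N) j = 0 := by
  have h := RingQuot.mkAlgHom_rel k (SPRel.rel (c := c) (N := N) lam)
  simp only [map_sum, map_smul, map_word, map_zero] at h
  exact h

variable {c N}

/-- Algebra maps out of `A(c, N)`. -/
noncomputable def lift {B : Type*} [Ring B] [Algebra k B] (y : Fin n → B)
    (h : ∀ lam : Fin (m - N) → Fin n, ∑ j : Fin N → Fin n, c (glue lam j) • word y j = 0) :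
    SPAlg c N →ₐ[k] B :=
  RingQuot.liftAlgHom k ⟨FreeAlgebra.lift k y, by
    rintro _ _ ⟨lam⟩
    simpa only [map_sum, map_smul, map_word, map_zero, FreeAlgebra.lift_ι_apply] using h lam⟩

@[simp]
lemma lift_x {B : Type*} [Ring B] [Algebra k B] (y : Fin n → B) (h) (i : Fin n) :
    lift (c := c) (N := N) y h (x c N i) = y i := by
  simp only [lift, x]
  erw [RingQuot.liftAlgHom_mkAlgHom_apply]
  simp

@[simp]
lemma aug_x [NeZero N] (i : Fin n) : aug c N (x c N i) = 0 := by
  simp only [aug, x]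
  erw [RingQuot.liftAlgHom_mkAlgHom_apply]
  simp

lemma hom_ext {B : Type*} [Ring B] [Algebra k B] {φ ψ : SPAlg c N →ₐ[k] B}
    (h : ∀ i, φ (x c N i) = ψ (x c N i)) : φ = ψ := by
  refine RingQuot.ringQuot_ext' k (s := SPRel c N) φ ψ ?_
  apply FreeAlgebra.hom_ext
  funext i
  exact h i

/-- The presentation supplies an algebra map into the subalgebra generated by the `x_i` that is a
section of the inclusion. -/
lemma adjoin_range_x : Algebra.adjoin k (Set.range (x c N)) = ⊤ := by
  have h : (Algebra.adjoin k (Set.range (x c N))).val.comp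
      (lift (fun i => ⟨x c N i, Algebra.subset_adjoin ⟨i, rfl⟩⟩) fun lam => by
        apply Subtype.ext
        rw [← Subalgebra.val_apply]
        simp only [map_sum, map_smul, map_word]
        exact rel c N lam) =
      AlgHom.id k (SPAlg c N) := hom_ext fun i => by simp
  rw [eq_top_iff]
  intro a _
  rw [← AlgHom.id_apply (R := k) a, ← h]
  exact Subtype.property _

variable (c N)

/-- The functions on words that vanish on the two-sided ideal of relations; `x_i` acts on them by
`(x_i F)(w) = F(w x_i)`. -/
def dualSpace : Submodule k (List (Fin n) → k) where
  carrier := {F | ∀ (s t : List (Fin n)) (lam : Fin (m - N) → Fin n),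
    ∑ j : Fin N → Fin n, c (glue lam j) * F (s ++ (List.ofFn j ++ t)) = 0}
  zero_mem' _ _ _ := by simp
  add_mem' hF hG s t lam := by simp [mul_add, Finset.sum_add_distrib, hF s t lam, hG s t lam]
  smul_mem' r F hF s t lam := by
    simp only [Pi.smul_apply, smul_eq_mul, mul_left_comm, ← Finset.mul_sum, hF s t lam, mul_zero]

/-- The action of `x_i` on `dualSpace`. -/
def dualShift (i : Fin n) : Module.End k (dualSpace c N) where
  toFun F := ⟨fun w => F.1 (w ++ [i]), fun s t lam => by
    simpa [List.append_assoc] using F.2 s (t ++ [i]) lam⟩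
  map_add' _ _ := rfl
  map_smul' _ _ := rfl

lemma word_dualShift_apply {p : ℕ} (j : Fin p → Fin n) (F : dualSpace c N) (w : List (Fin n)) :
    (word (dualShift c N) j F).1 w = F.1 (w ++ List.ofFn j) := by
  induction p generalizing w with
  | zero => simp [word]
  | succ p ih =>
    have h := ih (fun q => j q.succ) (w ++ [j 0])
    simp only [word] at h ⊢
    rw [List.ofFn_succ, List.prod_cons, List.ofFn_succ, Module.End.mul_apply]
    refine h.trans ?_
    simp

/-- The representation of `A(c, N)` on `dualSpace`. -/
noncomputable def dualRep : SPAlg c N →ₐ[k] Module.End k (dualSpace c N) :=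
  lift (dualShift c N) fun lam => by
    ext F w
    have := F.2 w [] lam
    simpa [LinearMap.sum_apply, Finset.sum_apply, word_dualShift_apply] using this

/-- The linear functional on `A(c, N)` given by an element of `dualSpace`. -/
noncomputable def functional (F : dualSpace c N) : SPAlg c N →ₗ[k] k where
  toFun a := (dualRep c N a F).1 []
  map_add' a b := by simp
  map_smul' r a := by simp

lemma functional_word (F : dualSpace c N) {p : ℕ} (j : Fin p → Fin n) :
    functional c N F (word (x c N) j) = F.1 (List.ofFn j) := by
  simp [functional, dualRep, map_word, word_dualShift_apply]

variable {c N}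

/-- For `μ` in the annihilator of the relations there is a functional on `A(c, N)` whose values on
the words of length `N` are given by `μ`. -/
lemma exists_functional_word {μ : (Fin N → Fin n) → k} (hμ : IsAnnihilating c μ) :
    ∃ F : SPAlg c N →ₗ[k] k, ∀ j, F (word (x c N) j) = μ j := by
  -- The function is `μ` on words of length `N` and zero elsewhere. A word `s j t` has length `N`
  -- only for empty `s` and `t`, so the sole condition left is that `μ` annihilates the relations.
  let G : dualSpace c N := ⟨fun w => if h : w.length = N then
      μ fun q => w.get (q.cast h.symm) else 0, fun s t lam => by
    by_cases h : s = [] ∧ t = []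
    · obtain ⟨rfl, rfl⟩ := h
      rw [← hμ lam]
      refine Finset.sum_congr rfl fun j _ => ?_
      simp
    · refine Finset.sum_eq_zero fun j _ => ?_
      refine mul_eq_zero_of_right _ (dif_neg ?_)
      rw [← List.length_eq_zero_iff, ← List.length_eq_zero_iff] at h
      simp only [List.length_append, List.length_ofFn]
      omega⟩
  refine ⟨functional c N G, fun j => ?_⟩
  rw [functional_word]
  simp [G]

/-- The functional dual to the generator `x_i`. -/
lemma exists_functional_x (hN : 2 ≤ N) (i : Fin n) :
    ∃ F : SPAlg c N →ₗ[k] k, ∀ j, F (x c N j) = if j = i then 1 else 0 := by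
  -- Every word occurring in a multiple of a relation has length at least `N ≥ 2`, so a function
  -- supported on one letter vanishes on the relations.
  let G : dualSpace c N := ⟨fun w => if w = [i] then 1 else 0, fun s t lam => by
    refine Finset.sum_eq_zero fun j _ => ?_
    refine mul_eq_zero_of_right _ (if_neg fun h => ?_)
    have := congrArg List.length h
    simp only [List.length_append, List.length_ofFn, List.length_singleton] at this
    omega⟩
  refine ⟨functional c N G, fun j => ?_⟩
  have := functional_word c N G (fun _ : Fin 1 => j)
  simpa [word, G] using this

/-- The generators are linearly independent, so a coaction determines its matrix. -/
lemma sum_tmul_x_injective (hN : 2 ≤ N) {M : Type*} [AddCommGroup M] [Module k M]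
    {s t : Fin n → M}
    (h : ∑ j, s j ⊗ₜ[k] x c N j = ∑ j, t j ⊗ₜ[k] x c N j) : s = t := by
  ext i
  obtain ⟨F, hF⟩ := exists_functional_x (c := c) hN i
  have := congrArg (TensorProduct.rid k M ∘ F.lTensor M) h
  simpa [hF] using this

/-- The coaction matrix of an algebra map `A → K ⊗ A` is compatible with the relations. -/
lemma isCompatible_of_hom {K : Type*} [Ring K] [Algebra k K]
    (ρ : SPAlg c N →ₐ[k] K ⊗[k] SPAlg c N) {a : Fin n → Fin n → K}
    (h : ∀ i, ρ (x c N i) = ∑ j, a i j ⊗ₜ[k] x c N j) : IsCompatible c N a := by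
  intro lam μ hμ
  -- Applying `ρ` to a relation gives zero; a functional on `A` with values `μ` on words of length
  -- `N` extracts the required identity in `K`.
  obtain ⟨F, hF⟩ := exists_functional_word hμ
  have h1 := congrArg (TensorProduct.rid k K ∘ F.lTensor K ∘ ρ) (rel c N lam)
  simp only [Function.comp_apply, map_sum, map_smul, map_word, map_zero, h] at h1
  rw [← h1]
  refine Finset.sum_congr rfl fun i _ => ?_
  have h2 : word (fun i => ∑ j, a i j ⊗ₜ[k] x c N j) i =
      ∑ j, word₂ a i j ⊗ₜ[k] word (x c N) j :=
    word₂_comul (k := k) a (fun i (_ : Fin n) => x c N i) i i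
  rw [h2]
  simp only [map_sum, LinearMap.lTensor_tmul, hF, TensorProduct.rid_tmul, Finset.smul_sum,
    smul_smul]

/-- The algebra map `A → K ⊗ A`, `x_i ↦ ∑_j a_{ij} ⊗ x_j`, of a compatible matrix. -/
noncomputable def coaction {K : Type*} [Ring K] [Algebra k K] (a : Fin n → Fin n → K)
    (ha : IsCompatible c N a) : SPAlg c N →ₐ[k] K ⊗[k] SPAlg c N :=
  lift (fun i => ∑ j, a i j ⊗ₜ[k] x c N j) fun lam => by
    have h2 : ∀ i : Fin N → Fin n, word (fun i => ∑ j, a i j ⊗ₜ[k] x c N j) i =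
      ∑ j, word₂ a i j ⊗ₜ[k] word (x c N) j := fun i =>
      word₂_comul (k := k) a (fun i (_ : Fin n) => x c N i) i i
    simp only [h2, Finset.smul_sum]
    rw [Finset.sum_comm]
    simp only [TensorProduct.smul_tmul', ← TensorProduct.sum_tmul]
    refine sum_tmul_eq_zero (relSpace c N) _ _ (fun μ hμ => ?_) (OM.relSpace_smul_sum (rel c N))
    rw [← ha lam μ (OM.annihilates_relSpace.mpr hμ), Finset.sum_comm]
    simp only [Finset.smul_sum, smul_smul, mul_comm]

@[simp]
lemma coaction_x {K : Type*} [Ring K] [Algebra k K] (a : Fin n → Fin n → K)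
    (ha : IsCompatible c N a) (i : Fin n) :
    coaction a ha (x c N i) = ∑ j, a i j ⊗ₜ[k] x c N j :=
  lift_x _ _ _

end SPAlg

end Functionals

/-! ## `Ext` from a projective resolution by dimension shifting -/

section DimensionShifting

set_option linter.unusedSectionVars false

open CategoryTheory CategoryTheory.Abelian CategoryTheory.Limits

universe w₁ w₂ w₃

variable {C : Type w₁} [Category.{w₂} C] [Abelian C] [HasExt.{w₃} C]
  {P : ℕ → C} (d : ∀ i, P (i + 1) ⟶ P i)

/-- The `i`-th syzygy object of a complex, as the cokernel of a differential. -/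
noncomputable abbrev syzygy (i : ℕ) : C := cokernel (d i)

variable {d} (hd : ∀ i, d (i + 1) ≫ d i = 0)

/-- The sequence `Ω_{i+1} → P_i → Ω_i`. -/
noncomputable abbrev syzygySequence (i : ℕ) : ShortComplex C :=
  ShortComplex.mk (cokernel.desc (d (i + 1)) (d i) (hd i)) (cokernel.π (d i))
    (by rw [← cancel_epi (cokernel.π (d (i + 1)))]; simp)

/-- The map from the syzygy is injective by exactness of the complex at `P (i + 1)`. Exactness in
the middle is that of `P (i + 1) → P i → Ω_i`, whose first map factors through an epimorphism onto
the syzygy. -/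
lemma syzygySequence_shortExact
    (hex : ∀ i, (ShortComplex.mk (d (i + 1)) (d i) (hd i)).Exact) (i : ℕ) :
    (syzygySequence hd i).ShortExact where
  exact := by
    have h := ShortComplex.exact_cokernel (d i)
    let φ : ShortComplex.mk (d i) (cokernel.π (d i)) (by simp) ⟶ syzygySequence hd i :=
      { τ₁ := cokernel.π (d (i + 1))
        τ₂ := 𝟙 _
        τ₃ := 𝟙 _ }
    have : Epi φ.τ₁ := by dsimp [φ]; infer_instance
    have : IsIso φ.τ₂ := by dsimp [φ]; infer_instance
    have : Mono φ.τ₃ := by dsimp [φ]; infer_instance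
    exact (ShortComplex.exact_iff_of_epi_of_isIso_of_mono φ).mp h
  mono_f := (hex i).mono_cokernelDesc
  epi_g := by dsimp; infer_instance

variable (hex : ∀ i, (ShortComplex.mk (d (i + 1)) (d i) (hd i)).Exact) {X : C}
  (θ : X ≅ syzygy d 0)

/-- The iterated extension class in `Ext^i(X, Ω_i)`. -/
noncomputable def syzygyClass : ∀ i : ℕ, Ext.{w₃} X (syzygy d i) i
  | 0 => Ext.mk₀ θ.hom
  | i + 1 => (syzygyClass i).comp (syzygySequence_shortExact hd hex i).extClass rfl

variable [∀ i, Projective (P i)]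

/-- Dimension shifting: positive `Ext` out of the projective `P i` vanishes, so the connecting map
from `Ω_{i+1}` to `Ω_i` is surjective. -/
lemma exists_eq_syzygyClass_comp {M : C} (i j l : ℕ) (h : i + j = l) (y : Ext.{w₃} X M l) :
    ∃ η : Ext.{w₃} (syzygy d i) M j, y = (syzygyClass hd hex θ i).comp η h := by
  induction i generalizing j with
  | zero =>
    obtain rfl : j = l := by omega
    refine ⟨(Ext.mk₀ θ.inv).comp y (zero_add j), ?_⟩
    simp only [syzygyClass]
    rw [Ext.mk₀_comp_mk₀_assoc, θ.hom_inv_id, Ext.mk₀_id_comp]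
  | succ i ih =>
    obtain ⟨η, hη⟩ := ih (j + 1) (by omega)
    obtain ⟨η', hη'⟩ := Ext.contravariant_sequence_exact₃
      (syzygySequence_shortExact hd hex i) M η (Ext.eq_zero_of_projective (P := P i) _)
      (add_comm 1 j)
    refine ⟨η', ?_⟩
    rw [hη, ← hη']
    simp only [syzygyClass]
    rw [Ext.comp_assoc]
    omega

lemma exists_eq_syzygyClass_comp_mk₀ {M : C} (i : ℕ) (y : Ext.{w₃} X M i) :
    ∃ h : syzygy d i ⟶ M, y = (syzygyClass hd hex θ i).comp (Ext.mk₀ h) (add_zero i) := by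
  obtain ⟨η, hη⟩ := exists_eq_syzygyClass_comp hd hex θ i 0 i (add_zero i) y
  obtain ⟨h, rfl⟩ := (Ext.mk₀_bijective _ _).2 η
  exact ⟨h, hη⟩

/-- The kernel of a connecting map is the image of `Ext` out of a projective, which is zero in
positive degree; in degree zero this argument breaks down. -/
lemma eq_zero_of_syzygyClass_comp {M : C} (i j l : ℕ) (h : i + (j + 1) = l)
    (η : Ext.{w₃} (syzygy d i) M (j + 1)) (hη : (syzygyClass hd hex θ i).comp η h = 0) :
    η = 0 := by
  induction i generalizing j with
  | zero =>
    obtain rfl : l = j + 1 := by omega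
    have := congrArg (fun y => (Ext.mk₀ θ.inv).comp y (zero_add (j + 1))) hη
    simp only [syzygyClass, Ext.mk₀_comp_mk₀_assoc, θ.inv_hom_id, Ext.mk₀_id_comp,
      Ext.comp_zero] at this
    exact this
  | succ i ih =>
    simp only [syzygyClass] at hη
    rw [Ext.comp_assoc _ _ _ rfl (show 1 + (j + 1) = j + 1 + 1 by omega) (by omega)] at hη
    have h0 := ih (j + 1) (by omega) _ hη
    obtain ⟨η', rfl⟩ := Ext.contravariant_sequence_exact₁
      (syzygySequence_shortExact hd hex i) M η _ h0
    rw [Ext.eq_zero_of_projective (P := P i) η', Ext.comp_zero]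

/-- Only the last connecting map starts in degree zero; its kernel consists of the maps that extend
to `P i`. -/
lemma exists_factor_of_syzygyClass_comp_eq_zero {M : C} (i : ℕ) (h : syzygy d (i + 1) ⟶ M)
    (hh : (syzygyClass hd hex θ (i + 1)).comp (Ext.mk₀ h) (add_zero (i + 1)) = 0) :
    ∃ g : P i ⟶ M, h = cokernel.desc (d (i + 1)) (d i) (hd i) ≫ g := by
  simp only [syzygyClass, Ext.comp_assoc_of_third_deg_zero] at hh
  have h0 := eq_zero_of_syzygyClass_comp hd hex θ i 0 (i + 1) rfl _ hh
  obtain ⟨η', hη'⟩ := Ext.contravariant_sequence_exact₁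
    (syzygySequence_shortExact hd hex i) M (Ext.mk₀ h) (add_zero 1) h0
  obtain ⟨g, rfl⟩ := (Ext.mk₀_bijective _ _).2 η'
  refine ⟨g, (Ext.mk₀_bijective _ _).1 ?_⟩
  rw [← hη', Ext.mk₀_comp_mk₀]

/-- Minimality with respect to `M`: a difference that extends to `P i` vanishes after precomposition
with the differential. -/
lemma syzygyClass_comp_injective {M : C} (i : ℕ) (hM : ∀ g : P i ⟶ M, d i ≫ g = 0)
    {h h' : syzygy d (i + 1) ⟶ M}
    (hh : (syzygyClass hd hex θ (i + 1)).comp (Ext.mk₀ h) (add_zero (i + 1)) =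
      (syzygyClass hd hex θ (i + 1)).comp (Ext.mk₀ h') (add_zero (i + 1))) : h = h' := by
  rw [← sub_eq_zero]
  obtain ⟨g, hg⟩ := exists_factor_of_syzygyClass_comp_eq_zero hd hex θ i (h - h') (by
    rw [sub_eq_add_neg, Ext.mk₀_add, Ext.comp_add, Ext.mk₀_neg, Ext.comp_neg, hh,
      add_neg_cancel])
  rw [hg, ← cancel_epi (cokernel.π (d (i + 1)))]
  simpa using hM g

/-! ### Action of an exact functor on iterated extension classes -/

section Functor

variable (T : C ⥤ C) [T.Additive] [PreservesFiniteLimits T] [PreservesFiniteColimits T]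
  (Ψ : ∀ i, P i ⟶ T.obj (P i)) (hΨ : ∀ i, Ψ (i + 1) ≫ T.map (d i) = d i ≫ Ψ i)

/-- The map on syzygies induced by a map of complexes `P → T P`. -/
noncomputable def syzygyMap (i : ℕ) : syzygy d i ⟶ T.obj (syzygy d i) :=
  cokernel.desc (d i) (Ψ i ≫ T.map (cokernel.π (d i))) (by
    rw [← Category.assoc, ← hΨ, Category.assoc, ← T.map_comp, cokernel.condition, T.map_zero,
      comp_zero])

lemma π_syzygyMap (i : ℕ) : cokernel.π (d i) ≫ syzygyMap T Ψ hΨ i =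
    Ψ i ≫ T.map (cokernel.π (d i)) := cokernel.π_desc _ _ _

/-- The chain map `Ψ` induces morphisms from each syzygy sequence to its image under `T`, and
extension classes are natural in short exact sequences. -/
lemma mk₀_comp_mapExactFunctor_syzygyClass (ι : X ⟶ T.obj X)
    (hι : ι ≫ T.map θ.hom = θ.hom ≫ syzygyMap T Ψ hΨ 0) (i : ℕ) :
    (Ext.mk₀ ι).comp ((syzygyClass hd hex θ i).mapExactFunctor T) (zero_add i) =
      (syzygyClass hd hex θ i).comp (Ext.mk₀ (syzygyMap T Ψ hΨ i)) (add_zero i) := by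
  induction i with
  | zero => simp only [syzygyClass, Ext.mapExactFunctor_mk₀, Ext.mk₀_comp_mk₀, hι]
  | succ i ih =>
    have h1 := syzygySequence_shortExact hd hex i
    have h12 : syzygyMap T Ψ hΨ (i + 1) ≫ T.map (cokernel.desc (d (i + 1)) (d i) (hd i)) =
        cokernel.desc (d (i + 1)) (d i) (hd i) ≫ Ψ i := by
      rw [← cancel_epi (cokernel.π (d (i + 1))), ← Category.assoc, π_syzygyMap, Category.assoc,
        ← T.map_comp]
      simp [hΨ]
    let φ : syzygySequence hd i ⟶ (syzygySequence hd i).map T :=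
      { τ₁ := syzygyMap T Ψ hΨ (i + 1)
        τ₂ := Ψ i
        τ₃ := syzygyMap T Ψ hΨ i
        comm₁₂ := h12
        comm₂₃ := (π_syzygyMap T Ψ hΨ i).symm }
    obtain ⟨δ, hδ, h2⟩ : ∃ δ : Ext.{w₃} (T.obj (syzygy d i)) (T.obj (syzygy d (i + 1))) 1,
        h1.extClass.mapExactFunctor T = δ ∧
        h1.extClass.comp (Ext.mk₀ (syzygyMap T Ψ hΨ (i + 1))) (add_zero 1) =
          (Ext.mk₀ (syzygyMap T Ψ hΨ i)).comp δ (zero_add 1) :=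
      ⟨_, Ext.mapExactFunctor_extClass T h1,
        ShortComplex.ShortExact.extClass_naturality h1 (h1.map_of_exact T) φ⟩
    simp only [syzygyClass, Ext.mapExactFunctor_comp, hδ]
    rw [Ext.comp_assoc_of_third_deg_zero, h2,
      ← Ext.comp_assoc (Ext.mk₀ ι) _ _ (zero_add i) rfl (by omega), ih,
      Ext.comp_assoc_of_second_deg_zero]

/-- Comparison of the two maps `Ext^{i+1}(X, X) → Ext^{i+1}(X, T X)` defined by `ι : X → T X`, for a
complex that is minimal with respect to `T X`. -/
lemma forall_ext_comp_eq_iff (hd : ∀ i, d (i + 1) ≫ d i = 0)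
    (hex : ∀ i, (ShortComplex.mk (d (i + 1)) (d i) (hd i)).Exact)
    (ι : X ⟶ T.obj X)
    (hι : ι ≫ T.map θ.hom = θ.hom ≫ syzygyMap T Ψ hΨ 0) (i : ℕ)
    (hM : ∀ g : P i ⟶ T.obj X, d i ≫ g = 0) :
    (∀ y : Ext.{w₃} X X (i + 1), (Ext.mk₀ ι).comp (y.mapExactFunctor T) (zero_add (i + 1)) =
        y.comp (Ext.mk₀ ι) (add_zero (i + 1))) ↔
      ∀ h : P (i + 1) ⟶ X, d (i + 1) ≫ h = 0 → Ψ (i + 1) ≫ T.map h = h ≫ ι := by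
  have key : ∀ h : syzygy d (i + 1) ⟶ X,
      (Ext.mk₀ ι).comp (((syzygyClass hd hex θ (i + 1)).comp (Ext.mk₀ h)
        (add_zero (i + 1))).mapExactFunctor T) (zero_add (i + 1)) =
      (syzygyClass hd hex θ (i + 1)).comp
        (Ext.mk₀ (syzygyMap T Ψ hΨ (i + 1) ≫ T.map h)) (add_zero (i + 1)) := by
    intro h
    rw [Ext.mapExactFunctor_comp, Ext.mapExactFunctor_mk₀,
      ← Ext.comp_assoc _ _ _ (zero_add (i + 1)) (add_zero (i + 1)) (by omega),
      mk₀_comp_mapExactFunctor_syzygyClass hd hex θ T Ψ hΨ ι hι,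
      Ext.comp_assoc_of_second_deg_zero, Ext.mk₀_comp_mk₀]
  constructor
  · intro hy h hh
    have h1 := hy ((syzygyClass hd hex θ (i + 1)).comp
      (Ext.mk₀ (cokernel.desc (d (i + 1)) h hh)) (add_zero (i + 1)))
    rw [key, Ext.comp_assoc_of_second_deg_zero, Ext.mk₀_comp_mk₀] at h1
    have h2 := syzygyClass_comp_injective hd hex θ i hM h1
    have h3 := congrArg (fun g => cokernel.π (d (i + 1)) ≫ g) h2
    simp only [← Category.assoc, π_syzygyMap, cokernel.π_desc] at h3
    rw [← h3, Category.assoc, ← T.map_comp, cokernel.π_desc]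
  · intro hh y
    obtain ⟨h, rfl⟩ := exists_eq_syzygyClass_comp_mk₀ hd hex θ (i + 1) y
    rw [key, Ext.comp_assoc_of_second_deg_zero, Ext.mk₀_comp_mk₀]
    congr 2
    rw [← cancel_epi (cokernel.π (d (i + 1))), ← Category.assoc, π_syzygyMap, Category.assoc,
      ← T.map_comp, hh _ (by simp), Category.assoc]

end Functor

/-! ### Linear relations forced by one-dimensional `Ext` -/

section Linear

variable {k : Type*} [Field k] [CategoryTheory.Linear k C]

/-- If `Ext^i(X, A)` is one-dimensional, `A → X` is an epimorphism and `X` has projective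
dimension at most `i`, then any two elements of `Ext^i(X, X)` are linearly dependent. -/
lemma exists_linear_relation_ext {A : C} (g : A ⟶ X) [Epi g] (i : ℕ)
    [HasProjectiveDimensionLT X (i + 1)] (h1 : Module.finrank k (Ext.{w₃} X A i) = 1)
    (y y' : Ext.{w₃} X X i) : ∃ s t : k, (s ≠ 0 ∨ t ≠ 0) ∧ s • y + t • y' = 0 := by
  have hS : (ShortComplex.mk (kernel.ι g) g (kernel.condition g)).ShortExact :=
    { exact := ShortComplex.exact_kernel g }
  -- The obstruction to lifting lies in `Ext^{i+1}(X, ker g)`, which vanishes by the bound on the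
  -- projective dimension of `X`.
  have hsurj : ∀ y : Ext.{w₃} X X i, ∃ x : Ext.{w₃} X A i,
      x.comp (Ext.mk₀ g) (add_zero i) = y := fun y =>
    Ext.covariant_sequence_exact₃ X hS y rfl
      (Ext.eq_zero_of_hasProjectiveDimensionLT _ (i + 1) le_rfl)
  obtain ⟨v, -, hv⟩ := finrank_eq_one_iff'.mp h1
  obtain ⟨x, rfl⟩ := hsurj y
  obtain ⟨x', rfl⟩ := hsurj y'
  obtain ⟨c, rfl⟩ := hv x
  obtain ⟨c', rfl⟩ := hv x'
  by_cases hc : c = 0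
  · exact ⟨1, 0, by simp, by simp [hc]⟩
  · refine ⟨-c', c, Or.inr hc, ?_⟩
    simp only [Ext.smul_comp, smul_smul]
    rw [← add_smul, neg_mul, mul_comm c', neg_add_cancel, zero_smul]

/-- Cocycles `P (i + 1) → X` represent classes in `Ext^{i+1}(X, X)`, and by minimality a relation
between the classes already holds between the cocycles. -/
lemma exists_linear_relation_hom (hd : ∀ i, d (i + 1) ≫ d i = 0)
    (hex : ∀ i, (ShortComplex.mk (d (i + 1)) (d i) (hd i)).Exact)
    (θ : X ≅ syzygy d 0) {A : C} (g : A ⟶ X) [Epi g] (i : ℕ)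
    (hM : ∀ g : P i ⟶ X, d i ≫ g = 0)
    [HasProjectiveDimensionLT X (i + 1 + 1)] (h1 : Module.finrank k (Ext.{w₃} X A (i + 1)) = 1)
    (h h' : P (i + 1) ⟶ X) (hh : d (i + 1) ≫ h = 0) (hh' : d (i + 1) ≫ h' = 0) :
    ∃ s t : k, (s ≠ 0 ∨ t ≠ 0) ∧ s • h + t • h' = 0 := by
  obtain ⟨s, t, hst, h0⟩ := exists_linear_relation_ext g (i + 1) h1
    ((syzygyClass hd hex θ (i + 1)).comp
      (Ext.mk₀ (cokernel.desc (d (i + 1)) h hh)) (add_zero (i + 1)))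
    ((syzygyClass hd hex θ (i + 1)).comp
      (Ext.mk₀ (cokernel.desc (d (i + 1)) h' hh')) (add_zero (i + 1)))
  refine ⟨s, t, hst, ?_⟩
  rw [← Ext.comp_smul, ← Ext.comp_smul, ← Ext.comp_add, ← Ext.mk₀_smul, ← Ext.mk₀_smul,
    ← Ext.mk₀_add] at h0
  have h2 := syzygyClass_comp_injective hd hex θ i hM (h' := 0) (by
    rw [h0, Ext.mk₀_zero, Ext.comp_zero])
  have h3 := congrArg (fun g => cokernel.π (d (i + 1)) ≫ g) h2
  simpa using h3

end Linear

/-! ### Resolutions given with an augmentation -/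

section Augmentation

variable (ε : P 0 ⟶ X) [Epi ε] (hε : d 0 ≫ ε = 0) (hεx : (ShortComplex.mk (d 0) ε hε).Exact)

/-- The augmentation identifies the zeroth syzygy object with `X`. -/
noncomputable def augmentationIso : X ≅ syzygy d 0 := by
  have h1 : Mono (cokernel.desc (d 0) ε hε) := hεx.mono_cokernelDesc
  have h2 : Epi (cokernel.desc (d 0) ε hε) := epi_of_epi_fac (cokernel.π_desc _ _ hε)
  have h3 := isIso_of_mono_of_epi (cokernel.desc (d 0) ε hε)
  exact (asIso (cokernel.desc (d 0) ε hε)).symm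

lemma π_augmentationIso_inv :
    cokernel.π (d 0) ≫ (augmentationIso ε hε hεx).inv = ε :=
  cokernel.π_desc _ _ hε

/-- `forall_ext_comp_eq_iff` for an augmented complex. -/
lemma forall_ext_comp_eq_iff_of_augmentation (hd : ∀ i, d (i + 1) ≫ d i = 0)
    (hex : ∀ i, (ShortComplex.mk (d (i + 1)) (d i) (hd i)).Exact)
    (hεx : (ShortComplex.mk (d 0) ε hε).Exact)
    (T : C ⥤ C) [T.Additive] [PreservesFiniteLimits T] [PreservesFiniteColimits T]
    (Ψ : ∀ i, P i ⟶ T.obj (P i)) (hΨ : ∀ i, Ψ (i + 1) ≫ T.map (d i) = d i ≫ Ψ i)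
    (ι : X ⟶ T.obj X) (hι : ε ≫ ι = Ψ 0 ≫ T.map ε) (i : ℕ)
    (hM : ∀ g : P i ⟶ T.obj X, d i ≫ g = 0) :
    (∀ y : Ext.{w₃} X X (i + 1), (Ext.mk₀ ι).comp (y.mapExactFunctor T) (zero_add (i + 1)) =
        y.comp (Ext.mk₀ ι) (add_zero (i + 1))) ↔
      ∀ h : P (i + 1) ⟶ X, d (i + 1) ≫ h = 0 → Ψ (i + 1) ≫ T.map h = h ≫ ι := by
  refine forall_ext_comp_eq_iff (augmentationIso ε hε hεx) T Ψ hΨ hd hex ι ?_ i hM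
  have h1 : (augmentationIso ε hε hεx).inv ≫ ι =
      syzygyMap T Ψ hΨ 0 ≫ T.map (augmentationIso ε hε hεx).inv := by
    rw [← cancel_epi (cokernel.π (d 0)), ← Category.assoc, π_augmentationIso_inv, hι,
      ← Category.assoc, π_syzygyMap, Category.assoc, ← T.map_comp, π_augmentationIso_inv]
  rw [← cancel_epi (augmentationIso ε hε hεx).inv, ← Category.assoc, h1, Category.assoc,
    ← T.map_comp, Iso.inv_hom_id, T.map_id, Category.comp_id, Iso.inv_hom_id_assoc]

/-- `exists_linear_relation_hom` for an augmented complex. -/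
lemma exists_linear_relation_hom_of_augmentation {k : Type*} [Field k]
    [CategoryTheory.Linear k C] (hd : ∀ i, d (i + 1) ≫ d i = 0)
    (hex : ∀ i, (ShortComplex.mk (d (i + 1)) (d i) (hd i)).Exact)
    (hεx : (ShortComplex.mk (d 0) ε hε).Exact) {A : C} (g : A ⟶ X) [Epi g] (i : ℕ)
    (hM : ∀ g : P i ⟶ X, d i ≫ g = 0)
    [HasProjectiveDimensionLT X (i + 1 + 1)] (h1 : Module.finrank k (Ext.{w₃} X A (i + 1)) = 1)
    (h h' : P (i + 1) ⟶ X) (hh : d (i + 1) ≫ h = 0) (hh' : d (i + 1) ≫ h' = 0) :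
    ∃ s t : k, (s ≠ 0 ∨ t ≠ 0) ∧ s • h + t • h' = 0 :=
  exists_linear_relation_hom hd hex (augmentationIso ε hε hεx) g i hM h1 h h' hh hh'

end Augmentation

end DimensionShifting

/-! ## The Koszul complex of left modules -/

section KoszulComplex

variable {k : Type u} [Field k] {n m : ℕ} {c : (Fin m → Fin n) → k} {N : ℕ}

/-- A vector with scalar entries in the free module over `A(c, N)`. -/
noncomputable def constVec (c : (Fin m → Fin n) → k) (N : ℕ) {I : Type*} (w : I → k) :
    I → SPAlg c N :=
  fun i => algebraMap k (SPAlg c N) (w i)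

lemma koszulTerm_induction {ℓ : ℕ} {M : Type*} [AddCommGroup M] [Module (SPAlg c N) M]
    {f g : koszulTerm c N ℓ →ₗ[SPAlg c N] M}
    (h : ∀ (w : (Fin ℓ → Fin n) → k) (hw : constVec c N w ∈ koszulTerm c N ℓ),
      w ∈ koszulSpace c N ℓ → f ⟨constVec c N w, hw⟩ = g ⟨constVec c N w, hw⟩) : f = g := by
  apply LinearMap.ext
  rintro ⟨F, hF⟩
  refine Submodule.span_induction (p := fun F hF => f ⟨F, hF⟩ = g ⟨F, hF⟩)
    ?_ ?_ ?_ ?_ hF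
  · rintro _ ⟨w, hw, rfl⟩
    exact h w _ hw
  · exact (map_zero f).trans (map_zero g).symm
  · intro F G hF hG h1 h2
    exact (map_add f ⟨F, hF⟩ ⟨G, hG⟩).trans ((congrArg₂ _ h1 h2).trans
      (map_add g ⟨F, hF⟩ ⟨G, hG⟩).symm)
  · intro r F hF h1
    exact (map_smul f r ⟨F, hF⟩).trans ((congrArg _ h1).trans (map_smul g r ⟨F, hF⟩).symm)

lemma constVec_mem {ℓ : ℕ} {w : (Fin ℓ → Fin n) → k} (hw : w ∈ koszulSpace c N ℓ) :
    constVec c N w ∈ koszulTerm c N ℓ :=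
  Submodule.subset_span ⟨w, hw, rfl⟩

/-- `koszulDiff` as a linear map. -/
noncomputable def koszulDiffHom (c : (Fin m → Fin n) → k) (N a b : ℕ) :
    ((Fin a → Fin n) → SPAlg c N) →ₗ[SPAlg c N] ((Fin b → Fin n) → SPAlg c N) where
  toFun := koszulDiff c N a b
  map_add' F G := by
    ext j
    simp [koszulDiff, add_mul, Finset.sum_add_distrib]
  map_smul' r F := by
    ext j
    simp [koszulDiff, mul_assoc, Finset.mul_sum]

lemma koszulDiff_constVec {a b : ℕ} (w : (Fin a → Fin n) → k) :
    koszulDiff c N a b (constVec c N w) = ∑ i : Fin (a - b) → Fin n,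
      word (SPAlg.x c N) i • constVec c N fun j => w (glue i j) := by
  ext j
  simp [koszulDiff, constVec, Finset.sum_apply, Algebra.commutes]

lemma glue_mem_koszulSpace {a b : ℕ} (hab : b ≤ a) {w : (Fin a → Fin n) → k}
    (hw : w ∈ koszulSpace c N a) (i : Fin (a - b) → Fin n) :
    (fun j => w (glue i j)) ∈ koszulSpace c N b := fun p hp j => by
  have := hw (a - b + p) (by omega) (glue i j)
  simpa only [glue_eq_cat hab, splice_cat] using this

lemma koszulDiff_mem {a b : ℕ} (hab : b ≤ a) {F : (Fin a → Fin n) → SPAlg c N}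
    (hF : F ∈ koszulTerm c N a) : koszulDiff c N a b F ∈ koszulTerm c N b := by
  have h : koszulTerm c N a ≤ (koszulTerm c N b).comap (koszulDiffHom c N a b) := by
    refine Submodule.span_le.mpr ?_
    rintro _ ⟨w, hw, rfl⟩
    change koszulDiff c N a b (constVec c N w) ∈ koszulTerm c N b
    rw [koszulDiff_constVec]
    exact Submodule.sum_mem _ fun i _ => Submodule.smul_mem _ _
      (constVec_mem (glue_mem_koszulSpace hab hw i))
  exact h hF

/-- The differentials of the Koszul complex. -/
noncomputable def koszulTermDiff (c : (Fin m → Fin n) → k) (N : ℕ) {a b : ℕ} (hab : b ≤ a) :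
    koszulTerm c N a →ₗ[SPAlg c N] koszulTerm c N b :=
  (koszulDiffHom c N a b).restrict fun _ hF => koszulDiff_mem hab hF

/-- Together the two maps multiply the first `N` tensor factors into `A`. That block of an element
of `W_a` lies in the relation space, so its product is zero. -/
lemma koszulDiff_koszulDiff {a b b' : ℕ} (hab : b ≤ a) (hb : b' ≤ b) (hN : N + b' = a)
    {F : (Fin a → Fin n) → SPAlg c N} (hF : F ∈ koszulTerm c N a) :
    koszulDiff c N b b' (koszulDiff c N a b F) = 0 := by
  have h : koszulTerm c N a ≤
      LinearMap.ker ((koszulDiffHom c N b b').comp (koszulDiffHom c N a b)) := by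
    refine Submodule.span_le.mpr ?_
    rintro _ ⟨w, hw, rfl⟩
    change koszulDiff c N b b' (koszulDiff c N a b (constVec c N w)) = 0
    ext j
    have h1 : (fun t : Fin N → Fin n => w (cat hN t j)) ∈ relSpace c N := by
      rcases isEmpty_or_nonempty (Fin N → Fin n) with h | ⟨⟨t⟩⟩
      · rw [Subsingleton.elim (fun t : Fin N → Fin n => w (cat hN t j)) 0]
        exact Submodule.zero_mem _
      · have := hw 0 (by omega) (cat hN t j)
        simpa only [splice_zero_eq_cat] using this
    have h2 : ∑ t : Fin N → Fin n, w (cat hN t j) • word (SPAlg.x c N) t = 0 := by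
      refine OM.relSpace_smul_sum (fun lam => ?_) _ h1
      exact SPAlg.rel c N lam
    have h3 : (a - b) + (b - b') = N := by omega
    rw [sum_cat h3, Finset.sum_comm] at h2
    rw [Pi.zero_apply, ← h2]
    simp only [koszulDiff]
    refine Finset.sum_congr rfl fun t _ => ?_
    rw [Finset.sum_mul]
    refine Finset.sum_congr rfl fun s _ => ?_
    rw [word_cat, Algebra.smul_def, mul_assoc, constVec, glue_eq_cat hab, glue_eq_cat hb]
    congr 3
    refine funext fun q => ?_
    simp only [cat]
    split_ifs
    any_goals first | rfl | omega
    exact congrArg j (Fin.ext (show (q : ℕ) - (a - b) - (b - b') = q - N by omega))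
  exact h hF

/-- A homomorphism into a module annihilated by the generators vanishes on boundaries. -/
lemma hom_koszulTermDiff_eq_zero {a b : ℕ} (hab : b < a) {M : Type*} [AddCommGroup M]
    [Module (SPAlg c N) M] (hM : ∀ (i : Fin n) (y : M), SPAlg.x c N i • y = 0)
    (g : koszulTerm c N b →ₗ[SPAlg c N] M) : g.comp (koszulTermDiff c N hab.le) = 0 := by
  refine koszulTerm_induction fun w hw' hw => ?_
  have h : koszulTermDiff c N hab.le ⟨constVec c N w, hw'⟩ = ∑ i : Fin (a - b) → Fin n,
      word (SPAlg.x c N) i •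
        (⟨_, constVec_mem (glue_mem_koszulSpace hab.le hw i)⟩ : koszulTerm c N b) := by
    apply Subtype.ext
    refine (koszulDiff_constVec (b := b) w).trans ?_
    simp
  rw [LinearMap.comp_apply, h, map_sum, LinearMap.zero_apply]
  refine Finset.sum_eq_zero fun i _ => ?_
  obtain ⟨r, hr⟩ : ∃ r, a - b = 1 + r := ⟨a - b - 1, by omega⟩
  obtain ⟨s, t, rfl⟩ := exists_cat hr.symm i
  rw [map_smul, word_cat, mul_smul]
  have : word (SPAlg.x c N) s = SPAlg.x c N (s 0) := by simp [word]
  rw [this, hM]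

/-! ### Koszul terms as direct summands of free modules -/

lemma exists_projection {I : Type*} [Fintype I] (W : Submodule k (I → k)) :
    ∃ p : (I → k) →ₗ[k] (I → k), (∀ w, p w ∈ W) ∧ ∀ w ∈ W, p w = w := by
  obtain ⟨q, hq⟩ := W.subtype.exists_leftInverse_of_injective W.ker_subtype
  refine ⟨W.subtype.comp q, fun w => (q w).2, fun w hw => ?_⟩
  simpa using congrArg Subtype.val (LinearMap.congr_fun hq ⟨w, hw⟩)

lemma sum_smul_single {I : Type*} [Fintype I] [DecidableEq I] {M : Type*} [AddCommGroup M]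
    [Module k M] (p : (I → k) →ₗ[k] M) (w : I → k) : ∑ i, w i • p (Pi.single i 1) = p w := by
  conv_rhs => rw [← Finset.univ_sum_single w, map_sum]
  refine Finset.sum_congr rfl fun j _ => ?_
  rw [← map_smul]
  congr 1
  ext l
  simp [Pi.single_apply]

/-- The projection onto `W_ℓ` of `Z^{⊗ℓ}`. -/
noncomputable def koszulProj (c : (Fin m → Fin n) → k) (N ℓ : ℕ) :
    ((Fin ℓ → Fin n) → k) →ₗ[k] ((Fin ℓ → Fin n) → k) :=
  (exists_projection (koszulSpace c N ℓ)).choose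

lemma koszulProj_mem {ℓ : ℕ} (w : (Fin ℓ → Fin n) → k) :
    koszulProj c N ℓ w ∈ koszulSpace c N ℓ :=
  (exists_projection (koszulSpace c N ℓ)).choose_spec.1 w

lemma koszulProj_eq {ℓ : ℕ} {w : (Fin ℓ → Fin n) → k} (hw : w ∈ koszulSpace c N ℓ) :
    koszulProj c N ℓ w = w :=
  (exists_projection (koszulSpace c N ℓ)).choose_spec.2 w hw

/-- The projection of `A ⊗ Z^{⊗ℓ}` onto `A ⊗ W_ℓ`. -/
noncomputable def koszulTermProj (c : (Fin m → Fin n) → k) (N ℓ : ℕ) :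
    ((Fin ℓ → Fin n) → SPAlg c N) →ₗ[SPAlg c N] koszulTerm c N ℓ :=
  Fintype.linearCombination (SPAlg c N) fun i =>
    ⟨constVec c N (koszulProj c N ℓ (Pi.single i 1)), constVec_mem (koszulProj_mem _)⟩

lemma koszulTermProj_coe {ℓ : ℕ} (F : (Fin ℓ → Fin n) → SPAlg c N) :
    (koszulTermProj c N ℓ F : (Fin ℓ → Fin n) → SPAlg c N) =
      ∑ i, F i • constVec c N (koszulProj c N ℓ (Pi.single i 1)) := by
  simp [koszulTermProj, Fintype.linearCombination_apply]

lemma koszulTermProj_constVec {ℓ : ℕ} (w : (Fin ℓ → Fin n) → k) :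
    (koszulTermProj c N ℓ (constVec c N w) : (Fin ℓ → Fin n) → SPAlg c N) =
      constVec c N (koszulProj c N ℓ w) := by
  rw [koszulTermProj_coe, ← sum_smul_single (koszulProj c N ℓ) w]
  ext j
  simp [constVec, Finset.sum_apply, Algebra.smul_def]

lemma koszulTermProj_subtype (ℓ : ℕ) :
    (koszulTermProj c N ℓ).comp (koszulTerm c N ℓ).subtype = LinearMap.id := by
  refine koszulTerm_induction fun w hw' hw => ?_
  apply Subtype.ext
  refine (koszulTermProj_constVec w).trans ?_
  rw [koszulProj_eq hw]
  rfl

instance (ℓ : ℕ) : Module.Projective (SPAlg c N) (koszulTerm c N ℓ) :=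
  Module.Projective.of_split (koszulTerm c N ℓ).subtype (koszulTermProj c N ℓ)
    (koszulTermProj_subtype ℓ)

/-! ### Compatible matrices act on Koszul spaces -/

lemma IsCompatible.sum_relSpace {K : Type*} [Ring K] [Algebra k K] {a : Fin n → Fin n → K}
    (ha : IsCompatible c N a) {r : (Fin N → Fin n) → k} (hr : r ∈ relSpace c N)
    {μ : (Fin N → Fin n) → k} (hμ : IsAnnihilating c μ) :
    ∑ i, r i • ∑ j, μ j • word₂ a i j = 0 := by
  refine OM.relSpace_smul_sum (fun lam => ?_) r hr
  rw [← ha lam μ hμ]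
  simp only [Finset.smul_sum, smul_smul]

/-- Words in `a` are multiplicative under concatenation, so contracting the window against `μ`
leaves compatibility for that window between a left and a right factor. -/
lemma IsCompatible.sum_splice {K : Type*} [Ring K] [Algebra k K] {a : Fin n → Fin n → K}
    (ha : IsCompatible c N a) {ℓ : ℕ} {w : (Fin ℓ → Fin n) → k} (hw : w ∈ koszulSpace c N ℓ)
    {p : ℕ} (hp : p + N ≤ ℓ) (i : Fin ℓ → Fin n) {μ : (Fin N → Fin n) → k}
    (hμ : IsAnnihilating c μ) :
    ∑ j, μ j • ∑ l, w l • word₂ a l (splice i p j) = 0 := by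
  obtain ⟨r, hr⟩ : ∃ r, p + (N + r) = ℓ := ⟨ℓ - p - N, by omega⟩
  obtain ⟨s, i', rfl⟩ := exists_cat hr i
  obtain ⟨t, y, rfl⟩ := exists_cat (rfl : N + r = N + r) i'
  have hsp : ∀ (s : Fin p → Fin n) (t : Fin N → Fin n) (y : Fin r → Fin n) (j : Fin N → Fin n),
      splice (cat hr s (cat rfl t y)) p j = cat hr s (cat rfl j y) := fun s t y j => by
    have := splice_cat hr s (cat rfl t y) 0 j
    rw [add_zero] at this
    rw [this, splice_zero_eq_cat]
  have key : ∀ (s' : Fin p → Fin n) (y' : Fin r → Fin n),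
      ∑ t', w (cat hr s' (cat rfl t' y')) • ∑ j, μ j • word₂ a t' j = 0 := fun s' y' => by
    refine ha.sum_relSpace ?_ hμ
    have := hw p hp (cat hr s' (cat rfl t y'))
    simpa only [hsp] using this
  calc ∑ j, μ j • ∑ l, w l • word₂ a l (splice (cat hr s (cat rfl t y)) p j)
      = ∑ s', ∑ y', word₂ a s' s *
          (∑ t', w (cat hr s' (cat rfl t' y')) • ∑ j, μ j • word₂ a t' j) * word₂ a y' y := by
        simp only [hsp, Finset.smul_sum, Finset.mul_sum, Finset.sum_mul]
        conv_lhs =>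
          enter [2, j]
          rw [sum_cat hr]
          enter [2, s']
          rw [sum_cat (rfl : N + r = N + r), Finset.sum_comm]
        rw [Finset.sum_comm]
        refine Finset.sum_congr rfl fun s' _ => ?_
        rw [Finset.sum_comm]
        refine Finset.sum_congr rfl fun y' _ => ?_
        rw [Finset.sum_comm]
        refine Finset.sum_congr rfl fun t' _ => Finset.sum_congr rfl fun j _ => ?_
        rw [word₂_cat, word₂_cat]
        simp only [mul_smul_comm, smul_mul_assoc, mul_assoc, smul_smul, mul_comm]
    _ = 0 := by simp [key]

/-- The coaction on `Z^{⊗ℓ}` given by a compatible matrix maps `W_ℓ` to `K ⊗ W_ℓ`. -/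
lemma IsCompatible.functional_mem {K : Type*} [Ring K] [Algebra k K] {a : Fin n → Fin n → K}
    (ha : IsCompatible c N a) {ℓ : ℕ} {w : (Fin ℓ → Fin n) → k} (hw : w ∈ koszulSpace c N ℓ)
    (φ : K →ₗ[k] k) : (fun j => φ (∑ l, w l • word₂ a l j)) ∈ koszulSpace c N ℓ :=
  fun p hp i => by
    rw [mem_iff_forall_annihilator]
    intro μ hμ
    have := congrArg φ (ha.sum_splice hw hp i (OM.annihilates_relSpace.mpr hμ))
    rw [map_sum, map_zero] at this
    rw [← this]
    refine Finset.sum_congr rfl fun j _ => ?_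
    rw [map_smul, smul_eq_mul, mul_comm]

lemma eq_of_forall_functional {M : Type*} [AddCommGroup M] [Module k M] {x y : M}
    (h : ∀ φ : M →ₗ[k] k, φ x = φ y) : x = y := by
  rw [← sub_eq_zero]
  exact (Module.forall_dual_apply_eq_zero_iff k _).mp fun φ => by rw [map_sub, h, sub_self]

/-- The statement that the coaction maps `W_ℓ` into `K ⊗ W_ℓ`, in the form that projecting the
second factor onto `W_ℓ` changes nothing; it is tested by functionals on `K`. -/
lemma IsCompatible.sum_koszulProj {K : Type*} [Ring K] [Algebra k K] {a : Fin n → Fin n → K}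
    (ha : IsCompatible c N a) {ℓ : ℕ} {w : (Fin ℓ → Fin n) → k} (hw : w ∈ koszulSpace c N ℓ)
    (j : Fin ℓ → Fin n) :
    ∑ i, koszulProj c N ℓ (Pi.single i 1) j • ∑ l, w l • word₂ a l i =
      ∑ l, w l • word₂ a l j := by
  refine eq_of_forall_functional (k := k) fun φ => ?_
  have h := congrFun (koszulProj_eq (ha.functional_mem hw φ)) j
  rw [← sum_smul_single] at h
  simp only [Finset.sum_apply, Pi.smul_apply, smul_eq_mul] at h
  rw [← h, map_sum]
  refine Finset.sum_congr rfl fun i _ => ?_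
  rw [map_smul, smul_eq_mul, mul_comm]

/-- The element `g` of `K` with `∑_i c_i a_{i₁j₁} ⋯ a_{i_m j_m} = c_j g`. -/
noncomputable def codet (c : (Fin m → Fin n) → k) (j : Fin m → Fin n) {K : Type*} [Ring K]
    [Algebra k K] (a : Fin n → Fin n → K) : K :=
  (c j)⁻¹ • ∑ i, c i • word₂ a i j

lemma map_codet {j : Fin m → Fin n} {K L : Type*} [Ring K] [Algebra k K] [Ring L] [Algebra k L]
    (φ : K →ₐ[k] L) (a : Fin n → Fin n → K) :
    φ (codet c j a) = codet c j fun p q => φ (a p q) := by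
  simp only [codet, map_smul, map_sum, map_word₂]

/-- Each functional on `K` carries the coacted tensor to an element of `W_m = k c`; the coordinate
`j₀`, where `c` is nonzero, identifies the multiple. In particular `codet` does not depend on the
choice of `j₀`. -/
lemma IsCompatible.sum_eq_smul_codet {K : Type*} [Ring K] [Algebra k K]
    {a : Fin n → Fin n → K} (ha : IsCompatible c N a) (hc : c ∈ koszulSpace c N m)
    (hW : koszulSpace c N m ≤ Submodule.span k {c}) {j₀ : Fin m → Fin n} (hj : c j₀ ≠ 0)
    (j : Fin m → Fin n) : ∑ i, c i • word₂ a i j = c j • codet c j₀ a := by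
  refine eq_of_forall_functional (k := k) fun φ => ?_
  obtain ⟨s, hs⟩ := Submodule.mem_span_singleton.mp (hW (ha.functional_mem hc φ))
  have h1 := congrFun hs j
  have h2 := congrFun hs j₀
  simp only [Pi.smul_apply, smul_eq_mul] at h1 h2
  rw [codet, map_smul, map_smul, ← h1, ← h2]
  simp only [smul_eq_mul]
  field_simp

end KoszulComplex

/-! ## Twisted modules -/

section Twist

open CategoryTheory
open scoped ModuleCat

variable {k : Type u} [Field k] {A K : Type u} [Ring A] [Algebra k A] [Ring K] [Algebra k K]
  (ρ : A →ₐ[k] K ⊗[k] A) (M : ModuleCat.{u} A)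

namespace TwistModule

variable {ρ M}

lemma tmul_add (h : K) (x y : M) : tmul ρ M h (x + y) = tmul ρ M h x + tmul ρ M h y :=
  TensorProduct.tmul_add _ _ _

lemma tmul_zero (h : K) : tmul ρ M h 0 = 0 := TensorProduct.tmul_zero _ _

lemma tmul_sum {I : Type*} (s : Finset I) (h : K) (x : I → M) :
    tmul ρ M h (∑ i ∈ s, x i) = ∑ i ∈ s, tmul ρ M h (x i) :=
  TensorProduct.tmul_sum _ _ _

lemma sum_tmul {I : Type*} (s : Finset I) (h : I → K) (x : M) :
    tmul ρ M (∑ i ∈ s, h i) x = ∑ i ∈ s, tmul ρ M (h i) x :=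
  TensorProduct.sum_tmul _ _ _

lemma tmul_algebraMap_smul (r : k) (h : K) (x : M) :
    tmul ρ M h (algebraMap k A r • x) = tmul ρ M (r • h) x :=
  (TensorProduct.smul_tmul r h x).symm

lemma induction {p : TwistModule ρ M → Prop} (h0 : p 0) (ht : ∀ h x, p (tmul ρ M h x))
    (ha : ∀ x y, p x → p y → p (x + y)) (y : TwistModule ρ M) : p y :=
  TensorProduct.induction_on (motive := p) y h0 ht ha

lemma smul_tmul_of_eq_sum {I : Type*} {s : Finset I} {u : I → K} {t : I → A} {a : A}
    (ha : ρ a = ∑ i ∈ s, u i ⊗ₜ[k] t i) (h : K) (x : M) :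
    a • tmul ρ M h x = ∑ i ∈ s, tmul ρ M (u i * h) (t i • x) := by
  change twistAction ρ M a (h ⊗ₜ[k] x) = ∑ i ∈ s, ((u i * h) ⊗ₜ[k] (t i • x) : K ⊗[k] M)
  simp only [twistAction, AlgHom.comp_apply, ha, map_sum, LinearMap.sum_apply]
  refine Finset.sum_congr rfl fun i _ => ?_
  simp [Module.endTensorEndAlgHom_apply]

lemma algebraMap_smul_tmul (r : k) (h : K) (x : M) :
    algebraMap k A r • tmul ρ M h x = tmul ρ M (r • h) x := by
  have := smul_tmul_of_eq_sum (ρ := ρ) (M := M) (s := {()}) (u := fun _ => algebraMap k K r)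
    (t := fun _ => 1) (a := algebraMap k A r)
    (by simp [AlgHom.commutes, Algebra.TensorProduct.algebraMap_apply]) h x
  simpa [Algebra.smul_def] using this

lemma map_tmul {M' : ModuleCat.{u} A} (f : M ⟶ M') (h : K) (x : M) :
    twistMap ρ f (tmul ρ M h x) = tmul ρ M' h (f.hom x) := rfl

end TwistModule

lemma trivialModule_smul (ε : A →ₐ[k] k) (a : A) (y : trivialModule ε) :
    a • y = (show trivialModule ε from (ε a * (show k from y) : k)) := rfl

end Twist

/-! ## The coaction on the Koszul complex -/

section KoszulCoaction

open CategoryTheory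
open scoped ModuleCat

variable {k : Type u} [Field k] {n m : ℕ} (c : (Fin m → Fin n) → k) (N : ℕ)

/-- The free module `A ⊗ Z^{⊗ℓ}`. -/
noncomputable abbrev koszulFree (ℓ : ℕ) : ModuleCat.{u} (SPAlg c N) :=
  ModuleCat.of (SPAlg c N) ((Fin ℓ → Fin n) → SPAlg c N)

/-- The module `A ⊗ W_ℓ`. -/
noncomputable abbrev koszulObj (ℓ : ℕ) : ModuleCat.{u} (SPAlg c N) :=
  ModuleCat.of (SPAlg c N) (koszulTerm c N ℓ)

/-- The inclusion `A ⊗ W_ℓ → A ⊗ Z^{⊗ℓ}`. -/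
noncomputable abbrev koszulIncl (ℓ : ℕ) : koszulObj c N ℓ ⟶ koszulFree c N ℓ :=
  ModuleCat.ofHom (koszulTerm c N ℓ).subtype

/-- The projection `A ⊗ Z^{⊗ℓ} → A ⊗ W_ℓ`. -/
noncomputable abbrev koszulRetr (ℓ : ℕ) : koszulFree c N ℓ ⟶ koszulObj c N ℓ :=
  ModuleCat.ofHom (koszulTermProj c N ℓ)

lemma koszulIncl_retr (ℓ : ℕ) : koszulIncl c N ℓ ≫ koszulRetr c N ℓ = 𝟙 _ := by
  apply ModuleCat.hom_ext
  exact koszulTermProj_subtype ℓ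

variable {c N} {K : Type u} [Ring K] [Algebra k K] (ρ : SPAlg c N →ₐ[k] K ⊗[k] SPAlg c N)
  (a : Fin n → Fin n → K)

/-- The coaction `A ⊗ Z^{⊗ℓ} → K ⊗ A ⊗ Z^{⊗ℓ}`. -/
noncomputable def freeCoaction (ℓ : ℕ) :
    ((Fin ℓ → Fin n) → SPAlg c N) →ₗ[SPAlg c N] TwistModule ρ (koszulFree c N ℓ) :=
  Fintype.linearCombination (SPAlg c N) fun i : Fin ℓ → Fin n =>
    ∑ j, TwistModule.tmul ρ (koszulFree c N ℓ) (word₂ a i j) (Pi.single j 1)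

lemma freeCoaction_single {ℓ : ℕ} (i : Fin ℓ → Fin n) :
    freeCoaction ρ a ℓ (Pi.single i 1) =
      ∑ j, TwistModule.tmul ρ (koszulFree c N ℓ) (word₂ a i j) (Pi.single j 1) := by
  rw [freeCoaction, Fintype.linearCombination_apply_single, one_smul]

lemma freeCoaction_constVec {ℓ : ℕ} (w : (Fin ℓ → Fin n) → k) :
    freeCoaction ρ a ℓ (constVec c N w) =
      ∑ j, TwistModule.tmul ρ (koszulFree c N ℓ) (∑ i, w i • word₂ a i j) (Pi.single j 1) := by
  rw [freeCoaction, Fintype.linearCombination_apply]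
  simp only [constVec, Finset.smul_sum, TwistModule.sum_tmul]
  rw [Finset.sum_comm]
  refine Finset.sum_congr rfl fun j _ => Finset.sum_congr rfl fun i _ => ?_
  exact TwistModule.algebraMap_smul_tmul _ _ _

lemma koszulDiff_single {p b ℓ : ℕ} (hb : b ≤ ℓ) (hp : p = ℓ - b) (i : Fin p → Fin n)
    (j : Fin b → Fin n) (h : p + b = ℓ) :
    koszulDiff c N ℓ b (Pi.single (cat h i j) 1) = word (SPAlg.x c N) i • Pi.single j 1 := by
  subst hp
  ext j'
  simp only [koszulDiff, glue_eq_cat hb, Pi.single_apply, cat_inj, Pi.smul_apply, smul_eq_mul,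
    ite_mul, one_mul, zero_mul, mul_ite, mul_one, mul_zero]
  by_cases hj : j' = j
  · simp [hj]
  · simp [hj]

lemma rho_word {ρ : SPAlg c N →ₐ[k] K ⊗[k] SPAlg c N} {a : Fin n → Fin n → K}
    (h : ∀ i, ρ (SPAlg.x c N i) = ∑ j, a i j ⊗ₜ[k] SPAlg.x c N j) {p : ℕ} (i : Fin p → Fin n) :
    ρ (word (SPAlg.x c N) i) = ∑ j, word₂ a i j ⊗ₜ[k] word (SPAlg.x c N) j := by
  rw [map_word]
  simp only [h]
  exact word₂_comul (k := k) a (fun i (_ : Fin n) => SPAlg.x c N i) i i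

variable {ρ a}

/-- `freeCoaction` is linear for the twisted action, so basis vectors suffice; there the claim is
multiplicativity of `ρ` on the word moved into `A`. -/
lemma freeCoaction_koszulDiff
    (h : ∀ i, ρ (SPAlg.x c N i) = ∑ j, a i j ⊗ₜ[k] SPAlg.x c N j) {b ℓ : ℕ} (hb : b ≤ ℓ) :
    (twistMap ρ (M := koszulFree c N ℓ) (M' := koszulFree c N b)
      (ModuleCat.ofHom (koszulDiffHom c N ℓ b))).comp (freeCoaction ρ a ℓ) =
      (freeCoaction ρ a b).comp (koszulDiffHom c N ℓ b) := by
  refine (Pi.basisFun (SPAlg c N) (Fin ℓ → Fin n)).ext fun i => ?_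
  obtain ⟨s, t, rfl⟩ := exists_cat (Nat.sub_add_cancel hb) i
  rw [Pi.basisFun_apply, LinearMap.comp_apply, LinearMap.comp_apply, freeCoaction_single, map_sum]
  have h1 : koszulDiffHom c N ℓ b (Pi.single (cat (Nat.sub_add_cancel hb) s t) 1) =
    word (SPAlg.x c N) s • Pi.single t 1 := koszulDiff_single hb rfl s t _
  rw [h1, map_smul, freeCoaction_single, Finset.smul_sum, sum_cat (Nat.sub_add_cancel hb),
    Finset.sum_comm]
  refine Finset.sum_congr rfl fun t' _ => ?_
  rw [TwistModule.smul_tmul_of_eq_sum (rho_word h s)]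
  refine Finset.sum_congr rfl fun s' _ => ?_
  rw [TwistModule.map_tmul, word₂_cat]
  exact congrArg _ (koszulDiff_single hb rfl s' t' _)

lemma koszulTermProj_single {ℓ : ℕ} (j : Fin ℓ → Fin n) :
    (koszulTermProj c N ℓ (Pi.single j 1) : (Fin ℓ → Fin n) → SPAlg c N) =
      ∑ l, algebraMap k (SPAlg c N) (koszulProj c N ℓ (Pi.single j 1) l) •
        (Pi.single l 1 : (Fin ℓ → Fin n) → SPAlg c N) := by
  rw [koszulTermProj, Fintype.linearCombination_apply_single, one_smul]
  ext l
  simp [Pi.single_apply, constVec, Finset.sum_apply, Algebra.smul_def]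

/-- The coaction of `A ⊗ W_ℓ` lands in `K ⊗ A ⊗ W_ℓ`, which is fixed by the idempotent projecting
onto `A ⊗ W_ℓ`. -/
lemma freeCoaction_retr
    (h : ∀ i, ρ (SPAlg.x c N i) = ∑ j, a i j ⊗ₜ[k] SPAlg.x c N j) {ℓ : ℕ} :
    (twistMap ρ (koszulRetr c N ℓ ≫ koszulIncl c N ℓ)).comp
      ((freeCoaction ρ a ℓ).comp (koszulTerm c N ℓ).subtype) =
      (freeCoaction ρ a ℓ).comp (koszulTerm c N ℓ).subtype := by
  have ha := SPAlg.isCompatible_of_hom ρ h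
  refine koszulTerm_induction fun w hw' hw => ?_
  simp only [LinearMap.comp_apply, Submodule.subtype_apply]
  rw [freeCoaction_constVec, map_sum]
  have h3 : ∀ j : Fin ℓ → Fin n, twistMap ρ (koszulRetr c N ℓ ≫ koszulIncl c N ℓ)
      (TwistModule.tmul ρ (koszulFree c N ℓ) (∑ i, w i • word₂ a i j) (Pi.single j 1)) =
      ∑ l, TwistModule.tmul ρ (koszulFree c N ℓ) (koszulProj c N ℓ (Pi.single j 1) l •
        ∑ i, w i • word₂ a i j) (Pi.single l 1) := fun j => by
    rw [TwistModule.map_tmul]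
    refine (congrArg _ (koszulTermProj_single j)).trans ?_
    refine (TwistModule.tmul_sum _ _ _).trans (Finset.sum_congr rfl fun l _ => ?_)
    exact TwistModule.tmul_algebraMap_smul _ _ _
  rw [Finset.sum_congr rfl fun j _ => h3 j, Finset.sum_comm]
  refine Finset.sum_congr rfl fun l _ => ?_
  rw [← TwistModule.sum_tmul, ha.sum_koszulProj hw]

end KoszulCoaction

/-! ## The Koszul resolution -/

section KoszulResolution

open CategoryTheory CategoryTheory.Abelian CategoryTheory.Limits
open scoped ModuleCat

variable {k : Type u} [Field k] {n m : ℕ} (c : (Fin m → Fin n) → k) (N : ℕ)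

lemma koszulDegree_lt_succ {N : ℕ} (hN : 2 ≤ N) (i : ℕ) :
    koszulDegree N i < koszulDegree N (i + 1) := by
  rcases Nat.even_or_odd' i with ⟨r, rfl | rfl⟩
  · have h1 : 2 * r / 2 = r := by omega
    have h2 : (2 * r + 1) / 2 = r := by omega
    simp only [koszulDegree, h1, h2]
    omega
  · have h1 : (2 * r + 1 + 1) / 2 = r + 1 := by omega
    have h2 : (2 * r + 1) / 2 = r := by omega
    simp only [koszulDegree, h1, h2, mul_add]
    omega

lemma koszulDegree_add_two (N i : ℕ) : N + koszulDegree N i = koszulDegree N (i + 1 + 1) := by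
  have h1 : (i + 1 + 1) / 2 = i / 2 + 1 := by omega
  simp only [koszulDegree, h1, mul_add]
  omega

variable {N} (hN : 2 ≤ N)

/-- The terms of the Koszul complex. -/
noncomputable abbrev koszulSeq (N i : ℕ) : ModuleCat.{u} (SPAlg c N) :=
  koszulObj c N (koszulDegree N i)

/-- The differentials of the Koszul complex, as morphisms. -/
noncomputable def koszulMap (i : ℕ) : koszulSeq c N (i + 1) ⟶ koszulSeq c N i :=
  ModuleCat.ofHom (koszulTermDiff c N (koszulDegree_lt_succ hN i).le)

lemma koszulMap_comp (i : ℕ) : koszulMap c hN (i + 1) ≫ koszulMap c hN i = 0 := by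
  apply ModuleCat.hom_ext
  apply LinearMap.ext
  rintro ⟨F, hF⟩
  apply Subtype.ext
  exact koszulDiff_koszulDiff (koszulDegree_lt_succ hN _).le (koszulDegree_lt_succ hN _).le
    (koszulDegree_add_two N i) hF

variable {c}

lemma koszulMap_exact (hK : IsNKoszul c N) (i : ℕ) :
    (ShortComplex.mk (koszulMap c hN (i + 1)) (koszulMap c hN i) (koszulMap_comp c hN i)).Exact := by
  rw [ShortComplex.moduleCat_exact_iff]
  rintro ⟨F, hF⟩ h
  obtain ⟨G, hG, hGF⟩ := hK i F hF (congrArg Subtype.val h)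
  exact ⟨⟨G, hG⟩, Subtype.ext hGF⟩

instance (ℓ : ℕ) : Projective (koszulObj c N ℓ) :=
  (IsProjective.iff_projective (koszulTerm c N ℓ)).mp inferInstance

/-- Minimality of the Koszul complex: `koszulDegree` strictly increases, so every term of a
differential carries a generator. -/
lemma koszulMap_comp_eq_zero {M : ModuleCat.{u} (SPAlg c N)}
    (hM : ∀ (i : Fin n) (y : M), SPAlg.x c N i • y = 0) (i : ℕ)
    (g : koszulObj c N (koszulDegree N i) ⟶ M) : koszulMap c hN i ≫ g = 0 := by
  apply ModuleCat.hom_ext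
  exact hom_koszulTermDiff_eq_zero (koszulDegree_lt_succ hN i) hM g.hom

lemma koszulTerm_eq_top {ℓ : ℕ} (hℓ : ℓ < N) : koszulTerm c N ℓ = ⊤ := by
  rw [eq_top_iff]
  intro F _
  have h : F = ∑ i, F i • constVec c N (Pi.single i 1) := by
    ext j
    simp [constVec, Finset.sum_apply, Pi.single_apply, apply_ite]
  rw [h]
  exact Submodule.sum_mem _ fun i _ => Submodule.smul_mem _ _
    (constVec_mem fun p hp _ => by omega)

variable [NeZero N]

lemma SPAlg.x_smul_trivialModule (i : Fin n) (y : trivialModule (SPAlg.aug c N)) :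
    SPAlg.x c N i • y = 0 := by
  rw [trivialModule_smul, SPAlg.aug_x]
  exact zero_mul (show k from y)

/-- The augmentation ideal is the left ideal generated by the `x_i`. -/
lemma SPAlg.exists_eq_aug_add (a : SPAlg c N) : ∃ r : Fin n → SPAlg c N,
    a = algebraMap k _ (SPAlg.aug c N a) + ∑ i, r i * SPAlg.x c N i := by
  have ha : a ∈ Algebra.adjoin k (Set.range (SPAlg.x c N)) := by
    rw [SPAlg.adjoin_range_x]; trivial
  induction ha using Algebra.adjoin_induction with
  | mem x hx =>
    obtain ⟨i, rfl⟩ := hx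
    exact ⟨Pi.single i 1, by simp [Pi.single_apply]⟩
  | algebraMap r => exact ⟨0, by simp⟩
  | add a b _ _ ha hb =>
    obtain ⟨r, hr⟩ := ha
    obtain ⟨s, hs⟩ := hb
    refine ⟨r + s, ?_⟩
    conv_lhs => rw [hr, hs]
    simp only [map_add, Pi.add_apply, add_mul, Finset.sum_add_distrib]
    abel
  | mul a b _ _ ha hb =>
    obtain ⟨r, hr⟩ := ha
    obtain ⟨s, hs⟩ := hb
    -- Expand the right factor `b` first, so that `a b = ε(b) a + ∑ a s_i x_i`, and then expand `a`
    -- in the first summand.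
    refine ⟨fun i => SPAlg.aug c N b • r i + a * s i, ?_⟩
    conv_lhs => rw [hs, mul_add, ← Algebra.commutes, ← Algebra.smul_def]
    conv_lhs =>
      enter [1, 2]
      rw [hr]
    simp only [Algebra.smul_def, add_mul, Finset.sum_add_distrib, mul_add,
      Finset.mul_sum, mul_assoc, map_mul]
    rw [add_assoc, ← map_mul, mul_comm, map_mul]

/-- The linear functionals on `Z^{⊗ℓ}` as homomorphisms `A ⊗ Z^{⊗ℓ} → k`. -/
noncomputable def augFunctional {ℓ : ℕ} (α : ((Fin ℓ → Fin n) → k) →ₗ[k] k) :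
    ((Fin ℓ → Fin n) → SPAlg c N) →ₗ[SPAlg c N] trivialModule (SPAlg.aug c N) where
  toFun F := by exact α fun i => SPAlg.aug c N (F i)
  map_add' F G := by
    refine Eq.trans ?_ (map_add α _ _)
    congr 1
    ext i
    simp
  map_smul' r F := by
    refine Eq.trans ?_ (map_smul α _ _)
    congr 1
    ext i
    simp

lemma augFunctional_apply {ℓ : ℕ} (α : ((Fin ℓ → Fin n) → k) →ₗ[k] k)
    (F : (Fin ℓ → Fin n) → SPAlg c N) :
    (id (augFunctional α F) : k) = α fun i => SPAlg.aug c N (F i) := rfl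

lemma augFunctional_constVec {ℓ : ℕ} (α : ((Fin ℓ → Fin n) → k) →ₗ[k] k)
    (w : (Fin ℓ → Fin n) → k) :
    (id (augFunctional (c := c) (N := N) α (constVec c N w)) : k) = α w := by
  rw [augFunctional_apply]
  simp only [constVec, AlgHom.commutes]
  rfl

/-- The sum of the coordinates. -/
noncomputable def sumFunctional (k : Type u) [Field k] (ℓ n : ℕ) :
    ((Fin ℓ → Fin n) → k) →ₗ[k] k :=
  Fintype.linearCombination k (fun _ => (1 : k))

/-- The augmentation of the Koszul complex. -/
noncomputable def koszulAug (c : (Fin m → Fin n) → k) (N ℓ : ℕ) [NeZero N] :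
    koszulObj c N ℓ ⟶ trivialModule (SPAlg.aug c N) :=
  ConcreteCategory.ofHom (C := ModuleCat (SPAlg c N)) (X := koszulObj c N ℓ)
    (Y := trivialModule (SPAlg.aug c N)) ((augFunctional (sumFunctional k ℓ n)).comp
      (koszulTerm c N ℓ).subtype)

lemma koszulMap_aug : koszulMap c hN 0 ≫ koszulAug c N (koszulDegree N 0) = 0 :=
  koszulMap_comp_eq_zero hN SPAlg.x_smul_trivialModule 0 _

/-- `IsNKoszul` asserts exactness in positive degrees only; at the augmentation exactness follows
because the `x_i` generate the augmentation ideal. -/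
lemma koszulDiff_surjective_of_aug {F : (Fin 0 → Fin n) → SPAlg c N}
    (hF : SPAlg.aug c N (F default) = 0) : ∃ G, koszulDiff c N 1 0 G = F := by
  obtain ⟨r, hr⟩ := SPAlg.exists_eq_aug_add (c := c) (N := N) (F default)
  refine ⟨fun i => r (i 0), ?_⟩
  refine funext fun j => ?_
  obtain rfl : j = default := Subsingleton.elim _ _
  refine Eq.trans ?_ hr.symm
  rw [hF, map_zero, zero_add]
  simp only [koszulDiff]
  refine Fintype.sum_equiv (Equiv.funUnique (Fin 1) (Fin n)) _ _ fun i => ?_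
  simp [word, glue]

lemma koszulMap_aug_exact :
    (ShortComplex.mk (koszulMap c hN 0) (koszulAug c N (koszulDegree N 0))
      (koszulMap_aug hN)).Exact := by
  rw [ShortComplex.moduleCat_exact_iff]
  have key : ∀ ℓ ℓ' : ℕ, ℓ = 0 → ℓ' = 1 → ∀ F : koszulObj c N ℓ, (koszulAug c N ℓ).hom F = 0 →
      ∃ G ∈ koszulTerm c N ℓ', koszulDiff c N ℓ' ℓ G = F.1 := by
    rintro _ _ rfl rfl ⟨F, hF⟩ h
    obtain ⟨G, hG⟩ := koszulDiff_surjective_of_aug (F := F) (by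
      have h' : sumFunctional k 0 n (fun i => SPAlg.aug c N (F i)) = 0 := h
      simpa [sumFunctional, Fintype.linearCombination_apply] using h')
    exact ⟨G, by rw [koszulTerm_eq_top (by omega)]; trivial, hG⟩
  intro F h
  obtain ⟨G, hG, hGF⟩ := key (koszulDegree N 0) (koszulDegree N 1) (by simp [koszulDegree])
    (by simp [koszulDegree]) F h
  exact ⟨⟨G, hG⟩, Subtype.ext hGF⟩

lemma koszulAug_epi : Epi (koszulAug c N (koszulDegree N 0)) := by
  rw [ModuleCat.epi_iff_surjective]
  have key : ∀ ℓ : ℕ, ℓ = 0 → ∀ y : trivialModule (SPAlg.aug c N),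
      ∃ F : koszulObj c N ℓ, (koszulAug c N ℓ).hom F = y := by
    rintro _ rfl y
    obtain ⟨r, rfl⟩ : ∃ r : k, r = y := ⟨y, rfl⟩
    have hN0 := NeZero.pos N
    refine ⟨⟨constVec c N fun _ => r, constVec_mem fun p hp _ => by omega⟩, ?_⟩
    have h : sumFunctional k 0 n (fun _ => r) = r := by
      simp [sumFunctional, Fintype.linearCombination_apply]
    exact (augFunctional_constVec (c := c) (N := N) (sumFunctional k 0 n) fun _ => r).trans h
  exact key _ (show koszulDegree N 0 = 0 by simp [koszulDegree])

end KoszulResolution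

/-! ## The coaction on the Koszul resolution and the codeterminant -/

section Codet

open CategoryTheory CategoryTheory.Abelian CategoryTheory.Limits
open scoped ModuleCat

variable {k : Type u} [Field k] {n m : ℕ} {c : (Fin m → Fin n) → k} {N : ℕ}
  {K : Type u} [Ring K] [Algebra k K] (ρ : SPAlg c N →ₐ[k] K ⊗[k] SPAlg c N)
  (a : Fin n → Fin n → K)

/-- `freeCoaction` as a morphism. -/
noncomputable def freeCoactionMap (ℓ : ℕ) : koszulFree c N ℓ ⟶ (twist ρ).obj (koszulFree c N ℓ) :=
  ModuleCat.ofHom (freeCoaction ρ a ℓ)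

/-- The coaction `A ⊗ W_ℓ → K ⊗ A ⊗ W_ℓ`. -/
noncomputable def koszulCoaction (ℓ : ℕ) : koszulObj c N ℓ ⟶ (twist ρ).obj (koszulObj c N ℓ) :=
  koszulIncl c N ℓ ≫ freeCoactionMap ρ a ℓ ≫ (twist ρ).map (koszulRetr c N ℓ)

variable {ρ a}

lemma koszulCoaction_incl (h : ∀ i, ρ (SPAlg.x c N i) = ∑ j, a i j ⊗ₜ[k] SPAlg.x c N j)
    (ℓ : ℕ) : koszulCoaction ρ a ℓ ≫ (twist ρ).map (koszulIncl c N ℓ) =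
      koszulIncl c N ℓ ≫ freeCoactionMap ρ a ℓ := by
  simp only [koszulCoaction, Category.assoc, ← Functor.map_comp]
  apply ModuleCat.hom_ext
  exact freeCoaction_retr h

lemma mono_twist_incl (ℓ : ℕ) : Mono ((twist ρ).map (koszulIncl c N ℓ)) := by
  have : Mono ((twist ρ).map (koszulIncl c N ℓ) ≫ (twist ρ).map (koszulRetr c N ℓ)) := by
    rw [← Functor.map_comp, koszulIncl_retr, CategoryTheory.Functor.map_id]
    infer_instance
  exact mono_of_mono _ ((twist ρ).map (koszulRetr c N ℓ))

/-- The chain map property is inherited from the free modules, since the twisted inclusion of `A ⊗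
W_ℓ` is a split monomorphism. -/
lemma koszulCoaction_koszulMap (h : ∀ i, ρ (SPAlg.x c N i) = ∑ j, a i j ⊗ₜ[k] SPAlg.x c N j)
    (hN : 2 ≤ N) (i : ℕ) :
    koszulCoaction ρ a (koszulDegree N (i + 1)) ≫ (twist ρ).map (koszulMap c hN i) =
      koszulMap c hN i ≫ koszulCoaction ρ a (koszulDegree N i) := by
  have h1 := mono_twist_incl (ρ := ρ) (koszulDegree N i)
  have h2 : koszulMap c hN i ≫ koszulIncl c N (koszulDegree N i) =
      koszulIncl c N (koszulDegree N (i + 1)) ≫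
        ModuleCat.ofHom (koszulDiffHom c N (koszulDegree N (i + 1)) (koszulDegree N i)) := rfl
  have h3 : freeCoactionMap ρ a (koszulDegree N (i + 1)) ≫ (twist ρ).map
      (ModuleCat.ofHom (koszulDiffHom c N (koszulDegree N (i + 1)) (koszulDegree N i))) =
      ModuleCat.ofHom (koszulDiffHom c N (koszulDegree N (i + 1)) (koszulDegree N i)) ≫
        freeCoactionMap ρ a (koszulDegree N i) := by
    apply ModuleCat.hom_ext
    exact freeCoaction_koszulDiff h (koszulDegree_lt_succ hN i).le
  rw [← cancel_mono ((twist ρ).map (koszulIncl c N (koszulDegree N i))), Category.assoc,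
    Category.assoc, koszulCoaction_incl h, ← Functor.map_comp, h2, Functor.map_comp,
    ← Category.assoc, koszulCoaction_incl h, Category.assoc, h3, ← Category.assoc,
    ← Category.assoc, h2]

lemma koszulCoaction_apply (h : ∀ i, ρ (SPAlg.x c N i) = ∑ j, a i j ⊗ₜ[k] SPAlg.x c N j)
    {ℓ : ℕ} {w : (Fin ℓ → Fin n) → k} (hw : constVec c N w ∈ koszulTerm c N ℓ) {g : K}
    (hg : ∀ j, ∑ i, w i • word₂ a i j = w j • g) :
    (koszulCoaction ρ a ℓ).hom ⟨constVec c N w, hw⟩ =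
      TwistModule.tmul ρ (koszulObj c N ℓ) g (⟨constVec c N w, hw⟩ : koszulTerm c N ℓ) := by
  have h1 := (ModuleCat.mono_iff_injective _).mp (mono_twist_incl (ρ := ρ) (c := c) (N := N) ℓ)
  apply h1
  have h2 := LinearMap.congr_fun (congrArg ModuleCat.Hom.hom (koszulCoaction_incl h ℓ))
    ⟨constVec c N w, hw⟩
  refine h2.trans ?_
  refine (freeCoaction_constVec ρ a w).trans ?_
  simp only [hg]
  have h3 : constVec c N w = ∑ j, algebraMap k (SPAlg c N) (w j) •
      (Pi.single j 1 : (Fin ℓ → Fin n) → SPAlg c N) := by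
    ext j
    simp [constVec, Finset.sum_apply, Pi.single_apply, Algebra.smul_def]
  refine Eq.trans ?_ (congrArg (TwistModule.tmul ρ (koszulFree c N ℓ) g) h3.symm)
  refine Eq.trans ?_ (TwistModule.tmul_sum _ _ _).symm
  exact Finset.sum_congr rfl fun j _ => (TwistModule.tmul_algebraMap_smul _ _ _).symm

lemma ModuleCat.algebraMap_smul_hom_add {A : Type u} [Ring A] [Algebra k A] {M M' : ModuleCat.{u} A}
    {f g : M ⟶ M'} {s t : k} (h : s • f + t • g = 0) (y : M) :
    algebraMap k A s • f.hom y + algebraMap k A t • g.hom y = 0 :=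
  LinearMap.congr_fun (congrArg ModuleCat.Hom.hom h) y

lemma TwistModule.tmul_injective {A : Type u} [Ring A] [Algebra k A] {ρ : A →ₐ[k] K ⊗[k] A}
    {M : ModuleCat.{u} A} {y : M} (L : M →+ k)
    (hL : ∀ (r : k) (y : M), L (algebraMap k A r • y) = r * L y) (hy : L y ≠ 0) {g g' : K}
    (h : tmul ρ M g y = tmul ρ M g' y) : g = g' := by
  let L' : M →ₗ[k] k := { L with map_smul' := hL }
  have h1 : (TensorProduct.rid k K ∘ L'.lTensor K) (g ⊗ₜ[k] y) =
    (TensorProduct.rid k K ∘ L'.lTensor K) (g' ⊗ₜ[k] y) := congrArg _ h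
  simp only [Function.comp_apply, LinearMap.lTensor_tmul, TensorProduct.rid_tmul] at h1
  exact smul_right_injective K hy h1

variable [NeZero N]

/-- The coaction preserves the span of the generators, so `K ⊗ k` is again killed by them; this
gives minimality with respect to `K ⊗ k`. -/
lemma x_smul_twist_trivialModule (h : ∀ i, ρ (SPAlg.x c N i) = ∑ j, a i j ⊗ₜ[k] SPAlg.x c N j)
    (i : Fin n) (y : TwistModule ρ (trivialModule (SPAlg.aug c N))) :
    SPAlg.x c N i • y = 0 := by
  induction y using TwistModule.induction with
  | h0 => exact smul_zero _
  | ht r y =>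
    rw [TwistModule.smul_tmul_of_eq_sum (h i)]
    refine Finset.sum_eq_zero fun j _ => ?_
    rw [SPAlg.x_smul_trivialModule, TwistModule.tmul_zero]
  | ha y z hy hz => rw [smul_add, hy, hz, add_zero]

lemma smul_one_tmul (h : ∀ i, ρ (SPAlg.x c N i) = ∑ j, a i j ⊗ₜ[k] SPAlg.x c N j)
    (b : SPAlg c N) (y : trivialModule (SPAlg.aug c N)) :
    b • TwistModule.tmul ρ (trivialModule (SPAlg.aug c N)) 1 y =
      TwistModule.tmul ρ (trivialModule (SPAlg.aug c N)) 1 (b • y) := by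
  obtain ⟨r, hr⟩ := SPAlg.exists_eq_aug_add b
  generalize SPAlg.aug c N b = s at hr
  subst hr
  simp only [add_smul, Finset.sum_smul, mul_smul, x_smul_twist_trivialModule h, smul_zero,
    SPAlg.x_smul_trivialModule, Finset.sum_const_zero, add_zero]
  rw [TwistModule.algebraMap_smul_tmul, TwistModule.tmul_algebraMap_smul]

/-- The map `k → K ⊗ k`, `y ↦ 1 ⊗ y`. -/
noncomputable def unitMap (h : ∀ i, ρ (SPAlg.x c N i) = ∑ j, a i j ⊗ₜ[k] SPAlg.x c N j) :
    trivialModule (SPAlg.aug c N) ⟶ (twist ρ).obj (trivialModule (SPAlg.aug c N)) :=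
  ConcreteCategory.ofHom (C := ModuleCat (SPAlg c N)) (X := trivialModule (SPAlg.aug c N))
    (Y := (twist ρ).obj (trivialModule (SPAlg.aug c N)))
    { toFun := TwistModule.tmul ρ (trivialModule (SPAlg.aug c N)) 1
      map_add' := TwistModule.tmul_add 1
      map_smul' := fun b y => (smul_one_tmul h b y).symm }

lemma koszulAug_unitMap (h : ∀ i, ρ (SPAlg.x c N i) = ∑ j, a i j ⊗ₜ[k] SPAlg.x c N j) :
    ∀ ℓ : ℕ, ℓ = 0 → koszulAug c N ℓ ≫ unitMap h =
      koszulCoaction ρ a ℓ ≫ (twist ρ).map (koszulAug c N ℓ) := by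
  rintro _ rfl
  let ε : koszulFree c N 0 ⟶ trivialModule (SPAlg.aug c N) :=
    ConcreteCategory.ofHom (C := ModuleCat (SPAlg c N)) (X := koszulFree c N 0)
      (Y := trivialModule (SPAlg.aug c N)) (augFunctional (sumFunctional k 0 n))
  have h1 : koszulAug c N 0 = koszulIncl c N 0 ≫ ε := rfl
  have h2 : freeCoactionMap ρ a 0 ≫ (twist ρ).map ε = ε ≫ unitMap h := by
    apply ModuleCat.hom_ext
    refine (Pi.basisFun (SPAlg c N) (Fin 0 → Fin n)).ext fun i => ?_
    rw [Pi.basisFun_apply]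
    refine (congrArg (twistMap ρ ε) (freeCoaction_single ρ a i)).trans ?_
    rw [map_sum, Fintype.sum_unique, TwistModule.map_tmul, Subsingleton.elim i default]
    simp only [word₂, List.ofFn_zero, List.prod_nil]
    rfl
  rw [h1, Functor.map_comp, ← Category.assoc (koszulCoaction ρ a 0), koszulCoaction_incl h,
    Category.assoc, Category.assoc, h2]

lemma tmul_trivialModule_injective {g g' : K} {y : trivialModule (SPAlg.aug c N)}
    (hy : (id y : k) ≠ 0)
    (h : TwistModule.tmul ρ (trivialModule (SPAlg.aug c N)) g y =
      TwistModule.tmul ρ (trivialModule (SPAlg.aug c N)) g' y) : g = g' :=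
  TwistModule.tmul_injective
    { toFun := fun y => (id y : k)
      map_add' := fun _ _ => rfl
      map_zero' := rfl }
    (fun r y => by
      rw [trivialModule_smul, AlgHom.commutes]
      rfl) hy h

/-- A functional on `Z^{⊗ℓ}` as a morphism on the Koszul complex. -/
noncomputable def functionalMap (c : (Fin m → Fin n) → k) (N : ℕ) [NeZero N] {ℓ : ℕ}
    (α : ((Fin ℓ → Fin n) → k) →ₗ[k] k) : koszulObj c N ℓ ⟶ trivialModule (SPAlg.aug c N) :=
  ConcreteCategory.ofHom (C := ModuleCat (SPAlg c N)) (X := koszulObj c N ℓ)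
    (Y := trivialModule (SPAlg.aug c N)) ((augFunctional α).comp (koszulTerm c N ℓ).subtype)

lemma functionalMap_constVec {ℓ : ℕ} (α : ((Fin ℓ → Fin n) → k) →ₗ[k] k)
    (w : (Fin ℓ → Fin n) → k) (hw : constVec c N w ∈ koszulTerm c N ℓ) :
    (id ((functionalMap c N α).hom ⟨constVec c N w, hw⟩) : k) = α w :=
  augFunctional_constVec α w

/-- For an `N`-Koszul algebra whose top Koszul space `W_m` is spanned by `c`, the coaction on
`Ext^d(k, k)` is trivial if and only if the codeterminant is `1`. -/
theorem actsTriviallyOnExt_iff (hN : 2 ≤ N) (hK : IsNKoszul c N) (hc : c ∈ koszulSpace c N m)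
    (hW : koszulSpace c N m ≤ Submodule.span k {c}) {j₀ : Fin m → Fin n} (hj : c j₀ ≠ 0)
    {d : ℕ} (hm : m = koszulDegree N d) (hd : d ≠ 0)
    (h : ∀ i, ρ (SPAlg.x c N i) = ∑ j, a i j ⊗ₜ[k] SPAlg.x c N j) :
    ActsTriviallyOnExt ρ (SPAlg.aug c N) d ↔ codet c j₀ a = 1 := by
  obtain ⟨i, rfl⟩ : ∃ i, d = i + 1 := ⟨d - 1, by lia⟩
  subst hm
  have hg := (SPAlg.isCompatible_of_hom ρ h).sum_eq_smul_codet hc hW hj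
  have hepi := koszulAug_epi (c := c) (N := N)
  have key := forall_ext_comp_eq_iff_of_augmentation
    (P := fun i => koszulSeq c N i) (d := koszulMap c hN)
    (koszulAug c N (koszulDegree N 0)) (koszulMap_aug hN) (koszulMap_comp c hN)
    (koszulMap_exact hN hK) (koszulMap_aug_exact hN) (twist ρ)
    (fun i => koszulCoaction ρ a (koszulDegree N i)) (koszulCoaction_koszulMap h hN)
    (unitMap h) (koszulAug_unitMap h (koszulDegree N 0) (show koszulDegree N 0 = 0 by simp [koszulDegree])) i
    (fun g => koszulMap_comp_eq_zero hN (x_smul_twist_trivialModule h) i g)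
  have h1 : ActsTriviallyOnExt ρ (SPAlg.aug c N) (i + 1) ↔
      ∀ y : Ext.{u} (trivialModule (SPAlg.aug c N)) (trivialModule (SPAlg.aug c N)) (i + 1),
        (Ext.mk₀ (unitMap h)).comp (y.mapExactFunctor (twist ρ)) (zero_add (i + 1)) =
          y.comp (Ext.mk₀ (unitMap h)) (add_zero (i + 1)) := by
    constructor
    · rintro ⟨ι, hι, hy⟩
      have : ι = unitMap h := by
        apply ModuleCat.hom_ext
        apply LinearMap.ext
        exact hι
      rwa [this] at hy
    · exact fun hy => ⟨unitMap h, fun _ => rfl, hy⟩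
  rw [h1, key]
  have hcm : constVec c N c ∈ koszulTerm c N (koszulDegree N (i + 1)) := constVec_mem hc
  constructor
  · intro hh
    -- Any functional nonzero on `c` would do. By minimality it is a cocycle, and evaluating both
    -- sides at `c` compares `codet` with `1`.
    let α : ((Fin (koszulDegree N (i + 1)) → Fin n) → k) →ₗ[k] k := LinearMap.proj j₀
    have h2 := LinearMap.congr_fun (congrArg ModuleCat.Hom.hom (hh (functionalMap c N α)
      (koszulMap_comp_eq_zero hN SPAlg.x_smul_trivialModule (i + 1) _))) ⟨constVec c N c, hcm⟩
    have h3 : ((twist ρ).map (functionalMap c N α)).hom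
        ((koszulCoaction ρ a (koszulDegree N (i + 1))).hom ⟨constVec c N c, hcm⟩) =
      TwistModule.tmul ρ (trivialModule (SPAlg.aug c N)) (codet c j₀ a)
        ((functionalMap c N α).hom ⟨constVec c N c, hcm⟩) :=
      congrArg _ (koszulCoaction_apply h hcm hg)
    refine tmul_trivialModule_injective (ρ := ρ) ?_ (h3.symm.trans h2)
    rw [functionalMap_constVec]
    exact hj
  · intro hg1 f _
    apply ModuleCat.hom_ext
    refine koszulTerm_induction fun w hw' hw => ?_
    -- Since `c` spans `W_m`, it generates `A ⊗ W_m`, and it suffices to compare the two maps at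
    -- `c`.
    obtain ⟨s, rfl⟩ := Submodule.mem_span_singleton.mp (hW hw)
    have h2 : (⟨constVec c N (s • c), hw'⟩ : koszulTerm c N (koszulDegree N (i + 1))) =
        algebraMap k (SPAlg c N) s • ⟨constVec c N c, hcm⟩ := by
      apply Subtype.ext
      ext j
      simp [constVec, Algebra.smul_def]
    rw [h2, map_smul, map_smul]
    congr 1
    have h3 : ((twist ρ).map f).hom
        ((koszulCoaction ρ a (koszulDegree N (i + 1))).hom ⟨constVec c N c, hcm⟩) =
      TwistModule.tmul ρ (trivialModule (SPAlg.aug c N)) (codet c j₀ a)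
        (f.hom ⟨constVec c N c, hcm⟩) :=
      congrArg _ (koszulCoaction_apply h hcm hg)
    rw [hg1] at h3
    exact h3

/-- For an `N`-Koszul Artin–Schelter regular algebra the top Koszul space is spanned by `c`. -/
theorem koszulSpace_le_span (hN : 2 ≤ N) (hK : IsNKoszul c N) (hc : c ∈ koszulSpace c N m)
    {j₀ : Fin m → Fin n} (hj : c j₀ ≠ 0) {d : ℕ} (hm : m = koszulDegree N d) (hd : d ≠ 0)
    (hAS : IsLeftASRegular (SPAlg.aug c N) d) : koszulSpace c N m ≤ Submodule.span k {c} := by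
  obtain ⟨i, rfl⟩ : ∃ i, d = i + 1 := ⟨d - 1, by lia⟩
  subst hm
  intro w hw
  by_contra hwc
  -- A functional `β` killing `c` but not `w`, together with the coordinate `α` at `j₀`, gives two
  -- cocycles. The relation `s α + t β = 0` on `W_m` forces `s = 0` at `c` and then `t = 0` at `w`.
  obtain ⟨β, hβ, hβc⟩ := Submodule.exists_le_ker_of_notMem hwc
  have hβc : β c = 0 := hβc (Submodule.mem_span_singleton_self c)
  have hpd : HasProjectiveDimensionLT (trivialModule (SPAlg.aug c N)) (i + 1 + 1) := by
    have h1 : projectiveDimension (trivialModule (SPAlg.aug c N)) ≤ ((i + 1 : ℕ) : WithBot ℕ∞) := by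
      rw [← hAS.globalDimension]
      exact le_iSup (fun M : ModuleCat.{u} (SPAlg c N) => projectiveDimension M) _
    exact (projectiveDimension_le_iff _ _).mp h1
  have hepi := koszulAug_epi (c := c) (N := N)
  let g : (ModuleCat.of (SPAlg c N) (SPAlg c N) : ModuleCat.{u} (SPAlg c N)) ⟶
      trivialModule (SPAlg.aug c N) :=
    ConcreteCategory.ofHom (C := ModuleCat (SPAlg c N))
      (X := ModuleCat.of (SPAlg c N) (SPAlg c N)) (Y := trivialModule (SPAlg.aug c N))
      (LinearMap.toSpanSingleton (SPAlg c N) (trivialModule (SPAlg.aug c N)) (1 : k))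
  have hg : Epi g := by
    rw [ModuleCat.epi_iff_surjective]
    intro y
    obtain ⟨r, rfl⟩ : ∃ r : k, r = y := ⟨y, rfl⟩
    refine ⟨algebraMap k (SPAlg c N) r, ?_⟩
    have h1 : SPAlg.aug c N (algebraMap k (SPAlg c N) r) * 1 = r := by
      rw [AlgHom.commutes, mul_one]; rfl
    exact h1
  let α : ((Fin (koszulDegree N (i + 1)) → Fin n) → k) →ₗ[k] k := LinearMap.proj j₀
  obtain ⟨s, t, hst, h0⟩ := exists_linear_relation_hom_of_augmentation (k := k)
    (P := fun i => koszulSeq c N i) (d := koszulMap c hN)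
    (koszulAug c N (koszulDegree N 0)) (koszulMap_aug hN) (koszulMap_comp c hN)
    (koszulMap_exact hN hK) (koszulMap_aug_exact hN) g i
    (fun g => koszulMap_comp_eq_zero hN SPAlg.x_smul_trivialModule i g)
    hAS.ext_top (functionalMap c N α) (functionalMap c N β)
    (koszulMap_comp_eq_zero hN SPAlg.x_smul_trivialModule (i + 1) _)
    (koszulMap_comp_eq_zero hN SPAlg.x_smul_trivialModule (i + 1) _)
  have h1 : ∀ w ∈ koszulSpace c N (koszulDegree N (i + 1)), s * α w + t * β w = 0 := by
    intro w hw
    have h2 := ModuleCat.algebraMap_smul_hom_add h0 ⟨constVec c N w, constVec_mem hw⟩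
    rw [trivialModule_smul, trivialModule_smul, AlgHom.commutes, AlgHom.commutes] at h2
    rw [← functionalMap_constVec (c := c) (N := N) α w (constVec_mem hw),
      ← functionalMap_constVec (c := c) (N := N) β w (constVec_mem hw)]
    exact h2
  have h2 := h1 c hc
  rw [hβc, mul_zero, add_zero] at h2
  have hs : s = 0 := (mul_eq_zero.mp h2).resolve_right hj
  have h3 := h1 w hw
  rw [hs, zero_mul, zero_add] at h3
  have ht : t = 0 := (mul_eq_zero.mp h3).resolve_right hβ
  simp [hs, ht] at hst

end Codet

/-! ## Inverses of the generating matrix -/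

/-! ### Words in a matrix against reversed words in its inverse -/

section ReversedWords

/-- The reversed product `s_{i_N j_N} ⋯ s_{i₁ j₁}`. -/
def revWord₂ {B : Type*} [Monoid B] {X : Type*} {N : ℕ} (s : X → X → B) (i j : Fin N → X) : B :=
  (word₂ (fun p q => MulOpposite.op (s p q)) i j).unop

lemma revWord₂_cat {B : Type*} [Monoid B] {X : Type*} {a b ℓ : ℕ} (h : a + b = ℓ)
    (z : X → X → B) (s s' : Fin a → X) (w w' : Fin b → X) :
    revWord₂ z (cat h s w) (cat h s' w') = revWord₂ z w w' * revWord₂ z s s' := by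
  rw [revWord₂, word₂_cat, MulOpposite.unop_mul]
  rfl

lemma word₂_one {B : Type*} [Monoid B] {X : Type*} (s : X → X → B) (i j : Fin 1 → X) :
    word₂ s i j = s (i 0) (j 0) := by simp [word₂]

lemma revWord₂_one {B : Type*} [Monoid B] {X : Type*} (s : X → X → B) (i j : Fin 1 → X) :
    revWord₂ s i j = s (i 0) (j 0) := by simp [revWord₂, word₂]

lemma sum_fin_one {X M : Type*} [Fintype X] [AddCommMonoid M] (F : (Fin 1 → X) → M) :
    ∑ i, F i = ∑ x, F fun _ => x := by
  rw [← (Equiv.funUnique (Fin 1) X).symm.sum_comp]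
  rfl

variable {R X : Type*} [Fintype X] [DecidableEq X] [Ring R] {a s : X → X → R}

/-- The product telescopes from the middle: the adjacent letters of the word and the reversed word
sum to a scalar, which moves out. -/
lemma sum_word₂_mul_revWord₂ (h : ∀ i j, ∑ p, a i p * s p j = if i = j then 1 else 0) {N : ℕ}
    (i k : Fin N → X) : ∑ j, word₂ a i j * revWord₂ s j k = if i = k then 1 else 0 := by
  induction N with
  | zero =>
    rw [Fintype.sum_unique, if_pos (Subsingleton.elim _ _)]
    simp [word₂, revWord₂]
  | succ N ih =>
    obtain ⟨i, x, rfl⟩ := exists_cat rfl i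
    obtain ⟨k, y, rfl⟩ := exists_cat rfl k
    simp only [sum_cat (rfl : N + 1 = N + 1), word₂_cat, revWord₂_cat, cat_inj]
    have h1 : ∀ j : Fin N → X, ∑ w : Fin 1 → X,
        word₂ a i j * word₂ a x w * (revWord₂ s w y * revWord₂ s j k) =
        (if x = y then 1 else 0) * (word₂ a i j * revWord₂ s j k) := fun j => by
      have h2 : ∑ w : Fin 1 → X, word₂ a x w * revWord₂ s w y = if x = y then 1 else 0 := by
        rw [sum_fin_one]
        simp only [word₂_one, revWord₂_one, h, funext_iff, Fin.forall_fin_one, Fin.isValue]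
      have h3 : ∀ w : Fin 1 → X, word₂ a i j * word₂ a x w * (revWord₂ s w y * revWord₂ s j k) =
        word₂ a i j * ((word₂ a x w * revWord₂ s w y) * revWord₂ s j k) := fun w => by
          simp only [mul_assoc]
      rw [Finset.sum_congr rfl fun w _ => h3 w, ← Finset.mul_sum, ← Finset.sum_mul, h2]
      split_ifs <;> simp
    rw [Finset.sum_congr rfl fun j _ => h1 j, ← Finset.mul_sum, ih, ite_and]
    split_ifs <;> simp

lemma sum_revWord₂_mul_word₂ (h : ∀ i j, ∑ p, s i p * a p j = if i = j then 1 else 0) {N : ℕ}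
    (i k : Fin N → X) : ∑ j, revWord₂ s i j * word₂ a j k = if i = k then 1 else 0 := by
  induction N with
  | zero =>
    rw [Fintype.sum_unique, if_pos (Subsingleton.elim _ _)]
    simp [word₂, revWord₂]
  | succ N ih =>
    obtain ⟨x, i, rfl⟩ := exists_cat (Nat.add_comm 1 N) i
    obtain ⟨y, k, rfl⟩ := exists_cat (Nat.add_comm 1 N) k
    simp only [sum_cat (Nat.add_comm 1 N), word₂_cat, revWord₂_cat, cat_inj]
    rw [Finset.sum_comm]
    have h1 : ∀ j : Fin N → X, ∑ w : Fin 1 → X,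
        revWord₂ s i j * revWord₂ s x w * (word₂ a w y * word₂ a j k) =
        (if x = y then 1 else 0) * (revWord₂ s i j * word₂ a j k) := fun j => by
      have h2 : ∑ w : Fin 1 → X, revWord₂ s x w * word₂ a w y = if x = y then 1 else 0 := by
        rw [sum_fin_one]
        simp only [word₂_one, revWord₂_one, h, funext_iff, Fin.forall_fin_one, Fin.isValue]
      have h3 : ∀ w : Fin 1 → X, revWord₂ s i j * revWord₂ s x w * (word₂ a w y * word₂ a j k) =
        revWord₂ s i j * ((revWord₂ s x w * word₂ a w y) * word₂ a j k) := fun w => by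
          simp only [mul_assoc]
      rw [Finset.sum_congr rfl fun w _ => h3 w, ← Finset.mul_sum, ← Finset.sum_mul, h2]
      split_ifs <;> simp
    rw [Finset.sum_congr rfl fun j _ => h1 j, ← Finset.mul_sum, ih, ite_and]
    split_ifs <;> simp

end ReversedWords

/-! ### The inverse matrix and its compatibility with the relations -/

section Inverse

variable {k : Type u} [Field k] {n m : ℕ} {e f : (Fin m → Fin n) → k} {N : ℕ}

/-- The properties of the coefficients of a preregular form that are used below, together with
`W_m = k c`. -/
structure IsSpanningPotential (c : (Fin m → Fin n) → k) (N : ℕ) : Prop where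
  le : N ≤ m
  mem : c ∈ koszulSpace c N m
  le_span : koszulSpace c N m ≤ Submodule.span k {c}
  exists_first_inverse : ∀ {r : ℕ} (h : 1 + r = m), ∃ t : (Fin r → Fin n) → Fin n → k, ∀ a l,
    ∑ w, c (cat h (fun _ => a) w) * t w l = if a = l then 1 else 0
  exists_last_inverse : ∀ {r : ℕ} (h : r + 1 = m), ∃ t : (Fin r → Fin n) → Fin n → k, ∀ a l,
    ∑ w, c (cat h w (fun _ => a)) * t w l = if a = l then 1 else 0
  smul_sum : ∀ {r : ℕ} (hN : N + r = m) {B : Type u} [AddCommGroup B] [Module k B]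
    {w : (Fin N → Fin n) → B}, (∀ κ : Fin r → Fin n, ∑ j, c (cat hN j κ) • w j = 0) →
    ∀ r ∈ relSpace c N, ∑ j, r j • w j = 0

variable {K : Type u} [Ring K] [Algebra k K] {a : Fin n → Fin n → K}

lemma IsSpanningPotential.sum_eq (hc : IsSpanningPotential e N) (ha : IsCompatible e N a)
    {j₀ : Fin m → Fin n} (hj : e j₀ ≠ 0) (j : Fin m → Fin n) :
    ∑ i, e i • word₂ a i j = e j • codet e j₀ a :=
  ha.sum_eq_smul_codet hc.mem hc.le_span hj j

lemma IsSpanningPotential.sum_cat_mul_eq_zero (hf : IsSpanningPotential f N) {r : ℕ}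
    (hr : N + r = m) {ν : (Fin N → Fin n) → k} (hν : IsAnnihilating f ν) (s : Fin r → Fin n) :
    ∑ i, f (cat hr i s) * ν i = 0 := by
  have h := OM.annihilates_relSpace.mp hν
  by_cases hn : Nonempty (Fin n)
  · have h1 := h _ (hf.mem 0 (by lia) (cat hr (fun _ => hn.some) s))
    simpa only [splice_zero_eq_cat] using h1
  · rw [not_nonempty_iff] at hn
    by_cases hN : N = 0
    · subst hN
      have h1 := h _ (hf.mem 0 (by lia) (cat hr (fun i => i.elim0) s))
      simpa only [splice_zero_eq_cat] using h1
    · have : IsEmpty (Fin N → Fin n) := ⟨fun g => hn.elim (g ⟨0, by lia⟩)⟩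
      simp

/-- A cofactor formula: splitting off the last letter in the identity defining `codet` exhibits `a`
as a right factor, and nondegeneracy in the last argument solves for the matrix. -/
lemma exists_left_inverse (he : IsSpanningPotential e N) (hm : m ≠ 0) {j₀ : Fin m → Fin n}
    (hj : e j₀ ≠ 0) (ha : IsCompatible e N a) (hg : IsUnit (codet e j₀ a)) :
    ∃ s : Fin n → Fin n → K, ∀ i j, ∑ p, s i p * a p j = if i = j then 1 else 0 := by
  obtain ⟨r, hr⟩ : ∃ r, r + 1 = m := ⟨m - 1, by lia⟩
  obtain ⟨t, ht⟩ := he.exists_last_inverse hr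
  obtain ⟨u, hu⟩ := hg.exists_left_inv
  refine ⟨fun l p => u * ∑ y, t y l • ∑ x : Fin r → Fin n,
    e (cat hr x fun _ => p) • word₂ a x y, fun l q => ?_⟩
  have h1 : ∀ y : Fin r → Fin n, ∑ p, (∑ x : Fin r → Fin n,
      e (cat hr x fun _ => p) • word₂ a x y) * a p q = e (cat hr y fun _ => q) • codet e j₀ a := by
    intro y
    rw [← he.sum_eq ha hj, sum_cat hr]
    simp only [sum_fin_one, word₂_cat, word₂_one, Finset.sum_mul, smul_mul_assoc]
    exact Finset.sum_comm
  calc ∑ p, (u * ∑ y, t y l • ∑ x : Fin r → Fin n, e (cat hr x fun _ => p) • word₂ a x y) * a p q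
      = u * ∑ y, t y l • ∑ p, (∑ x : Fin r → Fin n,
          e (cat hr x fun _ => p) • word₂ a x y) * a p q := by
        simp only [mul_assoc, ← Finset.mul_sum, Finset.smul_sum, Finset.sum_mul]
        rw [Finset.sum_comm]
        simp only [smul_mul_assoc]
    _ = u * ((∑ y, e (cat hr y fun _ => q) * t y l) • codet e j₀ a) := by
        simp only [h1, smul_smul, Finset.sum_smul, mul_comm]
    _ = if l = q then 1 else 0 := by
        rw [ht, mul_smul_comm, hu, ite_smul, one_smul, zero_smul]
        simp only [eq_comm]

/-- For the transposed matrix, splitting off the first letter exhibits `a` as a left factor, so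
nondegeneracy in the first argument gives an inverse on the other side. -/
lemma exists_right_inverse (hf : IsSpanningPotential f N) (hm : m ≠ 0) {j₀ : Fin m → Fin n}
    (hj : f j₀ ≠ 0) (ha : IsCompatible f N fun p q => a q p)
    (hg : IsUnit (codet f j₀ fun p q => a q p)) :
    ∃ s : Fin n → Fin n → K, ∀ i j, ∑ p, a i p * s p j = if i = j then 1 else 0 := by
  obtain ⟨r, hr⟩ : ∃ r, 1 + r = m := ⟨m - 1, by lia⟩
  obtain ⟨t, ht⟩ := hf.exists_first_inverse hr
  obtain ⟨u, hu⟩ := hg.exists_right_inv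
  refine ⟨fun p l => (∑ y, t y l • ∑ x : Fin r → Fin n,
    f (cat hr (fun _ => p) x) • word₂ (fun p q => a q p) x y) * u, fun q l => ?_⟩
  have h1 : ∀ y : Fin r → Fin n, ∑ p, a q p * (∑ x : Fin r → Fin n,
      f (cat hr (fun _ => p) x) • word₂ (fun p q => a q p) x y) =
      f (cat hr (fun _ => q) y) • codet f j₀ fun p q => a q p := by
    intro y
    rw [← hf.sum_eq ha hj, sum_cat hr]
    simp only [sum_fin_one, word₂_cat, word₂_one, Finset.mul_sum, mul_smul_comm]
  calc ∑ p, a q p * ((∑ y, t y l • ∑ x : Fin r → Fin n,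
        f (cat hr (fun _ => p) x) • word₂ (fun p q => a q p) x y) * u)
      = (∑ y, t y l • ∑ p, a q p * (∑ x : Fin r → Fin n,
          f (cat hr (fun _ => p) x) • word₂ (fun p q => a q p) x y)) * u := by
        simp only [← mul_assoc, ← Finset.sum_mul, Finset.smul_sum, Finset.mul_sum]
        rw [Finset.sum_comm]
        simp only [mul_smul_comm]
    _ = ((∑ y, f (cat hr (fun _ => q) y) * t y l) • codet f j₀ fun p q => a q p) * u := by
        simp only [h1, smul_smul, Finset.sum_smul, mul_comm]
    _ = if q = l then 1 else 0 := by
        rw [ht, smul_mul_assoc, hu, ite_smul, one_smul, zero_smul]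

lemma exists_inverse (he : IsSpanningPotential e N) (hf : IsSpanningPotential f N) (hm : m ≠ 0)
    {j₀ j₁ : Fin m → Fin n} (hj : e j₀ ≠ 0) (hj' : f j₁ ≠ 0) (ha : IsCompatible e N a)
    (ha' : IsCompatible f N fun p q => a q p) (hg : IsUnit (codet e j₀ a))
    (hg' : IsUnit (codet f j₁ fun p q => a q p)) :
    ∃ s : Fin n → Fin n → K, (∀ i j, ∑ p, s i p * a p j = if i = j then 1 else 0) ∧
      ∀ i j, ∑ p, a i p * s p j = if i = j then 1 else 0 := by
  obtain ⟨s, hs⟩ := exists_left_inverse he hm hj ha hg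
  obtain ⟨s', hs'⟩ := exists_right_inverse hf hm hj' ha' hg'
  have h : (Matrix.of s : Matrix (Fin n) (Fin n) K) = Matrix.of s' :=
    left_inv_eq_right_inv (a := Matrix.of a)
      (by ext i j; simp [Matrix.mul_apply, hs, Matrix.one_apply])
      (by ext i j; simp [Matrix.mul_apply, hs', Matrix.one_apply])
  have h' : s = s' := h
  exact ⟨s, hs, h' ▸ hs'⟩

variable {s : Fin n → Fin n → K}

/-- The inverse matrix satisfies the relations of `A(e, N)` in the opposite algebra. -/
lemma IsSpanningPotential.isCompatible_inverse (he : IsSpanningPotential e N)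
    {j₀ : Fin m → Fin n} (hj : e j₀ ≠ 0) (ha : IsCompatible e N a) (hg : IsUnit (codet e j₀ a))
    (hs : ∀ i j, ∑ p, a i p * s p j = if i = j then 1 else 0) :
    IsCompatible e N fun p q => MulOpposite.op (s p q) := by
  intro t μ hμ
  -- Multiplying the identity for `codet` on the right by reversed words in `s` cancels the last `N`
  -- letters.
  have h1 : ∀ κ : Fin N → Fin n, ∑ x : Fin (m - N) → Fin n, e (glue x κ) • word₂ a x t =
      codet e j₀ a * ∑ j, e (glue t j) • revWord₂ s j κ := by
    intro κ
    have h2 : ∀ j : Fin N → Fin n, ∑ x : Fin (m - N) → Fin n, ∑ r : Fin N → Fin n,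
        e (glue x r) • (word₂ a x t * word₂ a r j) = e (glue t j) • codet e j₀ a := by
      intro j
      rw [← he.sum_eq ha hj, sum_cat (Nat.sub_add_cancel he.le)]
      simp only [glue_eq_cat he.le, word₂_cat]
    calc ∑ x : Fin (m - N) → Fin n, e (glue x κ) • word₂ a x t
        = ∑ x : Fin (m - N) → Fin n, ∑ r : Fin N → Fin n, e (glue x r) •
            (word₂ a x t * ∑ j, word₂ a r j * revWord₂ s j κ) := by
          simp [sum_word₂_mul_revWord₂ hs]
      _ = ∑ j, (∑ x : Fin (m - N) → Fin n, ∑ r : Fin N → Fin n,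
            e (glue x r) • (word₂ a x t * word₂ a r j)) * revWord₂ s j κ := by
          simp only [Finset.mul_sum, Finset.smul_sum, Finset.sum_mul, smul_mul_assoc, mul_assoc]
          conv_rhs => rw [Finset.sum_comm]
          exact Finset.sum_congr rfl fun x _ => Finset.sum_comm
      _ = _ := by
          simp only [h2, Finset.mul_sum, smul_mul_assoc, mul_smul_comm]
  -- Contracted with `μ`, the side free of `s` vanishes because `μ` annihilates the relations; the
  -- unit `codet` is then cancelled.
  have h3 : codet e j₀ a * ∑ κ, μ κ • ∑ j, e (glue t j) • revWord₂ s j κ = 0 := by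
    rw [Finset.mul_sum, Finset.sum_congr rfl fun κ _ => (mul_smul_comm (μ κ) _ _).trans
      (congrArg _ (h1 κ).symm)]
    simp only [Finset.smul_sum, smul_smul]
    rw [Finset.sum_comm]
    refine Finset.sum_eq_zero fun x _ => ?_
    rw [← Finset.sum_smul]
    simp only [mul_comm (μ _)]
    rw [hμ x, zero_smul]
  have h4 := hg.mul_right_eq_zero.mp h3
  apply MulOpposite.unop_injective
  rw [MulOpposite.unop_zero, ← h4, Finset.sum_comm, Finset.unop_sum]
  refine Finset.sum_congr rfl fun κ _ => ?_
  rw [Finset.unop_sum, Finset.smul_sum]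
  refine Finset.sum_congr rfl fun j _ => ?_
  rw [MulOpposite.unop_smul, smul_smul, mul_comm]
  rfl

/-- The inverse matrix satisfies the relations of `A(f, N)` in the opposite algebra. -/
lemma IsSpanningPotential.isCompatible_inverse_transpose (hf : IsSpanningPotential f N)
    {j₀ : Fin m → Fin n} (hj : f j₀ ≠ 0) (ha : IsCompatible f N fun p q => a q p)
    (hg : IsUnit (codet f j₀ fun p q => a q p))
    (hs : ∀ i j, ∑ p, s i p * a p j = if i = j then 1 else 0) :
    IsCompatible f N fun p q => MulOpposite.op (s q p) := by
  intro lam ν hν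
  have hm := Nat.add_sub_of_le hf.le
  have h1 : ∀ (t : Fin (m - N) → Fin n) (κ : Fin N → Fin n),
      ∑ x : Fin (m - N) → Fin n, f (cat hm κ x) • word₂ a t x =
      (∑ p, f (cat hm p t) • revWord₂ s κ p) * codet f j₀ fun p q => a q p := by
    intro t κ
    have h2 : ∀ p : Fin N → Fin n, ∑ r : Fin N → Fin n, ∑ x : Fin (m - N) → Fin n,
        f (cat hm r x) • (word₂ a p r * word₂ a t x) =
        f (cat hm p t) • codet f j₀ fun p q => a q p := by
      intro p
      rw [← hf.sum_eq ha hj, sum_cat hm]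
      simp only [word₂_cat]
      rfl
    calc ∑ x : Fin (m - N) → Fin n, f (cat hm κ x) • word₂ a t x
        = ∑ r : Fin N → Fin n, ∑ x : Fin (m - N) → Fin n, f (cat hm r x) •
            ((∑ p, revWord₂ s κ p * word₂ a p r) * word₂ a t x) := by
          rw [Finset.sum_comm]
          simp [sum_revWord₂_mul_word₂ hs]
      _ = ∑ p, revWord₂ s κ p * ∑ r : Fin N → Fin n, ∑ x : Fin (m - N) → Fin n,
            f (cat hm r x) • (word₂ a p r * word₂ a t x) := by
          simp only [Finset.mul_sum, Finset.smul_sum, Finset.sum_mul, mul_smul_comm, mul_assoc]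
          conv_rhs => rw [Finset.sum_comm]
          exact Finset.sum_congr rfl fun x _ => Finset.sum_comm
      _ = _ := by
          simp only [h2, Finset.sum_mul, smul_mul_assoc, mul_smul_comm]
  have h3 : ∀ t : Fin (m - N) → Fin n,
      ∑ p, f (cat hm p t) • ∑ κ, ν κ • revWord₂ s κ p = 0 := by
    intro t
    refine hg.mul_left_eq_zero.mp ?_
    have h4 : ∑ p, f (cat hm p t) • ∑ κ, ν κ • revWord₂ s κ p =
        ∑ κ, ν κ • ∑ p, f (cat hm p t) • revWord₂ s κ p := by
      simp only [Finset.smul_sum, smul_smul, mul_comm (ν _)]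
      exact Finset.sum_comm
    rw [h4, Finset.sum_mul, Finset.sum_congr rfl fun κ _ => (smul_mul_assoc (ν κ) _ _).trans
      (congrArg _ (h1 t κ).symm)]
    simp only [Finset.smul_sum, smul_smul]
    rw [Finset.sum_comm]
    refine Finset.sum_eq_zero fun x _ => ?_
    rw [← Finset.sum_smul]
    simp only [mul_comm (ν _)]
    rw [hf.sum_cat_mul_eq_zero hm hν, zero_smul]
  -- Here the first `N` letters were cancelled, so the identity concerns initial windows. By
  -- cyclicity these span the relation space, which is defined by final windows.
  have h5 := hf.smul_sum hm h3 (fun i => f (glue lam i)) (Submodule.subset_span ⟨lam, rfl⟩)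
  apply MulOpposite.unop_injective
  rw [MulOpposite.unop_zero, ← h5, Finset.unop_sum]
  refine Finset.sum_congr rfl fun i _ => ?_
  rw [Finset.unop_sum, Finset.smul_sum]
  refine Finset.sum_congr rfl fun j _ => ?_
  rw [MulOpposite.unop_smul, smul_smul]
  rfl

/-- The codeterminant of the inverse matrix inverts that of `a`, so the candidate antipode sends
`g₁` to a unit, as lifting requires. -/
lemma codet_mul_codet_inverse (he : IsSpanningPotential e N)
    {j₀ : Fin m → Fin n} (hj : e j₀ ≠ 0) (ha : IsCompatible e N a)
    (hs : ∀ i j, ∑ p, a i p * s p j = if i = j then 1 else 0) :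
    codet e j₀ a * (codet e j₀ fun p q => MulOpposite.op (s p q)).unop = 1 := by
  have h1 : (codet e j₀ fun p q => MulOpposite.op (s p q)).unop =
      (e j₀)⁻¹ • ∑ j, e j • revWord₂ s j j₀ := by
    rw [codet, MulOpposite.unop_smul, Finset.unop_sum]
    rfl
  have h2 : ∑ j, (∑ i, e i • word₂ a i j) * revWord₂ s j j₀ = e j₀ • 1 := by
    simp only [Finset.sum_mul, smul_mul_assoc]
    rw [Finset.sum_comm]
    simp [← Finset.smul_sum, sum_word₂_mul_revWord₂ hs]
  simp only [he.sum_eq ha hj, smul_mul_assoc, ← mul_smul_comm, ← Finset.mul_sum] at h2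
  rw [h1, mul_smul_comm, h2, smul_smul, inv_mul_cancel₀ hj, one_smul]

lemma codet_inverse_mul_codet (hf : IsSpanningPotential f N)
    {j₀ : Fin m → Fin n} (hj : f j₀ ≠ 0) (ha : IsCompatible f N fun p q => a q p)
    (hs : ∀ i j, ∑ p, s i p * a p j = if i = j then 1 else 0) :
    (codet f j₀ fun p q => MulOpposite.op (s q p)).unop * (codet f j₀ fun p q => a q p) = 1 := by
  have h1 : (codet f j₀ fun p q => MulOpposite.op (s q p)).unop =
      (f j₀)⁻¹ • ∑ j, f j • revWord₂ s j₀ j := by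
    rw [codet, MulOpposite.unop_smul, Finset.unop_sum]
    rfl
  have h2 : ∑ j, revWord₂ s j₀ j * (∑ i, f i • word₂ (fun p q => a q p) i j) = f j₀ • 1 := by
    simp only [Finset.mul_sum, mul_smul_comm]
    rw [Finset.sum_comm]
    have h3 : ∀ i, ∑ j, revWord₂ s j₀ j * word₂ (fun p q => a q p) i j = if j₀ = i then 1 else 0 :=
      fun i => sum_revWord₂_mul_word₂ hs j₀ i
    simp [← Finset.smul_sum, h3]
  simp only [hf.sum_eq ha hj, mul_smul_comm, ← smul_mul_assoc, ← Finset.sum_mul] at h2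
  rw [h1, smul_mul_assoc, h2, smul_smul, inv_mul_cancel₀ hj, one_smul]

end Inverse

/-! ## Matrix bialgebra elements -/

section GroupLike

variable {k : Type u} [Field k] {n m : ℕ} {e f : (Fin m → Fin n) → k} {N : ℕ}
  {K : Type u} [Ring K]

/-- Coacting twice on the line `k c` multiplies the two coefficients. A general `D` is allowed so
that the flipped comultiplication can be used for the transposed matrix. -/
lemma IsSpanningPotential.algHom_codet [Algebra k K] {a : Fin n → Fin n → K}
    (he : IsSpanningPotential e N) {j₀ : Fin m → Fin n} (hj : e j₀ ≠ 0) (ha : IsCompatible e N a)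
    (D : K →ₐ[k] K ⊗[k] K) (hD : ∀ i j, D (a i j) = ∑ p, a i p ⊗ₜ[k] a p j) :
    D (codet e j₀ a) = codet e j₀ a ⊗ₜ[k] codet e j₀ a := by
  calc D (codet e j₀ a)
      = (e j₀)⁻¹ • ∑ p, (∑ i, e i • word₂ a i p) ⊗ₜ[k] word₂ a p j₀ := by
        rw [map_codet]
        simp only [hD, codet, word₂_comul, Finset.smul_sum, TensorProduct.sum_tmul,
          TensorProduct.smul_tmul']
        exact Finset.sum_comm
    _ = codet e j₀ a ⊗ₜ[k] codet e j₀ a := by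
        simp only [he.sum_eq ha hj, TensorProduct.smul_tmul, ← TensorProduct.tmul_sum,
          ← TensorProduct.tmul_smul]
        rw [inv_smul_smul₀ hj]

lemma algHom_codet_eq_one [Algebra k K] {a : Fin n → Fin n → K} {j₀ : Fin m → Fin n}
    (hj : e j₀ ≠ 0) (E : K →ₐ[k] k) (hE : ∀ i j, E (a i j) = if i = j then 1 else 0) :
    E (codet e j₀ a) = 1 := by
  rw [map_codet]
  simp only [hE, codet, word₂_delta, smul_eq_mul, mul_ite, mul_one, mul_zero,
    Finset.sum_ite_eq', Finset.mem_univ, if_true]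
  exact inv_mul_cancel₀ hj

variable [Bialgebra k K] {a : Fin n → Fin n → K}

/-- The matrix `a` is multiplicative: `Δ(a_{ij}) = ∑_p a_{ip} ⊗ a_{pj}`, `ε(a_{ij}) = δ_{ij}`. -/
structure IsMultiplicativeMatrix (a : Fin n → Fin n → K) : Prop where
  comul : ∀ i j, Bialgebra.comulAlgHom k K (a i j) = ∑ p, a i p ⊗ₜ[k] a p j
  counit : ∀ i j, Bialgebra.counitAlgHom k K (a i j) = if i = j then 1 else 0

lemma IsMultiplicativeMatrix.isGroupLikeElem (h : IsMultiplicativeMatrix (k := k) a)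
    (he : IsSpanningPotential e N) {j₀ : Fin m → Fin n} (hj : e j₀ ≠ 0) (ha : IsCompatible e N a) :
    IsGroupLikeElem k (codet e j₀ a) where
  counit_eq_one := algHom_codet_eq_one hj _ h.counit
  comul_eq_tmul_self := he.algHom_codet hj ha _ h.comul

lemma IsMultiplicativeMatrix.isGroupLikeElem_transpose (h : IsMultiplicativeMatrix (k := k) a)
    (hf : IsSpanningPotential f N) {j₀ : Fin m → Fin n} (hj : f j₀ ≠ 0)
    (ha : IsCompatible f N fun p q => a q p) :
    IsGroupLikeElem k (codet f j₀ fun p q => a q p) where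
  counit_eq_one := algHom_codet_eq_one hj (Bialgebra.counitAlgHom k K) fun i j => by
    simp only [h.counit, eq_comm]
  comul_eq_tmul_self := by
    have h1 := hf.algHom_codet hj ha ((Algebra.TensorProduct.comm k K K).toAlgHom.comp
      (Bialgebra.comulAlgHom k K)) fun i j => by simp [h.comul, -Bialgebra.comulAlgHom_apply]
    exact (Algebra.TensorProduct.comm k K K).injective h1

lemma OM.isMultiplicativeMatrix_z (e f : (Fin m → Fin n) → k) (N : ℕ) :
    IsMultiplicativeMatrix (k := k) (OM.z e f N) where
  comul _ _ := OM.lift_z _ _ _ _ _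
  counit _ _ := OM.lift_z _ _ _ _ _

lemma IsMultiplicativeMatrix.map {L : Type u} [Ring L] [Bialgebra k L]
    (h : IsMultiplicativeMatrix (k := k) a) (φ : K →ₐc[k] L) :
    IsMultiplicativeMatrix (k := k) fun i j => φ (a i j) where
  comul i j := by
    have h1 := h.comul i j
    simp only [Bialgebra.comulAlgHom_apply] at h1 ⊢
    rw [← CoalgHomClass.map_comp_comul_apply, h1]
    simp
  counit i j := by
    have h1 := h.counit i j
    simp only [Bialgebra.counitAlgHom_apply] at h1 ⊢
    rw [CoalgHomClass.counit_comp_apply, h1]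

/-- Algebra maps out of `O(M)` to a bialgebra that send `z` to a multiplicative matrix are
coalgebra maps. -/
lemma OM.map_comul_eq {φ : OM e f N →ₐ[k] K}
    (h : IsMultiplicativeMatrix (k := k) fun i j => φ (OM.z e f N i j)) :
    (Algebra.TensorProduct.map φ φ).comp (Bialgebra.comulAlgHom k _) =
      (Bialgebra.comulAlgHom k K).comp φ := by
  refine OM.hom_ext fun i j => ?_
  rw [AlgHom.comp_apply, AlgHom.comp_apply, h.comul, (OM.isMultiplicativeMatrix_z e f N).comul]
  simp

lemma OM.counit_comp_eq {φ : OM e f N →ₐ[k] K}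
    (h : IsMultiplicativeMatrix (k := k) fun i j => φ (OM.z e f N i j)) :
    (Bialgebra.counitAlgHom k K).comp φ = Bialgebra.counitAlgHom k _ := by
  refine OM.hom_ext fun i j => ?_
  rw [AlgHom.comp_apply, h.counit, (OM.isMultiplicativeMatrix_z e f N).counit]

end GroupLike

/-! ## Coactions given by multiplicative matrices -/

section MatrixCoactions

variable {k : Type u} [Field k] {n m : ℕ} {e f : (Fin m → Fin n) → k} {N : ℕ}
  {K : Type u} [Ring K]

/-- The right coaction `y_j ↦ ∑_i y_i ⊗ a_{ij}`. -/
noncomputable def SPAlg.rightCoaction [Algebra k K] (a : Fin n → Fin n → K)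
    (ha : IsCompatible f N fun p q => a q p) : SPAlg f N →ₐ[k] SPAlg f N ⊗[k] K :=
  (Algebra.TensorProduct.comm k K (SPAlg f N)).toAlgHom.comp (SPAlg.coaction _ ha)

lemma SPAlg.rightCoaction_x [Algebra k K] (a : Fin n → Fin n → K)
    (ha : IsCompatible f N fun p q => a q p) (j : Fin n) :
    SPAlg.rightCoaction a ha (SPAlg.x f N j) = ∑ i, SPAlg.x f N i ⊗ₜ[k] a i j := by
  simp [rightCoaction]

variable [Bialgebra k K] {a : Fin n → Fin n → K}
  {ρl : SPAlg e N →ₐ[k] K ⊗[k] SPAlg e N} {ρr : SPAlg f N →ₐ[k] SPAlg f N ⊗[k] K}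

lemma HasMatrix.coaction (ha : IsCompatible e N a) (ha' : IsCompatible f N fun p q => a q p) :
    HasMatrix (SPAlg.coaction a ha) (SPAlg.rightCoaction a ha') a :=
  ⟨SPAlg.coaction_x a ha, SPAlg.rightCoaction_x a ha'⟩

lemma HasMatrix.isCompatible (h : HasMatrix ρl ρr a) : IsCompatible e N a :=
  SPAlg.isCompatible_of_hom ρl h.1

lemma HasMatrix.comm_x (h : HasMatrix ρl ρr a) (j : Fin n) :
    (Algebra.TensorProduct.comm k (SPAlg f N) K).toAlgHom.comp ρr (SPAlg.x f N j) =
      ∑ i, a i j ⊗ₜ[k] SPAlg.x f N i := by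
  simp [h.2 j]

lemma HasMatrix.isCompatible_transpose (h : HasMatrix ρl ρr a) :
    IsCompatible f N fun p q => a q p :=
  SPAlg.isCompatible_of_hom _ h.comm_x

lemma HasMatrix.isBalancedCoaction (h : HasMatrix ρl ρr a)
    (ha : IsMultiplicativeMatrix (k := k) a) : IsBalancedCoaction ρl ρr where
  left :=
    { coassoc := SPAlg.hom_ext fun i => by
        simp only [AlgHom.comp_apply, h.1, map_sum, Algebra.TensorProduct.map_tmul, ha.comul,
          AlgHom.id_apply, TensorProduct.sum_tmul, TensorProduct.tmul_sum]
        rw [Finset.sum_comm]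
        rfl
      counit := SPAlg.hom_ext fun i => by
        simp only [AlgHom.comp_apply, h.1, map_sum, Algebra.TensorProduct.map_tmul, ha.counit,
          AlgHom.id_apply, TensorProduct.ite_tmul]
        simp }
  right :=
    { coassoc := SPAlg.hom_ext fun i => by
        simp only [AlgHom.comp_apply, h.2, map_sum, Algebra.TensorProduct.map_tmul, ha.comul,
          AlgHom.id_apply, TensorProduct.sum_tmul, TensorProduct.tmul_sum]
        rw [Finset.sum_comm]
        rfl
      counit := SPAlg.hom_ext fun i => by
        simp only [AlgHom.comp_apply, h.2, map_sum, Algebra.TensorProduct.map_tmul, ha.counit,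
          AlgHom.id_apply, TensorProduct.tmul_ite]
        simp }
  balanced := ⟨a, h⟩

/-- Evaluate the comodule axioms on the generators and compare coefficients, using their linear
independence. -/
lemma HasMatrix.isMultiplicativeMatrix (hN : 2 ≤ N) (h : HasMatrix ρl ρr a)
    (hρ : IsLeftCoaction ρl) : IsMultiplicativeMatrix (k := k) a where
  comul i j := by
    have h1 := congrArg (TensorProduct.assoc k K K (SPAlg e N)).symm
      (AlgHom.congr_fun hρ.coassoc (SPAlg.x e N i))
    have h2 : ∑ j, Bialgebra.comulAlgHom k K (a i j) ⊗ₜ[k] SPAlg.x e N j =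
        ∑ j, (∑ p, a i p ⊗ₜ[k] a p j) ⊗ₜ[k] SPAlg.x e N j := by
      simp only [AlgHom.comp_apply, h.1, map_sum, Algebra.TensorProduct.map_tmul,
          AlgHom.id_apply, TensorProduct.tmul_sum] at h1
      simp only [TensorProduct.sum_tmul]
      rw [Finset.sum_comm]
      refine Eq.trans ?_ (h1.trans ?_)
      · refine Finset.sum_congr rfl fun j _ => ?_
        exact ((TensorProduct.assoc k K K (SPAlg e N)).symm_apply_apply _).symm
      · rfl
    exact congrFun (SPAlg.sum_tmul_x_injective hN h2) j
  counit i j := by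
    have h1 := AlgHom.congr_fun hρ.counit (SPAlg.x e N i)
    have h2 : ∑ j, Bialgebra.counitAlgHom k K (a i j) ⊗ₜ[k] SPAlg.x e N j =
        ∑ j, (if i = j then (1 : k) else 0) ⊗ₜ[k] SPAlg.x e N j := by
      simp only [AlgHom.comp_apply, h.1, map_sum, Algebra.TensorProduct.map_tmul,
          AlgHom.id_apply] at h1
      rw [h1]
      simp [TensorProduct.ite_tmul]
    exact congrFun (SPAlg.sum_tmul_x_injective hN h2) j

lemma HasMatrix.intertwines {L : Type u} [Ring L] [Bialgebra k L] {a' : Fin n → Fin n → L}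
    {σl : SPAlg e N →ₐ[k] L ⊗[k] SPAlg e N} {σr : SPAlg f N →ₐ[k] SPAlg f N ⊗[k] L}
    (h : HasMatrix ρl ρr a) (h' : HasMatrix σl σr a') (φ : K →ₐc[k] L)
    (hφ : ∀ i j, φ (a i j) = a' i j) : IntertwinesCoactions φ ρl ρr σl σr := by
  constructor
  · refine SPAlg.hom_ext fun i => ?_
    simp [h.1, h'.1, hφ]
  · refine SPAlg.hom_ext fun i => ?_
    simp [h.2, h'.2, hφ]

lemma IntertwinesCoactions.map_matrix (hN : 2 ≤ N) {L : Type u} [Ring L] [Bialgebra k L]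
    {a' : Fin n → Fin n → L} {σl : SPAlg e N →ₐ[k] L ⊗[k] SPAlg e N}
    {σr : SPAlg f N →ₐ[k] SPAlg f N ⊗[k] L} {φ : K →ₐc[k] L}
    (hφ : IntertwinesCoactions φ ρl ρr σl σr) (h : HasMatrix ρl ρr a) (h' : HasMatrix σl σr a')
    (i j : Fin n) : φ (a i j) = a' i j := by
  have h1 := AlgHom.congr_fun hφ.1 (SPAlg.x e N i)
  rw [h'.1, AlgHom.comp_apply, h.1, map_sum] at h1
  simp only [Algebra.TensorProduct.map_tmul, AlgHom.id_apply] at h1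
  exact congrFun (SPAlg.sum_tmul_x_injective hN h1) j

end MatrixCoactions

/-! ## The antipode axioms on generators -/

section Antipode

variable {k : Type u} [Field k] {L : Type u} [Ring L] [Bialgebra k L] (S : L →ₐ[k] Lᵐᵒᵖ)

/-- The linear map underlying an algebra map `L → Lᵒᵖ`. -/
noncomputable def unopLinearMap {B : Type u} [Ring B] [Algebra k B] (S : B →ₐ[k] Bᵐᵒᵖ) :
    B →ₗ[k] B :=
  (MulOpposite.opLinearEquiv k).symm.toLinearMap ∘ₗ S.toLinearMap

/-- `x ⊗ y ↦ S(x) y`. -/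
noncomputable def antipodeMul : L ⊗[k] L →ₗ[k] L :=
  LinearMap.mul' k L ∘ₗ (unopLinearMap S).rTensor L

/-- `x ⊗ y ↦ x S(y)`. -/
noncomputable def mulAntipode : L ⊗[k] L →ₗ[k] L :=
  LinearMap.mul' k L ∘ₗ (unopLinearMap S).lTensor L

variable {S}

lemma antipodeMul_tmul (x y : L) : antipodeMul S (x ⊗ₜ[k] y) = (S x).unop * y := rfl

lemma mulAntipode_tmul (x y : L) : mulAntipode S (x ⊗ₜ[k] y) = x * (S y).unop := rfl

/-- Since `S` reverses products, the contribution of `X` sits between the two legs of `Y`; being a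
scalar, it can be pulled out. Hence the antipode axioms pass to products. -/
lemma antipodeMul_mul {X : L ⊗[k] L} {r : k} (hX : antipodeMul S X = algebraMap k L r)
    (Y : L ⊗[k] L) : antipodeMul S (X * Y) = algebraMap k L r * antipodeMul S Y := by
  have h1 : ∀ (x y : L) (X : L ⊗[k] L),
      antipodeMul S (X * x ⊗ₜ[k] y) = (S x).unop * antipodeMul S X * y := by
    intro x y X
    induction X with
    | zero => simp
    | tmul c d => simp [antipodeMul_tmul, mul_assoc]
    | add X X' h h' => rw [add_mul, map_add, map_add, h, h', mul_add, add_mul]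
  induction Y with
  | zero => simp
  | tmul c d => rw [h1, hX, antipodeMul_tmul, ← Algebra.commutes, mul_assoc]
  | add Y Y' h h' => rw [mul_add, map_add, map_add, h, h', mul_add]

lemma mulAntipode_mul {Y : L ⊗[k] L} {r : k} (hY : mulAntipode S Y = algebraMap k L r)
    (X : L ⊗[k] L) : mulAntipode S (X * Y) = mulAntipode S X * algebraMap k L r := by
  have h1 : ∀ (x y : L) (Y : L ⊗[k] L),
      mulAntipode S (x ⊗ₜ[k] y * Y) = x * mulAntipode S Y * (S y).unop := by
    intro x y Y
    induction Y with
    | zero => simp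
    | tmul c d => simp [mulAntipode_tmul, mul_assoc]
    | add X X' h h' => rw [mul_add, map_add, map_add, h, h', mul_add, add_mul]
  induction X with
  | zero => simp
  | tmul c d => rw [h1, hY, mulAntipode_tmul, mul_assoc, mul_assoc, Algebra.commutes]
  | add Y Y' h h' => rw [add_mul, map_add, map_add, h, h', add_mul]

variable (S)

/-- The elements for which the antipode axioms hold. -/
noncomputable def antipodeSubalgebra : Subalgebra k L where
  carrier := {x | antipodeMul S (Bialgebra.comulAlgHom k L x) =
      algebraMap k L (Bialgebra.counitAlgHom k L x) ∧
    mulAntipode S (Bialgebra.comulAlgHom k L x) = algebraMap k L (Bialgebra.counitAlgHom k L x)}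
  mul_mem' {x y} hx hy := by
    constructor
    · rw [map_mul, antipodeMul_mul hx.1, hy.1, map_mul, map_mul]
    · rw [map_mul, mulAntipode_mul hy.2, hx.2, map_mul, map_mul]
  add_mem' {x y} hx hy := by
    constructor
    · rw [map_add, map_add, hx.1, hy.1, map_add, map_add]
    · rw [map_add, map_add, hx.2, hy.2, map_add, map_add]
  algebraMap_mem' r := by
    rw [Set.mem_ofPred_eq, AlgHom.commutes, AlgHom.commutes]
    simp only [Algebra.TensorProduct.algebraMap_apply, antipodeMul_tmul, mulAntipode_tmul]
    simp

variable {S}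

lemma mem_antipodeSubalgebra_of_isMultiplicativeMatrix {n : ℕ} {a s : Fin n → Fin n → L}
    (ha : IsMultiplicativeMatrix (k := k) a) (hS : ∀ i j, S (a i j) = MulOpposite.op (s i j))
    (h : ∀ i j, ∑ p, s i p * a p j = if i = j then 1 else 0)
    (h' : ∀ i j, ∑ p, a i p * s p j = if i = j then 1 else 0) (i j : Fin n) :
    a i j ∈ antipodeSubalgebra S := by
  constructor
  · simp only [ha.comul, ha.counit, map_sum, antipodeMul_tmul, hS, MulOpposite.unop_op, h]
    split_ifs <;> simp
  · simp only [ha.comul, ha.counit, map_sum, mulAntipode_tmul, hS, MulOpposite.unop_op, h']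
    split_ifs <;> simp

/-- The axiom at a group-like `x` forces `S(x) = x⁻¹`; hence `S(x⁻¹) = x`, which is the axiom at the
group-like element `x⁻¹`. -/
lemma mem_antipodeSubalgebra_of_mul_eq_one {x y : L} (hx : IsGroupLikeElem k x)
    (hxS : x ∈ antipodeSubalgebra S) (h : x * y = 1) (h' : y * x = 1) :
    y ∈ antipodeSubalgebra S := by
  have hy : IsGroupLikeElem k y := hx.of_mul_eq_one h h'
  have h1 := hxS.1
  rw [Bialgebra.comulAlgHom_apply, Bialgebra.counitAlgHom_apply, hx.comul_eq_tmul_self,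
    hx.counit_eq_one, antipodeMul_tmul, map_one] at h1
  have h2 : (S x).unop = y := left_inv_eq_right_inv h1 h
  have h3 : (S y).unop * y = 1 := by
    rw [← h2, ← MulOpposite.unop_mul, h2, ← map_mul, h, map_one, MulOpposite.unop_one]
  have h4 : y * (S y).unop = 1 := by
    rw [← h2, ← MulOpposite.unop_mul, h2, ← map_mul, h', map_one, MulOpposite.unop_one]
  constructor
  · rw [Bialgebra.comulAlgHom_apply, Bialgebra.counitAlgHom_apply, hy.comul_eq_tmul_self,
      hy.counit_eq_one, antipodeMul_tmul, map_one, h3]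
  · rw [Bialgebra.comulAlgHom_apply, Bialgebra.counitAlgHom_apply, hy.comul_eq_tmul_self,
      hy.counit_eq_one, mulAntipode_tmul, map_one, h4]

/-- A Hopf algebra from an antipode that satisfies the axioms on generators. -/
noncomputable abbrev hopfAlgebraOfAntipodeSubalgebra (h : antipodeSubalgebra S = ⊤) :
    HopfAlgebra k L where
  antipode := unopLinearMap S
  mul_antipode_rTensor_comul := LinearMap.ext fun x =>
    (show x ∈ antipodeSubalgebra S by rw [h]; trivial).1
  mul_antipode_lTensor_comul := LinearMap.ext fun x =>
    (show x ∈ antipodeSubalgebra S by rw [h]; trivial).2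

end Antipode

/-! ## Universal localizations and quotients -/

section UniversalInverting

/-- `b` is a unit, and equal to `1` if `t` holds. -/
def IsSpecialUnit (t : Prop) {B : Type*} [Monoid B] (b : B) : Prop := IsUnit b ∧ (t → b = 1)

section

variable {t : Prop} {B C : Type*} [Monoid B] [Monoid C]

lemma IsSpecialUnit.one : IsSpecialUnit t (1 : B) := ⟨isUnit_one, fun _ => rfl⟩

lemma IsSpecialUnit.map {F : Type*} [FunLike F B C] [MonoidHomClass F B C] {b : B}
    (h : IsSpecialUnit t b) (φ : F) : IsSpecialUnit t (φ b) :=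
  ⟨h.1.map φ, fun ht => by rw [h.2 ht, map_one]⟩

lemma IsSpecialUnit.mul {b b' : B} (h : IsSpecialUnit t b) (h' : IsSpecialUnit t b') :
    IsSpecialUnit t (b * b') :=
  ⟨h.1.mul h'.1, fun ht => by rw [h.2 ht, h'.2 ht, one_mul]⟩

lemma IsSpecialUnit.of_mul_eq_one {b b' : B} (h : IsSpecialUnit t b) (hb : b * b' = 1) :
    IsSpecialUnit t b' := by
  obtain ⟨u, hu⟩ := h.1
  refine ⟨⟨u⁻¹, ?_⟩, fun ht => by rwa [h.2 ht, one_mul] at hb⟩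
  rw [← hu] at hb
  exact (Units.eq_inv_of_mul_eq_one_left hb).symm

lemma IsSpecialUnit.of_mul_eq_one' {b b' : B} (h : IsSpecialUnit t b) (hb : b' * b = 1) :
    IsSpecialUnit t b' := by
  obtain ⟨u, hu⟩ := h.1
  refine ⟨⟨u⁻¹, ?_⟩, fun ht => by rwa [h.2 ht, mul_one] at hb⟩
  rw [← hu] at hb
  exact (Units.eq_inv_of_mul_eq_one_right hb).symm

lemma IsSpecialUnit.op {b : B} (h : IsSpecialUnit t b) : IsSpecialUnit t (MulOpposite.op b) :=
  ⟨h.1.op, fun ht => by rw [h.2 ht, MulOpposite.op_one]⟩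

end

variable {k : Type u} [Field k]

/-- `ι : O → L` is universal among the algebra maps that send `g₁` and `g₂` to units, respectively
(if `t` holds) to `1`. -/
structure IsUniversalInverting (t : Prop) {O : Type u} [Ring O] [Algebra k O] (g₁ g₂ : O)
    {L : Type u} [Ring L] [Algebra k L] (ι : O →ₐ[k] L) : Prop where
  left : IsSpecialUnit t (ι g₁)
  right : IsSpecialUnit t (ι g₂)
  exists_lift : ∀ {B : Type u} [Ring B] [Algebra k B] (φ : O →ₐ[k] B), IsSpecialUnit t (φ g₁) →
    IsSpecialUnit t (φ g₂) → ∃ ψ : L →ₐ[k] B, ψ.comp ι = φ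
  hom_ext : ∀ {B : Type u} [Ring B] [Algebra k B] {ψ ψ' : L →ₐ[k] B},
    ψ.comp ι = ψ'.comp ι → ψ = ψ'

namespace IsUniversalInverting

variable {t : Prop} {O : Type u} [Ring O] {g₁ g₂ : O} {L : Type u} [Ring L]

lemma isSpecialUnit_subtype {A : Type u} [Ring A] [Algebra k A] {H : Subalgebra k A} {x : A}
    (hx : IsSpecialUnit t x) (hxH : x ∈ H) (h : ∀ y, x * y = 1 → y * x = 1 → y ∈ H) :
    IsSpecialUnit t (⟨x, hxH⟩ : H) := by
  obtain ⟨⟨u, hu⟩, ht⟩ := hx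
  refine ⟨⟨⟨⟨x, hxH⟩, ⟨(u⁻¹ : Aˣ), h _ (by simp [← hu]) (by simp [← hu])⟩, ?_, ?_⟩, rfl⟩,
    fun h => Subtype.ext (ht h)⟩
  · exact Subtype.ext (by simp [← hu])
  · exact Subtype.ext (by simp [← hu])

/-- When `H` contains the inverses, the corestriction `O → H` lifts to `L → H`, and by uniqueness
the composite with the inclusion is the identity. -/
lemma eq_top [Algebra k O] [Algebra k L] {ι : O →ₐ[k] L} (h : IsUniversalInverting t g₁ g₂ ι)
    (H : Subalgebra k L) (hι : ∀ x, ι x ∈ H)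
    (h₁ : ∀ y, ι g₁ * y = 1 → y * ι g₁ = 1 → y ∈ H)
    (h₂ : ∀ y, ι g₂ * y = 1 → y * ι g₂ = 1 → y ∈ H) : H = ⊤ := by
  obtain ⟨ψ, hψ⟩ := h.exists_lift (ι.codRestrict H hι) (isSpecialUnit_subtype h.left (hι _) h₁)
    (isSpecialUnit_subtype h.right (hι _) h₂)
  have h3 : H.val.comp ψ = AlgHom.id k L := h.hom_ext (by
    rw [AlgHom.comp_assoc, hψ]
    rfl)
  refine eq_top_iff.mpr fun x _ => ?_
  have := AlgHom.congr_fun h3 x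
  rw [AlgHom.id_apply] at this
  rw [← this]
  exact (ψ x).2

section Bialgebra

variable [Bialgebra k O] [Algebra k L] {ι : O →ₐ[k] L}

lemma isSpecialUnit_tmul {x y : L} (hx : IsSpecialUnit t x) (hy : IsSpecialUnit t y) :
    IsSpecialUnit t (x ⊗ₜ[k] y) := by
  have h1 := (hx.map (Algebra.TensorProduct.includeLeft : L →ₐ[k] L ⊗[k] L)).mul
    (hy.map (Algebra.TensorProduct.includeRight : L →ₐ[k] L ⊗[k] L))
  simpa using h1

lemma exists_comul (h : IsUniversalInverting t g₁ g₂ ι)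
    (hg₁ : IsGroupLikeElem k g₁) (hg₂ : IsGroupLikeElem k g₂) : ∃ Δ : L →ₐ[k] L ⊗[k] L,
    Δ.comp ι = (Algebra.TensorProduct.map ι ι).comp (Bialgebra.comulAlgHom k O) := by
  refine h.exists_lift _ ?_ ?_
  · simpa [hg₁.comul_eq_tmul_self] using isSpecialUnit_tmul h.left h.left
  · simpa [hg₂.comul_eq_tmul_self] using isSpecialUnit_tmul h.right h.right

lemma exists_counit (h : IsUniversalInverting t g₁ g₂ ι)
    (hg₁ : IsGroupLikeElem k g₁) (hg₂ : IsGroupLikeElem k g₂) : ∃ ε : L →ₐ[k] k, ε.comp ι = Bialgebra.counitAlgHom k O := by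
  refine h.exists_lift _ ?_ ?_
  · simpa [hg₁.counit_eq_one] using IsSpecialUnit.one
  · simpa [hg₂.counit_eq_one] using IsSpecialUnit.one

end Bialgebra

end IsUniversalInverting

end UniversalInverting

/-! ## Bialgebra and Hopf structures on universal localizations and quotients -/

section HopfStructure

variable {k : Type u} [Field k]

namespace IsUniversalInverting

section Bialgebra

variable {t : Prop} {O : Type u} [Ring O] [Bialgebra k O] {g₁ g₂ : O} {L : Type u} [Ring L]
  [Algebra k L] {ι : O →ₐ[k] L}

open Algebra.TensorProduct in
/-- The structure maps of the bialgebra structure for which `ι` is a bialgebra map. -/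
lemma exists_bialgebra (h : IsUniversalInverting t g₁ g₂ ι)
    (hg₁ : IsGroupLikeElem k g₁) (hg₂ : IsGroupLikeElem k g₂) :
    ∃ (Δ : L →ₐ[k] L ⊗[k] L) (ε : L →ₐ[k] k),
      (Δ.comp ι = (map ι ι).comp (Bialgebra.comulAlgHom k O) ∧
      ε.comp ι = Bialgebra.counitAlgHom k O) ∧
      (Algebra.TensorProduct.assoc k k k L L L).toAlgHom.comp ((map Δ (.id k L)).comp Δ) =
        (map (.id k L) Δ).comp Δ ∧
      (map ε (.id k L)).comp Δ = (Algebra.TensorProduct.lid k L).symm ∧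
      (map (.id k L) ε).comp Δ = (Algebra.TensorProduct.rid k k L).symm := by
  obtain ⟨Δ, hΔ⟩ := h.exists_comul hg₁ hg₂
  obtain ⟨ε, hε⟩ := h.exists_counit hg₁ hg₂
  have hΔ' : ∀ x, Δ (ι x) = map ι ι (Bialgebra.comulAlgHom k O x) := AlgHom.congr_fun hΔ
  have hε' : ∀ x, ε (ι x) = Bialgebra.counitAlgHom k O x := AlgHom.congr_fun hε
  -- By uniqueness of lifts each coalgebra axiom need only be checked on the image of `ι`, where it
  -- comes from `O`.
  refine ⟨Δ, ε, ⟨hΔ, hε⟩, h.hom_ext (AlgHom.ext fun x => ?_), h.hom_ext (AlgHom.ext fun x => ?_),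
    h.hom_ext (AlgHom.ext fun x => ?_)⟩
  · have h1 : (map ι (map ι ι)) (TensorProduct.assoc k O O O (map (Bialgebra.comulAlgHom k O)
        (.id k O) (Bialgebra.comulAlgHom k O x))) = (map ι (map ι ι))
        (map (.id k O) (Bialgebra.comulAlgHom k O) (Bialgebra.comulAlgHom k O x)) :=
      congrArg _ (Coalgebra.coassoc_apply (R := k) x)
    have h2 : ∀ X : O ⊗[k] O, TensorProduct.assoc k L L L (map Δ (.id k L) (map ι ι X)) =
        map ι (map ι ι) (TensorProduct.assoc k O O O (map (Bialgebra.comulAlgHom k O)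
          (.id k O) X)) := by
      intro X
      induction X with
      | zero => simp
      | add X Y hX hY => simp only [map_add, hX, hY]
      | tmul x y =>
        rw [map_tmul, map_tmul, map_tmul, hΔ']
        generalize Bialgebra.comulAlgHom k O x = Z
        induction Z with
        | zero => simp
        | add X Y hX hY => simp only [map_add, TensorProduct.add_tmul, hX, hY]
        | tmul z w => simp
    have h3 : ∀ X : O ⊗[k] O, map (.id k L) Δ (map ι ι X) =
        map ι (map ι ι) (map (.id k O) (Bialgebra.comulAlgHom k O) X) := by
      intro X
      induction X with
      | zero => simp
      | add X Y hX hY => simp only [map_add, hX, hY]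
      | tmul x y => rw [map_tmul, map_tmul, map_tmul, map_tmul, hΔ', AlgHom.id_apply,
          AlgHom.id_apply]
    simp only [AlgHom.comp_apply, hΔ']
    exact (h2 _).trans (h1.trans (h3 _).symm)
  · have h1 : map (.id k k) ι (map (Bialgebra.counitAlgHom k O) (.id k O)
        (Bialgebra.comulAlgHom k O x)) = map (.id k k) ι (1 ⊗ₜ[k] x) :=
      congrArg _ (Coalgebra.rTensor_counit_comul (R := k) x)
    have h2 : ∀ X : O ⊗[k] O, map ε (.id k L) (map ι ι X) =
        map (.id k k) ι (map (Bialgebra.counitAlgHom k O) (.id k O) X) := by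
      intro X
      induction X with
      | zero => simp
      | add X Y hX hY => simp only [map_add, hX, hY]
      | tmul x y => rw [map_tmul, map_tmul, map_tmul, map_tmul, hε', AlgHom.id_apply,
          AlgHom.id_apply, AlgHom.id_apply]
    simp only [AlgHom.comp_apply, hΔ']
    exact (h2 _).trans h1
  · have h1 : map ι (.id k k) (map (.id k O) (Bialgebra.counitAlgHom k O)
        (Bialgebra.comulAlgHom k O x)) = map ι (.id k k) (x ⊗ₜ[k] 1) :=
      congrArg _ (Coalgebra.lTensor_counit_comul (R := k) x)
    have h2 : ∀ X : O ⊗[k] O, map (.id k L) ε (map ι ι X) =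
        map ι (.id k k) (map (.id k O) (Bialgebra.counitAlgHom k O) X) := by
      intro X
      induction X with
      | zero => simp
      | add X Y hX hY => simp only [map_add, hX, hY]
      | tmul x y => rw [map_tmul, map_tmul, map_tmul, map_tmul, hε', AlgHom.id_apply,
          AlgHom.id_apply, AlgHom.id_apply]
    simp only [AlgHom.comp_apply, hΔ']
    exact (h2 _).trans h1

/-- `ι` is a bialgebra map for a suitable bialgebra structure. -/
lemma exists_bialgHom (h : IsUniversalInverting t g₁ g₂ ι)
    (hg₁ : IsGroupLikeElem k g₁) (hg₂ : IsGroupLikeElem k g₂) :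
    ∃ (L' : Type u) (_ : Ring L') (_ : Bialgebra k L') (ι' : O →ₐc[k] L') (E : L ≃+* L'),
      (ι' : O →+* L') = (E : L →+* L').comp (ι : O →+* L) ∧
      IsUniversalInverting t g₁ g₂ (ι' : O →ₐ[k] L') := by
  obtain ⟨Δ, ε, ⟨hΔ, hε⟩, h1, h2, h3⟩ := h.exists_bialgebra hg₁ hg₂
  exact ⟨L, inferInstance, Bialgebra.ofAlgHom Δ ε h1 h2 h3,
    @BialgHom.ofAlgHom k O L _ _ _ _ (Bialgebra.ofAlgHom Δ ε h1 h2 h3) ι hε hΔ.symm,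
    RingEquiv.refl L, rfl, h⟩

end Bialgebra

end IsUniversalInverting

end HopfStructure

/-! ### Antipode and universal property for localizations and quotients of `O(M)` -/

section QuantumGroups

variable {k : Type u} [Field k] {n m : ℕ} {e f : (Fin m → Fin n) → k} {N : ℕ}

lemma OM.map_mem {L : Type u} [Ring L] [Algebra k L] (φ : OM e f N →ₐ[k] L) (H : Subalgebra k L)
    (h : ∀ i j, φ (OM.z e f N i j) ∈ H) (x : OM e f N) : φ x ∈ H := by
  obtain ⟨y, rfl⟩ := RingQuot.mkAlgHom_surjective k (OMRel e f N) x
  have h1 : Algebra.adjoin k (Set.range (FreeAlgebra.ι k (X := Fin n × Fin n))) ≤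
      H.comap (φ.comp (RingQuot.mkAlgHom k (OMRel e f N))) := by
    refine Algebra.adjoin_le ?_
    rintro _ ⟨p, rfl⟩
    exact h p.1 p.2
  rw [FreeAlgebra.adjoin_range_ι] at h1
  exact h1 (Algebra.mem_top (x := y))

lemma OM.map_g₁ {L : Type u} [Ring L] [Algebra k L] (φ : OM e f N →ₐ[k] L) (j : Fin m → Fin n) :
    φ (OM.g₁ e f N j) = codet e j fun p q => φ (OM.z e f N p q) :=
  map_codet φ _

lemma OM.map_g₂ {L : Type u} [Ring L] [Algebra k L] (φ : OM e f N →ₐ[k] L) (j : Fin m → Fin n) :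
    φ (OM.g₂ e f N j) = codet f j fun p q => φ (OM.z e f N q p) :=
  map_codet φ fun p q => OM.z e f N q p

lemma OM.liftMatrix_g₁ {L : Type u} [Ring L] [Algebra k L] {a : Fin n → Fin n → L}
    (h : IsCompatible e N a) (h' : IsCompatible f N fun p q => a q p) (j : Fin m → Fin n) :
    OM.liftMatrix a h h' (OM.g₁ e f N j) = codet e j a := by
  rw [OM.map_g₁]
  simp only [OM.liftMatrix_z]

lemma OM.liftMatrix_g₂ {L : Type u} [Ring L] [Algebra k L] {a : Fin n → Fin n → L}
    (h : IsCompatible e N a) (h' : IsCompatible f N fun p q => a q p) (j : Fin m → Fin n) :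
    OM.liftMatrix a h h' (OM.g₂ e f N j) = codet f j fun p q => a q p := by
  rw [OM.map_g₂]
  simp only [OM.liftMatrix_z]

variable {t : Prop} {j j' : Fin m → Fin n} {L : Type u} [Ring L]

/-- The universal localization (or quotient) of `O(M)` is a Hopf algebra. -/
lemma IsUniversalInverting.exists_antipode (he : IsSpanningPotential e N)
    (hf : IsSpanningPotential f N) (hm : m ≠ 0) (hj : e j ≠ 0) (hj' : f j' ≠ 0) [Bialgebra k L]
    {ι : OM e f N →ₐc[k] L} (h : IsUniversalInverting t (OM.g₁ e f N j) (OM.g₂ e f N j')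
      (ι : OM e f N →ₐ[k] L)) : ∃ S : L →ₐ[k] Lᵐᵒᵖ, antipodeSubalgebra S = ⊤ := by
  let a : Fin n → Fin n → L := fun p q => ι (OM.z e f N p q)
  have ha : IsCompatible e N a := (OM.isCompatible_z e f N).map (ι : OM e f N →ₐ[k] L)
  have ha' : IsCompatible f N fun p q => a q p :=
    (OM.isCompatible_z_transpose e f N).map (ι : OM e f N →ₐ[k] L)
  have hg₁ : (ι : OM e f N →ₐ[k] L) (OM.g₁ e f N j) = codet e j a := OM.map_g₁ _ _
  have hg₂ : (ι : OM e f N →ₐ[k] L) (OM.g₂ e f N j') = codet f j' fun p q => a q p :=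
    OM.map_g₂ _ _
  have hu₁ := h.left
  have hu₂ := h.right
  rw [hg₁] at hu₁
  rw [hg₂] at hu₂
  have hmul : IsMultiplicativeMatrix (k := k) a := (OM.isMultiplicativeMatrix_z e f N).map ι
  obtain ⟨s, hs, hs'⟩ := exists_inverse he hf hm hj hj' ha ha' hu₁.1 hu₂.1
  have hc := he.isCompatible_inverse hj ha hu₁.1 hs'
  have hc' := hf.isCompatible_inverse_transpose hj' ha' hu₂.1 hs
  -- These are the images of `g₁` and `g₂` under the candidate antipode; as inverses of the
  -- codeterminants they are again units, and equal to `1` when `t` holds.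
  have hv₁ := (hu₁.of_mul_eq_one (codet_mul_codet_inverse he hj ha hs')).op
  have hv₂ := (hu₂.of_mul_eq_one' (codet_inverse_mul_codet hf hj' ha' hs)).op
  rw [MulOpposite.op_unop] at hv₁ hv₂
  obtain ⟨S, hS⟩ := h.exists_lift (OM.liftMatrix (fun p q => MulOpposite.op (s p q)) hc hc')
    (by rwa [OM.liftMatrix_g₁])
    (by rwa [OM.liftMatrix_g₂])
  have hSa : ∀ p q, S (a p q) = MulOpposite.op (s p q) := fun p q => by
    have h1 := AlgHom.congr_fun hS (OM.z e f N p q)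
    rwa [OM.liftMatrix_z] at h1
  have hι : ∀ x, (ι : OM e f N →ₐ[k] L) x ∈ antipodeSubalgebra S :=
    OM.map_mem _ _ (mem_antipodeSubalgebra_of_isMultiplicativeMatrix hmul hSa hs hs')
  -- The antipode axioms hold on the generators by construction and on the inverses of `g₁`, `g₂`
  -- because these elements are group-like.
  refine ⟨S, h.eq_top _ hι (fun y hy hy' => ?_) fun y hy hy' => ?_⟩
  · refine mem_antipodeSubalgebra_of_mul_eq_one ?_ (hι (OM.g₁ e f N j)) hy hy'
    rw [hg₁]
    exact hmul.isGroupLikeElem he hj ha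
  · refine mem_antipodeSubalgebra_of_mul_eq_one ?_ (hι (OM.g₂ e f N j')) hy hy'
    rw [hg₂]
    exact hmul.isGroupLikeElem_transpose hf hj' ha'

/-- The Hopf algebra structure on a universal localization (or quotient) of `O(M)`. -/
noncomputable abbrev IsUniversalInverting.hopfAlgebra (he : IsSpanningPotential e N)
    (hf : IsSpanningPotential f N) (hm : m ≠ 0) (hj : e j ≠ 0) (hj' : f j' ≠ 0) [Bialgebra k L]
    {ι : OM e f N →ₐc[k] L} (h : IsUniversalInverting t (OM.g₁ e f N j) (OM.g₂ e f N j')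
      (ι : OM e f N →ₐ[k] L)) : HopfAlgebra k L :=
  hopfAlgebraOfAntipodeSubalgebra (h.exists_antipode he hf hm hj hj').choose_spec

variable [NeZero N]

/-- The common form of `IsQuantumGL` (for `t = False`) and `IsQuantumSL` (for `t = True`). -/
structure IsUniversalBalanced (t : Prop) (d : ℕ) {H : Type u} [Ring H] [HopfAlgebra k H]
    (ρl : SPAlg e N →ₐ[k] H ⊗[k] SPAlg e N) (ρr : SPAlg f N →ₐ[k] SPAlg f N ⊗[k] H) : Prop where
  balanced : IsBalancedCoaction ρl ρr
  trivial_codeterminants : t → HasTrivialCodeterminants d ρl ρr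
  universal : ∀ (K : Type u) [Ring K] [HopfAlgebra k K]
    (σl : SPAlg e N →ₐ[k] K ⊗[k] SPAlg e N) (σr : SPAlg f N →ₐ[k] SPAlg f N ⊗[k] K),
    IsBalancedCoaction σl σr → (t → HasTrivialCodeterminants d σl σr) →
    ∃! φ : H →ₐc[k] K, IntertwinesCoactions φ ρl ρr σl σr

lemma isQuantumGL_iff (d : ℕ) {H : Type u} [Ring H] [HopfAlgebra k H]
    {ρl : SPAlg e N →ₐ[k] H ⊗[k] SPAlg e N} {ρr : SPAlg f N →ₐ[k] SPAlg f N ⊗[k] H} :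
    IsQuantumGL ρl ρr ↔ IsUniversalBalanced False d ρl ρr :=
  ⟨fun h => ⟨h.1, False.elim, fun K _ _ σl σr hσ _ => h.2 K σl σr hσ⟩,
    fun h => ⟨h.1, fun K _ _ σl σr hσ => h.3 K σl σr hσ False.elim⟩⟩

lemma isQuantumSL_iff (d : ℕ) {H : Type u} [Ring H] [HopfAlgebra k H]
    {ρl : SPAlg e N →ₐ[k] H ⊗[k] SPAlg e N} {ρr : SPAlg f N →ₐ[k] SPAlg f N ⊗[k] H} :
    IsQuantumSL d ρl ρr ↔ IsUniversalBalanced True d ρl ρr :=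
  ⟨fun h => ⟨h.1, fun _ => h.2, fun K _ _ σl σr hσ h' => h.3 K σl σr hσ (h' trivial)⟩,
    fun h => ⟨h.1, h.2 trivial, fun K _ _ σl σr hσ h' => h.3 K σl σr hσ fun _ => h'⟩⟩

/-- The hypothesis that the homological codeterminants are given by the elements `codet`. -/
def CodeterminantCriterion (e f : (Fin m → Fin n) → k) (N d : ℕ) [NeZero N]
    (j j' : Fin m → Fin n) : Prop :=
  ∀ ⦃K : Type u⦄ [Ring K] [Bialgebra k K] {σl : SPAlg e N →ₐ[k] K ⊗[k] SPAlg e N}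
    {σr : SPAlg f N →ₐ[k] SPAlg f N ⊗[k] K} {a : Fin n → Fin n → K}, HasMatrix σl σr a →
    (HasTrivialCodeterminants d σl σr ↔ codet e j a = 1 ∧ codet f j' (fun p q => a q p) = 1)

/-- A competing Hopf algebra gives a map out of `O(M)`. It inverts `g₁` and `g₂`, since group-like
elements of a Hopf algebra are units, and trivial codeterminants mean that both go to `1`; so it
factors through `L`. Any map intertwining the coactions has prescribed values on the generators,
whence uniqueness. -/
theorem IsUniversalInverting.isUniversalBalanced (hN : 2 ≤ N) {d : ℕ}
    (hd : CodeterminantCriterion e f N d j j') (he : IsSpanningPotential e N)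
    (hf : IsSpanningPotential f N) (hj : e j ≠ 0) (hj' : f j' ≠ 0) [HopfAlgebra k L]
    {ι : OM e f N →ₐc[k] L} (h : IsUniversalInverting t (OM.g₁ e f N j) (OM.g₂ e f N j')
      (ι : OM e f N →ₐ[k] L)) {ρl : SPAlg e N →ₐ[k] L ⊗[k] SPAlg e N}
    {ρr : SPAlg f N →ₐ[k] SPAlg f N ⊗[k] L}
    (hρ : HasMatrix ρl ρr fun p q => ι (OM.z e f N p q)) :
    IsUniversalBalanced t d ρl ρr where
  balanced := hρ.isBalancedCoaction ((OM.isMultiplicativeMatrix_z e f N).map ι)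
  trivial_codeterminants ht := (hd hρ).mpr
    ⟨(OM.map_g₁ (ι : OM e f N →ₐ[k] L) j).symm.trans (h.left.2 ht),
      (OM.map_g₂ (ι : OM e f N →ₐ[k] L) j').symm.trans (h.right.2 ht)⟩
  universal K _ _ σl σr hσ hσt := by
    obtain ⟨a, ha⟩ := hσ.balanced
    have hmul := ha.isMultiplicativeMatrix hN hσ.left
    have hc := ha.isCompatible
    have hc' := ha.isCompatible_transpose
    obtain ⟨ψ, hψ⟩ := h.exists_lift (OM.liftMatrix a hc hc')
      (by
        rw [OM.liftMatrix_g₁]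
        exact ⟨(hmul.isGroupLikeElem he hj hc).isUnit, fun ht => ((hd ha).mp (hσt ht)).1⟩)
      (by
        rw [OM.liftMatrix_g₂]
        exact ⟨(hmul.isGroupLikeElem_transpose hf hj' hc').isUnit,
          fun ht => ((hd ha).mp (hσt ht)).2⟩)
    have hψa : ∀ p q, ψ (ι (OM.z e f N p q)) = a p q := fun p q => by
      have h3 := AlgHom.congr_fun hψ (OM.z e f N p q)
      rwa [OM.liftMatrix_z] at h3
    have hmul' : IsMultiplicativeMatrix (k := k) fun p q =>
        (ψ.comp (ι : OM e f N →ₐ[k] L)) (OM.z e f N p q) := by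
      rw [hψ]
      simpa only [OM.liftMatrix_z] using hmul
    have hι : IsMultiplicativeMatrix (k := k) fun p q =>
        (ι : OM e f N →ₐ[k] L) (OM.z e f N p q) := (OM.isMultiplicativeMatrix_z e f N).map ι
    let Ψ : L →ₐc[k] K := BialgHom.ofAlgHom ψ
      (h.hom_ext (by rw [AlgHom.comp_assoc, OM.counit_comp_eq hmul', OM.counit_comp_eq hι]))
      (h.hom_ext (by
        rw [AlgHom.comp_assoc, AlgHom.comp_assoc, ← OM.map_comul_eq hmul', ← OM.map_comul_eq hι,
          ← AlgHom.comp_assoc, ← Algebra.TensorProduct.map_comp]))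
    refine ⟨Ψ, hρ.intertwines ha Ψ hψa, fun φ hφ => ?_⟩
    have h4 : (φ : L →ₐ[k] K) = ψ := h.hom_ext (OM.hom_ext fun p q =>
      (hφ.map_matrix hN hρ ha p q).trans (hψa p q).symm)
    exact BialgHom.ext fun x => AlgHom.congr_fun h4 x

/-- The two universal maps compose to endomorphisms fixing the coaction matrices, which are
identities by uniqueness. -/
lemma IsUniversalBalanced.exists_equiv (hN : 2 ≤ N) {d : ℕ} {H : Type u} [Ring H] [HopfAlgebra k H]
    {ρl : SPAlg e N →ₐ[k] H ⊗[k] SPAlg e N} {ρr : SPAlg f N →ₐ[k] SPAlg f N ⊗[k] H}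
    (hρ : IsUniversalBalanced t d ρl ρr) [HopfAlgebra k L]
    {σl : SPAlg e N →ₐ[k] L ⊗[k] SPAlg e N} {σr : SPAlg f N →ₐ[k] SPAlg f N ⊗[k] L}
    (hσ : IsUniversalBalanced t d σl σr) :
    ∃ Φ : H ≃ₐc[k] L, ∀ a a', HasMatrix ρl ρr a → HasMatrix σl σr a' →
      ∀ p q, Φ (a p q) = a' p q := by
  obtain ⟨a, ha⟩ := hρ.balanced.balanced
  obtain ⟨a', ha'⟩ := hσ.balanced.balanced
  obtain ⟨φ, hφ, -⟩ := hρ.universal L σl σr hσ.balanced hσ.trivial_codeterminants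
  obtain ⟨ψ, hψ, -⟩ := hσ.universal H ρl ρr hρ.balanced hρ.trivial_codeterminants
  refine ⟨BialgEquiv.ofBialgHom φ ψ ?_ ?_, fun b b' hb hb' => hφ.map_matrix hN hb hb'⟩
  · refine (hσ.universal L σl σr hσ.balanced hσ.trivial_codeterminants).unique
      (ha'.intertwines ha' _ fun p q => ?_) (ha'.intertwines ha' _ fun _ _ => rfl)
    rw [BialgHom.comp_apply, hψ.map_matrix hN ha' ha, hφ.map_matrix hN ha ha']
  · refine (hρ.universal H ρl ρr hρ.balanced hρ.trivial_codeterminants).unique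
      (ha.intertwines ha _ fun p q => ?_) (ha.intertwines ha _ fun _ _ => rfl)
    rw [BialgHom.comp_apply, hφ.map_matrix hN ha ha', hψ.map_matrix hN ha' ha]

end QuantumGroups

/-! ## Rings of right fractions -/

section Fractions

open OreLocalization

section

variable {R : Type*} [Ring R] {S : Submonoid R}

/-- A right Ore set is a left Ore set of the opposite ring. -/
lemma IsRightOreSet.nonempty_oreSet (h : IsRightOreSet S) : Nonempty (OreSet S.op) := by
  refine nonempty_oreSet_iff.mpr ⟨fun r₁ r₂ s hs => ?_, fun r s => ?_⟩
  · have h1 : s.1.unop * (r₁.unop - r₂.unop) = 0 := by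
      rw [mul_sub, ← MulOpposite.unop_mul, ← MulOpposite.unop_mul, hs, sub_self]
    obtain ⟨s', hs', h2⟩ := h.reversible _ _ s.2 h1
    rw [sub_mul, sub_eq_zero] at h2
    exact ⟨⟨MulOpposite.op s', hs'⟩, MulOpposite.unop_injective h2⟩
  · obtain ⟨r', s', hs', h1⟩ := h.ore r.unop s.1.unop s.2
    exact ⟨MulOpposite.op r', ⟨MulOpposite.op s', hs'⟩, MulOpposite.unop_injective h1⟩

variable [OreSet S.op] {B : Type*} [Ring B]

/-- Right fractions are left fractions over the opposite ring; read in `B`, the formula says that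
the fraction goes to `φ(r) φ(s)⁻¹`. -/
lemma exists_universalHom (φ : R →+* B) (hφ : ∀ s ∈ S, IsUnit (φ s)) :
    ∃ U : OreLocalization S.op Rᵐᵒᵖ →+* Bᵐᵒᵖ, ∀ (r : R) (s : R) (hs : s ∈ S),
      (U (MulOpposite.op r /ₒ (⟨MulOpposite.op s, hs⟩ : S.op))).unop * φ s = φ r := by
  let fS : S.op →* Bᵐᵒᵖˣ := IsUnit.liftRight ((φ.op : Rᵐᵒᵖ →* Bᵐᵒᵖ).comp S.op.subtype)
    fun s => (hφ _ s.2).op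
  have hfS : ∀ s : S.op, φ.op s = fS s := fun _ => rfl
  refine ⟨universalHom φ.op fS hfS, fun r s hs => ?_⟩
  rw [universalHom_apply]
  have h1 : MulOpposite.op (φ s) = fS ⟨MulOpposite.op s, hs⟩ := rfl
  apply MulOpposite.op_injective
  rw [MulOpposite.op_mul, MulOpposite.op_unop, h1, Units.mul_inv_cancel_left]
  rfl

/-- The kernel condition gives injectivity and the fraction form of elements gives surjectivity, so
every ring of right fractions is the concrete one. -/
lemma IsRightRingOfFractions.bijective {φ : R →+* B} (hφ : IsRightRingOfFractions S φ)
    {U : OreLocalization S.op Rᵐᵒᵖ →+* Bᵐᵒᵖ}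
    (hU : ∀ (r : R) (s : R) (hs : s ∈ S),
      (U (MulOpposite.op r /ₒ (⟨MulOpposite.op s, hs⟩ : S.op))).unop * φ s = φ r) :
    Function.Bijective U := by
  constructor
  · refine (injective_iff_map_eq_zero U).mpr fun q hq => ?_
    induction q using OreLocalization.ind with | _ r s
    have h1 := hU r.unop s.1.unop s.2
    have h2 : φ r.unop = 0 := by
      rw [← h1]
      exact (congrArg (fun q => q.unop * φ s.1.unop) hq).trans (zero_mul _)
    obtain ⟨s', hs', h3⟩ := hφ.ker _ h2
    rw [OreLocalization.expand' r s ⟨MulOpposite.op s', hs'⟩]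
    have h4 : (⟨MulOpposite.op s', hs'⟩ : S.op) • r = 0 := MulOpposite.unop_injective h3
    rw [h4, zero_oreDiv]
  · intro q
    obtain ⟨r, s, hs, h1⟩ := hφ.surj q.unop
    refine ⟨MulOpposite.op r /ₒ (⟨MulOpposite.op s, hs⟩ : S.op), ?_⟩
    apply MulOpposite.unop_injective
    exact (hφ.isUnit s hs).mul_right_cancel ((hU r s hs).trans h1.symm)

end

variable {k : Type u} [Field k] {R : Type u} [Ring R] [Algebra k R]

lemma IsRightRingOfFractions.algHom_ext {S : Submonoid R} {L : Type u} [Ring L] [Algebra k L]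
    {φ : R →ₐ[k] L} (hφ : IsRightRingOfFractions S (φ : R →+* L)) {B : Type u} [Ring B]
    [Algebra k B] {ψ ψ' : L →ₐ[k] B} (h : ψ.comp φ = ψ'.comp φ) : ψ = ψ' := by
  refine AlgHom.ext fun q => ?_
  obtain ⟨r, s, hs, h1⟩ := hφ.surj q
  have h2 : ∀ x, ψ (φ x) = ψ' (φ x) := AlgHom.congr_fun h
  refine ((hφ.isUnit s hs).map ψ).mul_right_cancel ?_
  calc ψ q * ψ (φ s) = ψ (φ r) := by rw [← map_mul]; exact congrArg ψ h1
    _ = ψ' q * ψ (φ s) := by rw [h2, h2, ← map_mul]; exact congrArg ψ' h1.symm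

lemma IsRightRingOfFractions.exists_algHom {S : Submonoid R} (hS : IsRightOreSet S) {L : Type u}
    [Ring L] [Algebra k L] {φ : R →ₐ[k] L} (hφ : IsRightRingOfFractions S (φ : R →+* L))
    {B : Type u} [Ring B] [Algebra k B] (χ : R →ₐ[k] B) (hχ : ∀ s ∈ S, IsUnit (χ s)) :
    ∃ ψ : L →ₐ[k] B, ψ.comp φ = χ := by
  let _ := hS.nonempty_oreSet.some
  obtain ⟨U, hU⟩ := exists_universalHom (φ : R →+* L) hφ.isUnit
  obtain ⟨W, hW⟩ := exists_universalHom (χ : R →+* B) hχ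
  let E := RingEquiv.ofBijective U (hφ.bijective hU)
  -- Pass from `L` to the concrete localization and then to `B`; linearity over `k` is automatic,
  -- because scalars come from `R`.
  let ψ : L →+* B := RingHom.unop (W.comp E.symm.toRingHom)
  have hψ : ∀ r, ψ (φ r) = χ r := fun r => by
    have h1 := hU r 1 S.one_mem
    have h2 := hW r 1 S.one_mem
    rw [map_one, mul_one] at h1 h2
    have h3 : E.symm (MulOpposite.op (φ r)) =
        MulOpposite.op r /ₒ (⟨MulOpposite.op 1, S.one_mem⟩ : S.op) := by
      rw [RingEquiv.symm_apply_eq]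
      exact MulOpposite.unop_injective h1.symm
    exact (congrArg (fun q => (W q).unop) h3).trans h2
  refine ⟨{ ψ with commutes' := fun r => ?_ }, AlgHom.ext hψ⟩
  have h4 := hψ (algebraMap k R r)
  rwa [AlgHom.commutes, AlgHom.commutes] at h4

lemma IsRightOreSet.exists_fractions {S : Submonoid R} (hS : IsRightOreSet S) :
    ∃ (L : Type u) (_ : Ring L) (_ : Algebra k L) (φ : R →ₐ[k] L),
      IsRightRingOfFractions S (φ : R →+* L) := by
  let _ := hS.nonempty_oreSet.some
  let ν : Rᵐᵒᵖ →+* OreLocalization S.op Rᵐᵒᵖ := numeratorRingHom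
  refine ⟨(OreLocalization S.op Rᵐᵒᵖ)ᵐᵒᵖ, inferInstance, inferInstance,
    { (ν.op.comp (RingEquiv.opOp R).toRingHom) with commutes' := fun r => rfl }, ?_, ?_, ?_⟩
  · intro s hs
    exact (numerator_isUnit (⟨MulOpposite.op s, hs⟩ : S.op)).op
  · intro q
    obtain ⟨q, rfl⟩ := MulOpposite.op_surjective q
    induction q using OreLocalization.ind with | _ r s
    refine ⟨r.unop, s.1.unop, s.2, ?_⟩
    apply MulOpposite.unop_injective
    exact OreLocalization.mul_cancel (r := r) (s := s) (t := 1)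
  · intro r hr
    have h1 : MulOpposite.op r /ₒ (1 : S.op) = (0 : Rᵐᵒᵖ) /ₒ (1 : S.op) := by
      rw [zero_oreDiv]
      exact MulOpposite.op_injective hr
    obtain ⟨u, v, h2, h3⟩ := oreDiv_eq_iff.mp h1
    have h4 : v = u := by simpa using h3.symm
    refine ⟨u.1.unop, u.2, ?_⟩
    rw [h4, smul_zero] at h2
    exact (MulOpposite.op_injective h2.symm)

lemma IsRightRingOfFractions.comp_ringEquiv {S : Submonoid R} {L L' : Type u} [Ring L] [Ring L']
    {φ : R →+* L} (h : IsRightRingOfFractions S φ) (E : L ≃+* L') :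
    IsRightRingOfFractions S ((E : L →+* L').comp φ) where
  isUnit s hs := (h.isUnit s hs).map E
  surj q := by
    obtain ⟨r, s, hs, h1⟩ := h.surj (E.symm q)
    refine ⟨r, s, hs, ?_⟩
    have h2 := congrArg E h1
    rwa [map_mul, E.apply_symm_apply] at h2
  ker r hr := h.ker r (E.injective (hr.trans (map_zero E).symm))

lemma IsRightRingOfFractions.isUniversalInverting {g₁ g₂ : R}
    (hS : IsRightOreSet (Submonoid.closure {g₁, g₂})) {L : Type u} [Ring L] [Algebra k L]
    {φ : R →ₐ[k] L} (hφ : IsRightRingOfFractions (Submonoid.closure {g₁, g₂}) (φ : R →+* L)) :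
    IsUniversalInverting False g₁ g₂ φ where
  left := ⟨hφ.isUnit _ (Submonoid.subset_closure (by simp)), False.elim⟩
  right := ⟨hφ.isUnit _ (Submonoid.subset_closure (by simp)), False.elim⟩
  exists_lift {B} _ _ χ h₁ h₂ := by
    refine hφ.exists_algHom hS χ fun s hs => ?_
    have h1 : Submonoid.closure {g₁, g₂} ≤ (IsUnit.submonoid B).comap (χ : R →* B) := by
      refine Submonoid.closure_le.mpr ?_
      rintro _ (rfl | rfl)
      exacts [h₁.1, h₂.1]
    exact h1 hs
  hom_ext h := hφ.algHom_ext h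

end Fractions

/-! ## Quotients -/

section Quotients

variable {k : Type u} [Field k] {R : Type u} [Ring R] [Algebra k R]

lemma IsQuotientBy.exists_quotient (X : Set R) :
    ∃ (L : Type u) (_ : Ring L) (_ : Algebra k L) (φ : R →ₐ[k] L),
      IsQuotientBy X (φ : R →+* L) :=
  ⟨(TwoSidedIdeal.span X).ringCon.Quotient, inferInstance, inferInstance,
    RingCon.mkₐ k _, RingCon.mk'_surjective _, TwoSidedIdeal.ker_ringCon_mk' _⟩

lemma IsQuotientBy.comp_ringEquiv {X : Set R} {L L' : Type u} [Ring L] [Ring L']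
    {φ : R →+* L} (h : IsQuotientBy X φ) (E : L ≃+* L') :
    IsQuotientBy X ((E : L →+* L').comp φ) where
  surj := E.surjective.comp h.surj
  ker := by
    rw [← h.ker]
    ext x
    simp [TwoSidedIdeal.mem_ker]

/-- A map sending `g₁` and `g₂` to `1` kills the ideal generated by `g₁ - 1` and `g₂ - 1`. -/
lemma IsQuotientBy.isUniversalInverting {g₁ g₂ : R} {L : Type u} [Ring L] [Algebra k L]
    {φ : R →ₐ[k] L} (hφ : IsQuotientBy {g₁ - 1, g₂ - 1} (φ : R →+* L)) :
    IsUniversalInverting True g₁ g₂ φ := by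
  have h : ∀ g ∈ ({g₁ - 1, g₂ - 1} : Set R), φ g = 0 := fun g hg => by
    have h1 := TwoSidedIdeal.subset_span hg
    rw [← hφ.ker] at h1
    exact (TwoSidedIdeal.mem_ker _).mp h1
  have h1 : φ g₁ = 1 := by simpa [sub_eq_zero] using h (g₁ - 1) (by simp)
  have h2 : φ g₂ = 1 := by simpa [sub_eq_zero] using h (g₂ - 1) (by simp)
  refine ⟨h1 ▸ IsSpecialUnit.one, h2 ▸ IsSpecialUnit.one, fun {B} _ _ χ h₁ h₂ => ?_,
    fun {B} _ _ ψ ψ' h => AlgHom.ext fun q => ?_⟩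
  · have h3 : RingHom.ker (φ : R →+* L) ≤ RingHom.ker (χ : R →+* B) := fun x hx => by
      have h4 : TwoSidedIdeal.span {g₁ - 1, g₂ - 1} ≤ TwoSidedIdeal.ker (χ : R →+* B) := by
        refine TwoSidedIdeal.span_le.mpr ?_
        rintro _ (rfl | rfl)
        · refine (TwoSidedIdeal.mem_ker _).mpr ((map_sub χ _ _).trans ?_)
          rw [h₁.2 trivial, map_one, sub_self]
        · refine (TwoSidedIdeal.mem_ker _).mpr ((map_sub χ _ _).trans ?_)
          rw [h₂.2 trivial, map_one, sub_self]
      rw [← hφ.ker] at h4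
      exact (TwoSidedIdeal.mem_ker _).mp (h4 ((TwoSidedIdeal.mem_ker _).mpr hx))
    let ψ : L →+* B := RingHom.liftOfSurjective (φ : R →+* L) hφ.surj ⟨χ, h3⟩
    have hψ : ∀ x, ψ (φ x) = χ x := fun x =>
      RingHom.liftOfRightInverseAux_comp_apply (φ : R →+* L) _
        (Function.rightInverse_surjInv hφ.surj) (χ : R →+* B) h3 x
    refine ⟨{ ψ with commutes' := fun r => ?_ }, AlgHom.ext hψ⟩
    have h4 := hψ (algebraMap k R r)
    rwa [AlgHom.commutes, AlgHom.commutes] at h4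
  · obtain ⟨x, rfl⟩ := hφ.surj q
    exact AlgHom.congr_fun h x

end Quotients

/-! ## The quantum groups of a pair of preregular forms -/

section Main

variable {k : Type u} [Field k] {n m : ℕ} {e f : (Fin m → Fin n) → k} {N : ℕ} [NeZero N]
  {j j' : Fin m → Fin n}

lemma IsPreregular.isSpanningPotential [NeZero m] {V : Type v} [AddCommGroup V] [Module k V]
    (b : Module.Basis (Fin n) k V) {e : MultilinearMap k (fun _ : Fin m => V) k}
    (he : IsPreregular e) {c : (Fin m → Fin n) → k} (hc : c = coeffs b e) (hN : 2 ≤ N)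
    (hNm : N ≤ m) (hK : IsNKoszul c N) {d : ℕ} (hAS : IsLeftASRegular (SPAlg.aug c N) d)
    (hmd : m = koszulDegree N d) (hd : d ≠ 0) (hj : c j ≠ 0) : IsSpanningPotential c N := by
  subst hc
  exact
    { le := hNm
      mem := he.mem_koszulSpace b N
      le_span := koszulSpace_le_span hN hK (he.mem_koszulSpace b N) hj hmd hd hAS
      exists_first_inverse := he.exists_first_inverse b
      exists_last_inverse := he.exists_last_inverse b
      smul_sum := fun hN => he.relSpace_smul_sum b hN }

/-- The flipped right coaction on `A(f, N)` is a left one with the transposed matrix, so the same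
criterion serves both algebras. -/
lemma codeterminantCriterion (he : IsSpanningPotential e N) (hf : IsSpanningPotential f N)
    (hN : 2 ≤ N) (heK : IsNKoszul e N) (hfK : IsNKoszul f N) {d : ℕ}
    (hmd : m = koszulDegree N d) (hd : d ≠ 0) (hj : e j ≠ 0) (hj' : f j' ≠ 0) :
    CodeterminantCriterion e f N d j j' := fun _ _ _ _ _ _ h =>
  and_congr (actsTriviallyOnExt_iff hN heK he.mem he.le_span hj hmd hd h.1)
    (actsTriviallyOnExt_iff hN hfK hf.mem hf.le_span hj' hmd hd h.comm_x)

lemma IsUniversalInverting.exists_universalBalanced (hN : 2 ≤ N) {t : Prop} {d : ℕ}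
    (hd : CodeterminantCriterion e f N d j j') (he : IsSpanningPotential e N)
    (hf : IsSpanningPotential f N) (hm : m ≠ 0) (hj : e j ≠ 0) (hj' : f j' ≠ 0)
    {L : Type u} [Ring L] [Algebra k L] {φ : OM e f N →ₐ[k] L}
    (h : IsUniversalInverting t (OM.g₁ e f N j) (OM.g₂ e f N j') φ) :
    ∃ (L' : Type u) (_ : Ring L') (_ : HopfAlgebra k L') (ι : OM e f N →ₐc[k] L')
      (ρl : SPAlg e N →ₐ[k] L' ⊗[k] SPAlg e N) (ρr : SPAlg f N →ₐ[k] SPAlg f N ⊗[k] L')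
      (E : L ≃+* L'), (ι : OM e f N →+* L') = (E : L →+* L').comp (φ : OM e f N →+* L) ∧
        IsUniversalBalanced t d ρl ρr ∧ HasMatrix ρl ρr fun p q => ι (OM.z e f N p q) := by
  have hz := OM.isMultiplicativeMatrix_z e f N
  obtain ⟨L', _, _, ι, E, hE, hι⟩ := h.exists_bialgHom
    (hz.isGroupLikeElem he hj (OM.isCompatible_z e f N))
    (hz.isGroupLikeElem_transpose hf hj' (OM.isCompatible_z_transpose e f N))
  have hmat := HasMatrix.coaction ((OM.isCompatible_z e f N).map (ι : OM e f N →ₐ[k] L'))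
    ((OM.isCompatible_z_transpose e f N).map (ι : OM e f N →ₐ[k] L'))
  let _ : HopfAlgebra k L' := hι.hopfAlgebra he hf hm hj hj'
  exact ⟨L', inferInstance, inferInstance, ι, _, _, E, hE,
    hι.isUniversalBalanced hN hd he hf hj hj' hmat, hmat⟩

lemma IsUniversalBalanced.exists_bialgEquiv (hN : 2 ≤ N) {t : Prop} {d : ℕ}
    (hd : CodeterminantCriterion e f N d j j') (he : IsSpanningPotential e N)
    (hf : IsSpanningPotential f N) (hm : m ≠ 0) (hj : e j ≠ 0) (hj' : f j' ≠ 0)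
    {H : Type u} [Ring H] [HopfAlgebra k H] {ρl : SPAlg e N →ₐ[k] H ⊗[k] SPAlg e N}
    {ρr : SPAlg f N →ₐ[k] SPAlg f N ⊗[k] H} (hρ : IsUniversalBalanced t d ρl ρr)
    {L : Type u} [Ring L] [Bialgebra k L] {ι : OM e f N →ₐc[k] L}
    (h : IsUniversalInverting t (OM.g₁ e f N j) (OM.g₂ e f N j') (ι : OM e f N →ₐ[k] L)) :
    ∃ Φ : H ≃ₐc[k] L, ∀ a : Fin n → Fin n → H, HasMatrix ρl ρr a →
      ∀ p q, Φ (a p q) = ι (OM.z e f N p q) := by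
  have hmat := HasMatrix.coaction ((OM.isCompatible_z e f N).map (ι : OM e f N →ₐ[k] L))
    ((OM.isCompatible_z_transpose e f N).map (ι : OM e f N →ₐ[k] L))
  let _ : HopfAlgebra k L := h.hopfAlgebra he hf hm hj hj'
  obtain ⟨Φ, hΦ⟩ := hρ.exists_equiv hN (h.isUniversalBalanced hN hd he hf hj hj' hmat)
  exact ⟨Φ, fun a ha => hΦ a _ ha hmat⟩

end Main

theorem theoremT {k : Type u} [Field k] {V : Type v} [AddCommGroup V] [Module k V]
    {n m N d : ℕ} [NeZero m] [NeZero N] (hn : 1 ≤ n) (hN : 2 ≤ N) (hNm : N ≤ m)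
    (b : Module.Basis (Fin n) k V)
    (e : MultilinearMap k (fun _ : Fin m => V) k)
    (f : MultilinearMap k (fun _ : Fin m => Module.Dual k V) k)
    (he : IsPreregular e) (hf : IsPreregular f)
    (heK : IsNKoszul (coeffs b e) N) (hfK : IsNKoszul (dualCoeffs b f) N)
    (heAS : IsASRegular (SPAlg.aug (coeffs b e) N) d)
    (hfAS : IsASRegular (SPAlg.aug (dualCoeffs b f) N) d)
    (hmd : m = koszulDegree N d)
    (j j' : Fin m → Fin n) (hj : coeffs b e j ≠ 0) (hj' : dualCoeffs b f j' ≠ 0)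
    (g₁ g₂ : OM (coeffs b e) (dualCoeffs b f) N)
    (hg₁ : g₁ = OM.g₁ (coeffs b e) (dualCoeffs b f) N j)
    (hg₂ : g₂ = OM.g₂ (coeffs b e) (dualCoeffs b f) N j') :
    (IsRightOreSet (Submonoid.closure {g₁, g₂}) →
      (∃ (L : Type u) (_ : Ring L) (_ : HopfAlgebra k L)
        (ι : OM (coeffs b e) (dualCoeffs b f) N →ₐc[k] L)
        (ρl : SPAlg (coeffs b e) N →ₐ[k] L ⊗[k] SPAlg (coeffs b e) N)
        (ρr : SPAlg (dualCoeffs b f) N →ₐ[k] SPAlg (dualCoeffs b f) N ⊗[k] L),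
        IsRightRingOfFractions (Submonoid.closure {g₁, g₂})
          (ι : OM (coeffs b e) (dualCoeffs b f) N →+* L) ∧
        IsQuantumGL ρl ρr ∧
        HasMatrix ρl ρr (fun p q => ι (OM.z (coeffs b e) (dualCoeffs b f) N p q))) ∧
      (∀ (H : Type u) [Ring H] [HopfAlgebra k H]
        (ρl : SPAlg (coeffs b e) N →ₐ[k] H ⊗[k] SPAlg (coeffs b e) N)
        (ρr : SPAlg (dualCoeffs b f) N →ₐ[k] SPAlg (dualCoeffs b f) N ⊗[k] H),
        IsQuantumGL ρl ρr →
        ∀ (L : Type u) [Ring L] [Bialgebra k L]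
          (ι : OM (coeffs b e) (dualCoeffs b f) N →ₐc[k] L),
          IsRightRingOfFractions (Submonoid.closure {g₁, g₂})
            (ι : OM (coeffs b e) (dualCoeffs b f) N →+* L) →
          ∃ Φ : H ≃ₐc[k] L, ∀ a : Fin n → Fin n → H, HasMatrix ρl ρr a →
            ∀ p q, Φ (a p q) = ι (OM.z (coeffs b e) (dualCoeffs b f) N p q))) ∧
    ((∃ (L : Type u) (_ : Ring L) (_ : HopfAlgebra k L)
        (π : OM (coeffs b e) (dualCoeffs b f) N →ₐc[k] L)
        (ρl : SPAlg (coeffs b e) N →ₐ[k] L ⊗[k] SPAlg (coeffs b e) N)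
        (ρr : SPAlg (dualCoeffs b f) N →ₐ[k] SPAlg (dualCoeffs b f) N ⊗[k] L),
        IsQuotientBy {g₁ - 1, g₂ - 1}
          (π : OM (coeffs b e) (dualCoeffs b f) N →+* L) ∧
        IsQuantumSL d ρl ρr ∧
        HasMatrix ρl ρr (fun p q => π (OM.z (coeffs b e) (dualCoeffs b f) N p q))) ∧
      (∀ (H : Type u) [Ring H] [HopfAlgebra k H]
        (ρl : SPAlg (coeffs b e) N →ₐ[k] H ⊗[k] SPAlg (coeffs b e) N)
        (ρr : SPAlg (dualCoeffs b f) N →ₐ[k] SPAlg (dualCoeffs b f) N ⊗[k] H),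
        IsQuantumSL d ρl ρr →
        ∀ (L : Type u) [Ring L] [Bialgebra k L]
          (π : OM (coeffs b e) (dualCoeffs b f) N →ₐc[k] L),
          IsQuotientBy {g₁ - 1, g₂ - 1}
            (π : OM (coeffs b e) (dualCoeffs b f) N →+* L) →
          ∃ Φ : H ≃ₐc[k] L, ∀ a : Fin n → Fin n → H, HasMatrix ρl ρr a →
            ∀ p q, Φ (a p q) = π (OM.z (coeffs b e) (dualCoeffs b f) N p q))) := by
  have hm : m ≠ 0 := NeZero.ne m
  have hd : d ≠ 0 := by
    rintro rfl
    exact hm (hmd.trans (by simp [koszulDegree]))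
  -- This makes `f` an ordinary preregular form on `V*` with its dual basis, so both forms are
  -- covered by the same results.
  have hdual : dualCoeffs b f = coeffs b.dualBasis f := by
    funext i
    simp only [dualCoeffs, coeffs, Module.Basis.coe_dualBasis]
  have he' := he.isSpanningPotential b rfl hN hNm heK heAS.left hmd hd hj
  have hf' := hf.isSpanningPotential b.dualBasis hdual hN hNm hfK hfAS.left hmd hd hj'
  have hcrit := codeterminantCriterion he' hf' hN heK hfK hmd hd hj hj'
  subst hg₁ hg₂
  refine ⟨fun hS => ⟨?_, ?_⟩, ?_, ?_⟩
  · obtain ⟨L₀, _, _, φ, hφ⟩ := hS.exists_fractions (k := k)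
    obtain ⟨L, _, _, ι, ρl, ρr, E, hE, hρ, hmat⟩ :=
      (hφ.isUniversalInverting hS).exists_universalBalanced hN hcrit he' hf' hm hj hj'
    refine ⟨L, inferInstance, inferInstance, ι, ρl, ρr, ?_, (isQuantumGL_iff d).mpr hρ, hmat⟩
    rw [hE]
    exact hφ.comp_ringEquiv E
  · intro H _ _ ρl ρr hρ L _ _ ι hι
    exact ((isQuantumGL_iff d).mp hρ).exists_bialgEquiv hN hcrit he' hf' hm hj hj'
      (IsRightRingOfFractions.isUniversalInverting (φ := (ι : OM (coeffs b e) (dualCoeffs b f) N →ₐ[k] L)) hS hι)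
  · obtain ⟨L₀, _, _, φ, hφ⟩ := IsQuotientBy.exists_quotient (k := k)
      {OM.g₁ (coeffs b e) (dualCoeffs b f) N j - 1, OM.g₂ (coeffs b e) (dualCoeffs b f) N j' - 1}
    obtain ⟨L, _, _, ι, ρl, ρr, E, hE, hρ, hmat⟩ :=
      hφ.isUniversalInverting.exists_universalBalanced hN hcrit he' hf' hm hj hj'
    refine ⟨L, inferInstance, inferInstance, ι, ρl, ρr, ?_, (isQuantumSL_iff d).mpr hρ, hmat⟩
    rw [hE]
    exact hφ.comp_ringEquiv E
  · intro H _ _ ρl ρr hρ L _ _ ι hι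
    exact ((isQuantumSL_iff d).mp hρ).exists_bialgEquiv hN hcrit he' hf' hm hj hj'
      (IsQuotientBy.isUniversalInverting (φ := (ι : OM (coeffs b e) (dualCoeffs b f) N →ₐ[k] L)) hι)
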